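/- Let $(\beta_p)_{p\ge1}$ be real numbers such that $\xi(t)=\sum_{p\ge1}\beta_p^2t^p$ satisfies $\xi(1+\epsilon)<\infty$ for some $\epsilon>0$, and let $\mu$ be a Borel probability measure on $[0,1]$. The Parisi PDE is $$\partial_tu+\frac{\xi''(t)}{2}\left(\partial_{xx}u+\mu[0,t]\,(\partial_xu)^2\right)=0\ \text{ on }(0,1)\times\mathbb R,\qquad u(1,x)=\log\cosh x .$$ A weak solution is a continuous function $u:[0,1]\times\mathbb R\to\mathbb R$ whose weak derivative $\partial_xu$ is essentially bounded and which satisfies $$0=\int_0^1\!\int_{\mathbb R}-u\,\partial_t\phi+\frac{\xi''(t)}{2}\left(u\,\partial_{xx}\phi+\mu[0,t](\partial_xu)^2\phi\right)dx\,dt+\int_{\mathbb R}\phi(1,x)\log\cosh x\,dx$$ for every $\phi\in C_c^\infty((0,1]\times\mathbb R)$. **Theorem.** There exists a unique weak solution $u$ of the Parisi PDE. For every $t\in[0,1]$ the function $u(t,\cdot)$ is smooth, and: 1. $\partial_x^ju$ is continuous and bounded on $[0,1]\times\mathbb R$ for every $j\ge1$; 2. the weak derivative $\partial_t\partial_x^ju$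 exists and belongs to $L^\infty([0,1]\times\mathbb R)$ for every $j\ge0$; 3. for every $j\ge1$, $w=\partial_x^ju$ is a weak solution of $$\partial_tw+\frac{\xi''(t)}{2}\left(\partial_{xx}w+\mu[0,t]\,\partial_x^j\big[(\partial_xu)^2\big]\right)=0\ \text{ on }(0,1)\times\mathbb R,\qquad w(1,x)=\frac{d^j}{dx^j}\log\cosh x,$$ that is, $w$ is continuous on $[0,1]\times\mathbb R$, $\partial_xw$ is essentially bounded, and for every $\phi\in C_c^\infty((0,1]\times\mathbb R)$ $$0=\int_0^1\!\int_{\mathbb R}-w\,\partial_t\phi+\frac{\xi''(t)}{2}\left(w\,\partial_{xx}\phi+\mu[0,t]\,\partial_x^j\big[(\partial_xu)^2\big]\phi\right)dx\,dt+\int_{\mathbb R}\phi(1,x)\frac{d^j}{dx^j}\log\cosh x\,dx;$$ 4. for every $x\in\mathbb R$ and every continuity point $t\in[0,1]$ of $\mu$ (that is, $\mu(\{t\})=0$), the function $s\mapsto u(s,x)$ on $[0,1]$ is differentiable at $t$ (one-sidedly if $t\in\{0,1\}$). -/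

import Mathlib

open MeasureTheory Set Function
open scoped ContDiff

noncomputable section

namespace Parisi

/-- The function `ξ(t) = ∑_{p ≥ 1} β_p² t^p`. -/
def mixture (β : ℕ+ → ℝ) (t : ℝ) : ℝ :=
  ∑' p : ℕ+, β p ^ 2 * t ^ (p : ℕ)

/-- There is `ε > 0` such that `ξ(1 + ε) < ∞`. -/
def Admissible (β : ℕ+ → ℝ) : Prop :=
  ∃ ε : ℝ, 0 < ε ∧ Summable fun p : ℕ+ => β p ^ 2 * (1 + ε) ^ (p : ℕ)

/-- The distribution function `t ↦ μ[0,t]` of a measure on `[0,1]`. -/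
def distFun (μ : Measure unitInterval) (t : ℝ) : ℝ :=
  μ.real {s : unitInterval | (s : ℝ) ≤ t}

/-- The terminal datum `log cosh`. -/
def logCosh (x : ℝ) : ℝ := Real.log (Real.cosh x)

/-- The closed strip `[0,1] × ℝ` in the variables `(t,x)`. -/
def strip : Set (ℝ × ℝ) := Icc 0 1 ×ˢ univ

/-- Real-valued test functions `φ ∈ C_c^∞(Ω)` on an open `Ω ⊆ ℝ × ℝ`, extended by zero. -/
structure IsTestFunction (Ω : Set (ℝ × ℝ)) (φ : ℝ → ℝ → ℝ) : Prop where
  smooth : ContDiff ℝ ∞ (uncurry φ)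
  hasCompactSupport : HasCompactSupport (uncurry φ)
  tsupport_subset : tsupport (uncurry φ) ⊆ Ω

/-- The time derivative `∂_t φ (t,x)`. -/
def dt (φ : ℝ → ℝ → ℝ) (t x : ℝ) : ℝ := deriv (fun s => φ s x) t

/-- The `j`-th (pointwise) space derivative `∂_x^j φ (t,x)`. -/
def dx (j : ℕ) (φ : ℝ → ℝ → ℝ) (t x : ℝ) : ℝ := iteratedDeriv j (φ t) x

/-- `q ∈ L^∞([0,1] × ℝ)`. -/
def EssBounded (q : ℝ → ℝ → ℝ) : Prop :=
  MemLp (uncurry q) ⊤ (volume.restrict strip)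

/-- `q` is the weak (distributional) derivative `∂_x w` on `(0,1) × ℝ`. -/
def IsWeakDx (w q : ℝ → ℝ → ℝ) : Prop :=
  ∀ φ : ℝ → ℝ → ℝ, IsTestFunction (Ioo 0 1 ×ˢ univ) φ →
    ∫ z in strip, w z.1 z.2 * dx 1 φ z.1 z.2 = -∫ z in strip, q z.1 z.2 * φ z.1 z.2

/-- `q` is the weak (distributional) derivative `∂_t w` on `(0,1) × ℝ`. -/
def IsWeakDt (w q : ℝ → ℝ → ℝ) : Prop :=
  ∀ φ : ℝ → ℝ → ℝ, IsTestFunction (Ioo 0 1 ×ˢ univ) φ →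
    ∫ z in strip, w z.1 z.2 * dt φ z.1 z.2 = -∫ z in strip, q z.1 z.2 * φ z.1 z.2

/-- The weak form of
`∂_t w + (ξ''/2) (∂_xx w + μ[0,t] f) = 0` on `(0,1) × ℝ`, `w(1,·) = g`.
The test functions range over `C_c^∞((0,1] × ℝ)`, that is, over the restrictions to `t ≤ 1` of
the functions in `C_c^∞((0,∞) × ℝ)`. -/
def WeakForm (β : ℕ+ → ℝ) (μ : Measure unitInterval) (w f : ℝ → ℝ → ℝ) (g : ℝ → ℝ) : Prop :=
  ∀ φ : ℝ → ℝ → ℝ, IsTestFunction (Ioi 0 ×ˢ univ) φ →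
    0 = (∫ z in strip,
          (-(w z.1 z.2 * dt φ z.1 z.2)
            + deriv (deriv (mixture β)) z.1 / 2 *
              (w z.1 z.2 * dx 2 φ z.1 z.2 + distFun μ z.1 * f z.1 z.2 * φ z.1 z.2)))
        + ∫ x, φ 1 x * g x

/-- Weak solutions of the Parisi PDE: continuous functions `u` on `[0,1] × ℝ` with essentially
bounded weak derivative `p = ∂_x u`, satisfying the weak form with nonlinear term `p²` and
terminal datum `log cosh`. Only the values of `u` on the strip matter. -/
def IsWeakSolution (β : ℕ+ → ℝ) (μ : Measure unitInterval) (u : ℝ → ℝ → ℝ) : Prop :=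
  ContinuousOn (uncurry u) strip ∧
    ∃ p : ℝ → ℝ → ℝ, EssBounded p ∧ IsWeakDx u p ∧
      WeakForm β μ u (fun t x => p t x ^ 2) logCosh

/-- `∂_x^j u` is a weak solution of the Parisi PDE differentiated `j` times in `x`, with
terminal datum `(d/dx)^j log cosh`. The derivatives of `u` are pointwise ones; this is applied to
functions `u` that are smooth in `x`. -/
def IsDifferentiatedWeakSolution (β : ℕ+ → ℝ) (μ : Measure unitInterval)
    (j : ℕ) (u : ℝ → ℝ → ℝ) : Prop :=
  ContinuousOn (uncurry (dx j u)) strip ∧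
    (∃ p : ℝ → ℝ → ℝ, EssBounded p ∧ IsWeakDx (dx j u) p) ∧
    WeakForm β μ (dx j u) (dx j fun t x => dx 1 u t x ^ 2) (iteratedDeriv j logCosh)

end Parisi

end

/-!
The solution is built through `w = ∂_x u`. In the reversed time `s = A(1) - A(t)`, where `A = ξ'`,
the equation for `w` becomes the viscous conservation law `∂_s w = ½ ∂_xx w + m (½ w²)_x` with
`w(0) = tanh` and a monotone coefficient `0 ≤ m ≤ 1`, whose Duhamel form only involves the heat
semigroup. Gaussian integration by parts moves the derivative off `w²` and costs an integrable
singularity, which the substitution `r = s (1 - a²)` in the time integral removes (`duhamel`). On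
a short time interval the Duhamel map is therefore a contraction of the bounded continuous
functions, and it commutes with translations in `x`.

Smoothness in `x` comes from that symmetry: the fixed point depends smoothly on the inhomogeneous
term (inverse function theorem for `w - B(w²) = H`), the orbit `a ↦ H(· + a)` of the inhomogeneous
term is a smooth curve in the Banach space, hence so is the orbit of the solution
(`exists_fixedPoint`). All space derivatives are thus bounded and continuous at once (`IsTower`).
The length of the interval depends only on the bound `|w| ≤ 1` on the initial datum, which is
propagated by the maximum principle `IsSol.abs_le_one`; concatenation gives a global solution
(`exists_isSol`). Integrating back in `t` yields a potential `u` all of whose space derivatives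
satisfy the differentiated equations in time-integrated form (`IsPotential`). The weak equations,
the bounded weak time derivatives and the differentiability at continuity points of `μ` follow
from these by the product rule and the fundamental theorem of calculus.

Uniqueness is an energy estimate. The difference `d` of two weak solutions satisfies `∂_t d + α
(∂_xx d + f) = 0` with `d(1) = 0` and `|f| ≤ K |∂_x d|` (`IsDifference`). Testing with products
`η(t) ρ(x - y)` turns this into time-integrated equations for the mollifications `d ⋆ ρ`, for
which the energy with weight `(1 + x²)⁻²` can be computed (`energy_identity`). Since `d` is
Lipschitz in `x`, the identity passes to the limit (`IsDifference.energy_eq`); completing the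
square absorbs the source into the dissipation, and Gronwall's inequality gives `d = 0`.
-/

open scoped BoundedContinuousFunction

namespace Parisi

/-! ### Calculus preliminaries -/

theorem hasDerivAt_integral_of_bounded {α : Type*} [MeasurableSpace α] {ν : Measure α}
    {F F' : α → ℝ → ℝ} {bound : α → ℝ} (x₀ : ℝ)
    (hF : ∀ x, AEStronglyMeasurable (fun a => F a x) ν)
    (hF' : AEStronglyMeasurable (fun a => F' a x₀) ν)
    (hint : Integrable (fun a => F a x₀) ν)
    (hb : ∀ a x, |F' a x| ≤ bound a) (hbi : Integrable bound ν)
    (hd : ∀ a x, HasDerivAt (F a) (F' a x) x) :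
    HasDerivAt (fun x => ∫ a, F a x ∂ν) (∫ a, F' a x₀ ∂ν) x₀ :=
  (hasDerivAt_integral_of_dominated_loc_of_deriv_le (F := fun x a => F a x)
    (F' := fun x a => F' a x) (s := univ) Filter.univ_mem
    (Filter.Eventually.of_forall hF) hint hF'
    (Filter.Eventually.of_forall fun a x _ => hb a x) hbi
    (Filter.Eventually.of_forall fun a x _ => hd a x)).2

/-- Product rule for two primitives normalised at the right end point `1`. -/
theorem mul_eq_add_integral {k l D E : ℝ → ℝ}
    (hk : IntervalIntegrable k volume 0 1) (hl : IntervalIntegrable l volume 0 1)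
    (hD : ∀ t ∈ Icc (0 : ℝ) 1, D t = D 1 + ∫ r in t..1, k r)
    (hE : ∀ t ∈ Icc (0 : ℝ) 1, E t = E 1 + ∫ r in t..1, l r) :
    ∀ t ∈ Icc (0 : ℝ) 1, D t * E t = D 1 * E 1 + ∫ r in t..1, (D r * l r + k r * E r) := by
  intro t ht
  have h01 : (0:ℝ) ∈ uIcc (0:ℝ) 1 := by simp
  have h11 : (1:ℝ) ∈ uIcc (0:ℝ) 1 := by simp
  have key : ∀ {k D : ℝ → ℝ}, IntervalIntegrable k volume 0 1 →
      (∀ t ∈ Icc (0 : ℝ) 1, D t = D 1 + ∫ r in t..1, k r) →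
      AbsolutelyContinuousOnInterval (fun s => D 1 - ∫ r in (1:ℝ)..s, k r) 0 1 ∧
      (∀ s ∈ Icc (0:ℝ) 1, D s = D 1 - ∫ r in (1:ℝ)..s, k r) ∧
      (∀ᵐ s, s ∈ uIcc (0:ℝ) 1 → deriv (fun s => D 1 - ∫ r in (1:ℝ)..s, k r) s = - k s) := by
    intro k D hk hD
    have h := hk.absolutelyContinuousOnInterval_intervalIntegral h11
    refine ⟨?_, ?_, ?_⟩
    · have hc : AbsolutelyContinuousOnInterval (fun _ : ℝ => D 1) 0 1 :=
        (LipschitzWith.const (D 1)).lipschitzOnWith.absolutelyContinuousOnInterval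
      exact hc.sub h
    · intro s hs
      rw [hD s hs, intervalIntegral.integral_symm 1 s]; ring
    · filter_upwards [hk.ae_hasDerivAt_integral] with s hs hs'
      exact ((hs hs' 1 h11).const_sub (D 1)).deriv
  obtain ⟨a1, e1, d1⟩ := key hk hD
  obtain ⟨a2, e2, d2⟩ := key hl hE
  have hsub : uIcc t 1 ⊆ uIcc (0:ℝ) 1 := by
    rw [uIcc_of_le ht.2, uIcc_of_le zero_le_one]; exact Icc_subset_Icc_left ht.1
  have := (a1.mono hsub).integral_deriv_mul_eq_sub (a2.mono hsub)
  simp only [intervalIntegral.integral_same, sub_zero] at this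
  rw [← e1 t ht, ← e2 t ht] at this
  have h2 : ∫ r in t..1, (D r * l r + k r * E r) = D t * E t - D 1 * E 1 := by
    rw [← neg_sub (D 1 * E 1), ← this, ← intervalIntegral.integral_neg]
    apply intervalIntegral.integral_congr_ae
    filter_upwards [d1, d2] with s h1 h2 hs
    have hs' : s ∈ uIcc (0:ℝ) 1 := hsub (uIoc_subset_uIcc hs)
    have hs'' : s ∈ Icc (0:ℝ) 1 := by rwa [uIcc_of_le zero_le_one] at hs'
    rw [h1 hs', h2 hs', ← e1 s hs'', ← e2 s hs'']
    ring
  rw [h2]; ring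

/-! ### Gaussian averages -/

/-- The standard Gaussian measure on `ℝ`. -/
noncomputable abbrev gauss : Measure ℝ := ProbabilityTheory.gaussianReal 0 1

theorem integrable_id_gauss : Integrable (fun z : ℝ => z) gauss := by
  have := (ProbabilityTheory.memLp_id_gaussianReal (μ := 0) (v := 1) 1)
  exact memLp_one_iff_integrable.1 (by simpa using! this)

theorem integrable_abs_gauss : Integrable (fun z : ℝ => |z|) gauss :=
  integrable_id_gauss.abs

theorem integrable_gauss_of_bounded {f : ℝ → ℝ} (hf : Measurable f) {C : ℝ}
    (hC : ∀ z, |f z| ≤ C) : Integrable f gauss :=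
  Integrable.of_bound hf.aestronglyMeasurable C (Filter.Eventually.of_forall hC)

theorem hasDerivAt_gaussianPDFReal (z : ℝ) :
    HasDerivAt (ProbabilityTheory.gaussianPDFReal 0 1)
      (-(z * ProbabilityTheory.gaussianPDFReal 0 1 z)) z := by
  have h : ProbabilityTheory.gaussianPDFReal 0 1 =
      fun x => (Real.sqrt (2 * Real.pi))⁻¹ * Real.exp (- x ^ 2 / 2) := by
    ext x; simp [ProbabilityTheory.gaussianPDFReal]
  rw [h]
  have := (((hasDerivAt_pow 2 z).neg.div_const 2).exp).const_mul (Real.sqrt (2 * Real.pi))⁻¹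
  convert! this using 1
  simp; ring

theorem integrable_mul_gaussianPDFReal {f : ℝ → ℝ} (hf : Integrable f gauss) :
    Integrable (fun z => f z * ProbabilityTheory.gaussianPDFReal 0 1 z) := by
  rw [gauss, ProbabilityTheory.gaussianReal_of_var_ne_zero 0 one_ne_zero] at hf
  rw [integrable_withDensity_iff_integrable_smul' (ProbabilityTheory.measurable_gaussianPDF 0 1)
    (by simp [ProbabilityTheory.gaussianPDF])] at hf
  refine hf.congr (Filter.Eventually.of_forall fun z => ?_)
  simp [ProbabilityTheory.toReal_gaussianPDF, mul_comm]

theorem integral_gauss (f : ℝ → ℝ) :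
    ∫ z, f z ∂gauss = ∫ z, f z * ProbabilityTheory.gaussianPDFReal 0 1 z := by
  rw [gauss, ProbabilityTheory.integral_gaussianReal_eq_integral_smul one_ne_zero]
  simp [mul_comm]

/-- Gaussian integration by parts. -/
theorem integral_mul_id_gauss {f f' : ℝ → ℝ} (hd : ∀ z, HasDerivAt f (f' z) z)
    (hf' : Measurable f') {C C' : ℝ} (hC : ∀ z, |f z| ≤ C) (hC' : ∀ z, |f' z| ≤ C') :
    ∫ z, f z * z ∂gauss = ∫ z, f' z ∂gauss := by
  have hfm : Measurable f :=
    (continuous_iff_continuousAt.2 fun z => (hd z).continuousAt).measurable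
  have h1 : Integrable (fun z => f z * z) gauss :=
    integrable_id_gauss.bdd_mul hfm.aestronglyMeasurable (Filter.Eventually.of_forall hC)
  have h := integral_mul_deriv_eq_deriv_mul_of_integrable (A := ℝ) (u := f) (u' := f')
    (v := ProbabilityTheory.gaussianPDFReal 0 1)
    (v' := fun z => -(z * ProbabilityTheory.gaussianPDFReal 0 1 z))
    (fun z _ => hd z) (fun z _ => hasDerivAt_gaussianPDFReal z)
    (by
      have := (integrable_mul_gaussianPDFReal h1).neg
      refine this.congr (Filter.Eventually.of_forall fun z => ?_)
      simp; ring)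
    (integrable_mul_gaussianPDFReal (integrable_gauss_of_bounded hf' hC'))
    (integrable_mul_gaussianPDFReal (integrable_gauss_of_bounded hfm hC))
  rw [integral_gauss, integral_gauss]
  simp only [mul_neg, integral_neg, neg_inj] at h
  rw [← h]
  congr 1; ext z; ring

/-- The heat semigroup: `heat τ f x = 𝔼 f (x + √τ Z)` with `Z` standard Gaussian. For `τ < 0` it is
the identity, since then `√τ = 0`. -/
noncomputable def heat (τ : ℝ) (f : ℝ → ℝ) (x : ℝ) : ℝ := ∫ z, f (x + √τ * z) ∂gauss

theorem heat_zero (f : ℝ → ℝ) (x : ℝ) : heat 0 f x = f x := by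
  simp [heat]

theorem abs_heat_le {f : ℝ → ℝ} {C : ℝ} (hC : ∀ z, |f z| ≤ C) (τ x : ℝ) : |heat τ f x| ≤ C := by
  have := norm_integral_le_of_norm_le_const (μ := gauss) (f := fun z => f (x + √τ * z))
    (C := C) (Filter.Eventually.of_forall fun z => hC _)
  simpa [heat] using this

theorem continuous_heat {X : Type*} [TopologicalSpace X] [FirstCountableTopology X]
    {f : X → ℝ → ℝ} (hf : Continuous (uncurry f)) {C : ℝ} (hC : ∀ p z, |f p z| ≤ C)
    {τ x : X → ℝ} (hτ : Continuous τ) (hx : Continuous x) :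
    Continuous fun p => heat (τ p) (f p) (x p) := by
  refine continuous_of_dominated (bound := fun _ => C) (fun p => ?_) (fun p => ?_)
    (integrable_const C) (Filter.Eventually.of_forall fun z => ?_)
  · have : Continuous fun z => f p (x p + √(τ p) * z) :=
      hf.comp (Continuous.prodMk continuous_const (by fun_prop))
    exact this.aestronglyMeasurable
  · exact Filter.Eventually.of_forall fun z => hC _ _
  · exact hf.comp (Continuous.prodMk continuous_id (by fun_prop))

theorem hasDerivAt_heat {f f' : ℝ → ℝ} (hd : ∀ x, HasDerivAt f (f' x) x) (hf' : Continuous f')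
    {C C' : ℝ} (hC : ∀ z, |f z| ≤ C) (hC' : ∀ z, |f' z| ≤ C') (τ x : ℝ) :
    HasDerivAt (heat τ f) (heat τ f' x) x := by
  have hfc : Continuous f := continuous_iff_continuousAt.2 fun z => (hd z).continuousAt
  refine hasDerivAt_integral_of_bounded (F := fun z x => f (x + √τ * z))
    (F' := fun z x => f' (x + √τ * z)) (bound := fun _ => C') x (fun y => ?_) ?_ ?_ ?_ ?_ ?_
  · exact (hfc.comp (by fun_prop)).aestronglyMeasurable
  · exact (hf'.comp (by fun_prop)).aestronglyMeasurable
  · exact integrable_gauss_of_bounded (hfc.comp (by fun_prop)).measurable (fun z => hC _)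
  · exact fun z y => hC' _
  · exact integrable_const _
  · exact fun z y => (hd _).comp_add_const y _

/-- The semigroup solves the heat equation `∂_τ = ½ ∂_xx`, in integrated form. -/
theorem heat_sub_eq_integral {f f' f'' : ℝ → ℝ} (hd : ∀ x, HasDerivAt f (f' x) x)
    (hd' : ∀ x, HasDerivAt f' (f'' x) x) (hf'' : Continuous f'')
    {C C' C'' : ℝ} (hC : ∀ z, |f z| ≤ C) (hC' : ∀ z, |f' z| ≤ C') (hC'' : ∀ z, |f'' z| ≤ C'')
    {τ : ℝ} (hτ : 0 ≤ τ) (x : ℝ) :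
    heat τ f x - f x = ∫ θ in 0..τ, 1 / 2 * heat θ f'' x := by
  have hfc : Continuous f := continuous_iff_continuousAt.2 fun z => (hd z).continuousAt
  have hfc' : Continuous f' := continuous_iff_continuousAt.2 fun z => (hd' z).continuousAt
  have hc : Continuous fun θ => heat θ f x :=
    continuous_heat (f := fun _ => f) (hfc.comp continuous_snd) (fun _ => hC) continuous_id
      continuous_const
  have hc'' : Continuous fun θ => 1 / 2 * heat θ f'' x :=
    continuous_const.mul (continuous_heat (f := fun _ => f'') (hf''.comp continuous_snd)
      (fun _ => hC'') continuous_id continuous_const)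
  have := intervalIntegral.integral_eq_sub_of_hasDerivAt_of_le hτ (f := fun θ => heat θ f x)
    (f' := fun θ => 1 / 2 * heat θ f'' x) hc.continuousOn ?_ (hc''.intervalIntegrable _ _)
  · rw [this, heat_zero]
  intro θ hθ
  have hθ0 : 0 < θ := hθ.1
  have hs : 0 < √θ := Real.sqrt_pos.2 hθ0
  -- differentiate in the variable `c = √θ`, then apply Gaussian integration by parts
  have h1 : HasDerivAt (fun c => ∫ z, f (x + c * z) ∂gauss) (∫ z, f' (x + √θ * z) * z ∂gauss)
      (√θ) := by
    refine hasDerivAt_integral_of_bounded (F := fun z c => f (x + c * z))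
      (F' := fun z c => f' (x + c * z) * z) (bound := fun z => C' * |z|) (√θ)
      (fun y => ?_) ?_ ?_ ?_ ?_ ?_
    · exact (hfc.comp (by fun_prop)).aestronglyMeasurable
    · exact ((hfc'.comp (by fun_prop)).mul continuous_id).aestronglyMeasurable
    · exact integrable_gauss_of_bounded (hfc.comp (by fun_prop)).measurable (fun z => hC _)
    · intro z c; rw [abs_mul]; exact mul_le_mul_of_nonneg_right (hC' _) (abs_nonneg z)
    · exact integrable_abs_gauss.const_mul _
    · intro z c
      have h2 : HasDerivAt (fun c => x + c * z) z c := by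
        simpa using ((hasDerivAt_id c).mul_const z).const_add x
      exact (hd (x + c * z)).comp c h2
  have h3 : ∫ z, f' (x + √θ * z) * z ∂gauss = √θ * heat θ f'' x := by
    rw [integral_mul_id_gauss (f := fun z => f' (x + √θ * z))
      (f' := fun z => √θ * f'' (x + √θ * z)) (C := C') (C' := √θ * C'') ?_ ?_ ?_ ?_]
    · rw [integral_const_mul, heat]
    · intro z
      have h2 : HasDerivAt (fun z => x + √θ * z) (√θ) z := by
        simpa using ((hasDerivAt_id z).const_mul (√θ)).const_add x
      rw [mul_comm]
      exact (hd' (x + √θ * z)).comp z h2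
    · exact (continuous_const.mul (hf''.comp (by fun_prop))).measurable
    · exact fun z => hC' _
    · intro z; rw [abs_mul, abs_of_pos hs]; exact mul_le_mul_of_nonneg_left (hC'' _) hs.le
  rw [h3] at h1
  have h4 := h1.comp θ (Real.hasDerivAt_sqrt hθ0.ne')
  convert! h4 using 1
  field_simp

/-! ### Towers of space derivatives -/

/-- `W j = ∂_x^j (W 0)`, all of them jointly continuous and bounded on `ℝ × ℝ`. -/
structure IsTower (W : ℕ → ℝ → ℝ → ℝ) : Prop where
  cont : ∀ j, Continuous (uncurry (W j))
  bdd : ∀ j, ∃ C, ∀ s x, |W j s x| ≤ C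
  hasDerivAt : ∀ j s x, HasDerivAt (W j s) (W (j + 1) s x) x

namespace IsTower

variable {W V : ℕ → ℝ → ℝ → ℝ}

theorem iteratedDeriv_eq (hW : IsTower W) (i j : ℕ) (s : ℝ) :
    iteratedDeriv j (W i s) = W (i + j) s := by
  induction j with
  | zero => simp
  | succ j ih =>
    rw [iteratedDeriv_succ, ih]
    ext x
    exact (hW.hasDerivAt _ _ _).deriv

theorem contDiff (hW : IsTower W) (i : ℕ) (s : ℝ) : ContDiff ℝ ∞ (W i s) := by
  refine contDiff_of_differentiable_iteratedDeriv fun m _ => ?_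
  rw [hW.iteratedDeriv_eq]
  exact fun x => (hW.hasDerivAt _ _ _).differentiableAt

theorem shift (hW : IsTower W) (i : ℕ) : IsTower fun j => W (i + j) :=
  ⟨fun _ => hW.cont _, fun _ => hW.bdd _, fun _ => hW.hasDerivAt _⟩

theorem comp_time (hW : IsTower W) {σ : ℝ → ℝ} (hσ : Continuous σ) :
    IsTower fun j s => W j (σ s) :=
  ⟨fun j => (hW.cont j).comp ((hσ.comp continuous_fst).prodMk continuous_snd),
    fun j => (hW.bdd j).imp fun _ h _ _ => h _ _, fun _ _ _ => hW.hasDerivAt _ _ _⟩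

theorem const_mul (hW : IsTower W) (c : ℝ) : IsTower fun j s x => c * W j s x :=
  ⟨fun j => continuous_const.mul (hW.cont j),
    fun j => by
      obtain ⟨C, hC⟩ := hW.bdd j
      refine ⟨|c| * C, fun s x => ?_⟩
      rw [abs_mul]
      exact mul_le_mul_of_nonneg_left (hC s x) (abs_nonneg c),
    fun j s x => (hW.hasDerivAt j s x).const_mul c⟩

/-- The tower of a product. -/
theorem mul (hW : IsTower W) (hV : IsTower V) :
    IsTower fun j s x => iteratedDeriv j (fun y => W 0 s y * V 0 s y) x := by
  have key : ∀ j s x, iteratedDeriv j (fun y => W 0 s y * V 0 s y) x =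
      ∑ i ∈ Finset.range (j + 1), (j.choose i : ℝ) * W i s x * V (j - i) s x := by
    intro j s x
    rw [iteratedDeriv_fun_mul ((hW.contDiff 0 s).contDiffAt.of_le (by exact_mod_cast le_top))
      ((hV.contDiff 0 s).contDiffAt.of_le (by exact_mod_cast le_top))]
    simp [hW.iteratedDeriv_eq, hV.iteratedDeriv_eq]
  refine ⟨fun j => ?_, fun j => ?_, fun j s x => ?_⟩
  · have : (uncurry fun s x => iteratedDeriv j (fun y => W 0 s y * V 0 s y) x) =
        fun p => ∑ i ∈ Finset.range (j + 1),
          (j.choose i : ℝ) * uncurry (W i) p * uncurry (V (j - i)) p := by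
      ext p; exact key j p.1 p.2
    rw [this]
    exact continuous_finsetSum _ fun i _ =>
      (continuous_const.mul (hW.cont i)).mul (hV.cont _)
  · choose C hC using hW.bdd
    choose D hD using hV.bdd
    refine ⟨∑ i ∈ Finset.range (j + 1), (j.choose i : ℝ) * C i * D (j - i), fun s x => ?_⟩
    rw [key]
    refine (Finset.abs_sum_le_sum_abs _ _).trans (Finset.sum_le_sum fun i _ => ?_)
    rw [abs_mul, abs_mul, Nat.abs_cast]
    have hC0 : 0 ≤ C i := (abs_nonneg _).trans (hC i s x)
    gcongr
    · exact hC i s x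
    · exact hD _ s x
  · have h : ContDiff ℝ ∞ fun y => W 0 s y * V 0 s y := (hW.contDiff 0 s).mul (hV.contDiff 0 s)
    rw [iteratedDeriv_succ]
    exact ((h.differentiable_iteratedDeriv j (by exact_mod_cast WithTop.coe_lt_top j)) x).hasDerivAt

/-- The members of a tower as elements of the Banach space of bounded continuous functions. -/
noncomputable def toBCF (hW : IsTower W) (j : ℕ) : ℝ × ℝ →ᵇ ℝ :=
  BoundedContinuousFunction.ofNormedAddCommGroup (uncurry (W j)) (hW.cont j)
    (hW.bdd j).choose fun p => (hW.bdd j).choose_spec p.1 p.2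

@[simp]
theorem toBCF_apply (hW : IsTower W) (j : ℕ) (p : ℝ × ℝ) : hW.toBCF j p = W j p.1 p.2 := rfl

/-- The heat flow of a tower that does not depend on time. -/
theorem heat {h : ℕ → ℝ → ℝ} (hh : IsTower fun j _ => h j) :
    IsTower fun j s => Parisi.heat s (h j) := by
  choose C hC using hh.bdd
  have hc : ∀ j, Continuous (h j) := fun j =>
    (hh.cont j).comp ((continuous_const (y := (0:ℝ))).prodMk continuous_id)
  refine ⟨fun j => ?_, fun j => ⟨C j, fun s x => abs_heat_le (fun z => hC j s z) s x⟩,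
    fun j s x => hasDerivAt_heat (hh.hasDerivAt j s) (hc _) (hC j s) (hC (j + 1) s) s x⟩
  exact continuous_heat (f := fun _ : ℝ × ℝ => h j) ((hc j).comp continuous_snd)
    (fun _ z => hC j 0 z) continuous_fst continuous_snd

end IsTower

/-! ### Smoothness of orbits under space translations -/

/-- Translation by `a` in the space variable. -/
noncomputable def translate (a : ℝ) : (ℝ × ℝ →ᵇ ℝ) →L[ℝ] (ℝ × ℝ →ᵇ ℝ) :=
  LinearMap.mkContinuous
    { toFun := fun f => f.compContinuous ⟨fun p => (p.1, p.2 + a), by fun_prop⟩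
      map_add' := fun _ _ => rfl
      map_smul' := fun _ _ => rfl } 1 fun f => by
    rw [one_mul]
    exact (BoundedContinuousFunction.norm_le (norm_nonneg f)).2 fun p => f.norm_coe_le_norm _

@[simp]
theorem translate_apply (a : ℝ) (f : ℝ × ℝ →ᵇ ℝ) (p : ℝ × ℝ) :
    translate a f p = f (p.1, p.2 + a) := rfl

theorem norm_translate_le (a : ℝ) (f : ℝ × ℝ →ᵇ ℝ) : ‖translate a f‖ ≤ ‖f‖ :=
  (BoundedContinuousFunction.norm_le (norm_nonneg f)).2 fun _ => f.norm_coe_le_norm _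

theorem translate_translate (a b : ℝ) (f : ℝ × ℝ →ᵇ ℝ) :
    translate a (translate b f) = translate (a + b) f := by
  ext p; simp [add_assoc]

theorem translate_mul (a : ℝ) (f g : ℝ × ℝ →ᵇ ℝ) :
    translate a (f * g) = translate a f * translate a g := rfl

theorem translate_zero (f : ℝ × ℝ →ᵇ ℝ) : translate 0 f = f := by
  ext p; simp

/-- The orbit of a tower under translations is a smooth curve. -/
theorem IsTower.contDiff_translate {W : ℕ → ℝ → ℝ → ℝ} (hW : IsTower W) (j : ℕ) :
    ContDiff ℝ ∞ fun a => translate a (hW.toBCF j) := by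
  have hd : ∀ j a, HasDerivAt (fun a => translate a (hW.toBCF j))
      (translate a (hW.toBCF (j + 1))) a := by
    intro j a
    obtain ⟨C, hC⟩ := hW.bdd (j + 1 + 1)
    have hC0 : 0 ≤ C := (abs_nonneg _).trans (hC 0 0)
    rw [hasDerivAt_iff_isLittleO]
    have h2 : (fun b => translate b (hW.toBCF j) - translate a (hW.toBCF j)
        - (b - a) • translate a (hW.toBCF (j + 1))) =O[nhds a] fun b => (b - a) ^ 2 := by
      refine Asymptotics.IsBigO.of_bound C (Filter.Eventually.of_forall fun b => ?_)
      refine (BoundedContinuousFunction.norm_le (by positivity)).2 fun p => ?_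
      simp only [BoundedContinuousFunction.sub_apply, translate_apply, toBCF_apply,
        BoundedContinuousFunction.smul_apply, smul_eq_mul]
      -- mean value inequality for `y ↦ W j (y) - (y - a) W (j+1) (a)`
      have hlip : ∀ y ∈ uIcc a b, ‖W (j + 1) p.1 (p.2 + y) - W (j + 1) p.1 (p.2 + a)‖
          ≤ C * |b - a| := by
        intro y hy
        have := (convex_univ (𝕜 := ℝ) (E := ℝ)).norm_image_sub_le_of_norm_hasDerivWithin_le
          (f := W (j + 1) p.1) (f' := W (j + 1 + 1) p.1) (C := C)
          (fun x _ => (hW.hasDerivAt (j + 1) p.1 x).hasDerivWithinAt)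
          (fun x _ => hC p.1 x) (mem_univ (p.2 + a)) (mem_univ (p.2 + y))
        refine this.trans (mul_le_mul_of_nonneg_left ?_ hC0)
        rw [Real.norm_eq_abs, add_sub_add_left_eq_sub]
        exact abs_sub_left_of_mem_uIcc hy
      have := (convex_uIcc a b).norm_image_sub_le_of_norm_hasDerivWithin_le
        (f := fun y => W j p.1 (p.2 + y) - y * W (j + 1) p.1 (p.2 + a))
        (f' := fun y => W (j + 1) p.1 (p.2 + y) - W (j + 1) p.1 (p.2 + a)) (C := C * |b - a|)
        (fun y _ => ?_) hlip left_mem_uIcc right_mem_uIcc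
      · rw [Real.norm_eq_abs, Real.norm_eq_abs] at *
        rw [abs_of_nonneg (sq_nonneg (b - a))]
        calc _ = |W j p.1 (p.2 + b) - b * W (j + 1) p.1 (p.2 + a) -
              (W j p.1 (p.2 + a) - a * W (j + 1) p.1 (p.2 + a))| := by congr 1; ring
          _ ≤ C * |b - a| * |b - a| := this
          _ = C * (b - a) ^ 2 := by rw [mul_assoc, abs_mul_abs_self, sq]
      · refine (HasDerivAt.sub ?_ ?_).hasDerivWithinAt
        · exact (hW.hasDerivAt j p.1 (p.2 + y)).comp_const_add p.2 y
        · simpa using (hasDerivAt_id y).mul_const (W (j + 1) p.1 (p.2 + a))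
    refine h2.trans_isLittleO ?_
    have h3 : (fun b : ℝ => (b - a) * (b - a)) =o[nhds a] fun b => (1 : ℝ) * (b - a) := by
      refine Asymptotics.IsLittleO.mul_isBigO ?_ (Asymptotics.isBigO_refl _ _)
      rw [Asymptotics.isLittleO_one_iff]
      have : Continuous fun b : ℝ => b - a := by fun_prop
      simpa using this.tendsto a
    simpa [sq] using h3
  have : ∀ n : ℕ, ∀ j, ContDiff ℝ n fun a => translate a (hW.toBCF j) := by
    intro n
    induction n with
    | zero =>
      intro j
      exact contDiff_zero.2 (continuous_iff_continuousAt.2 fun a => (hd j a).continuousAt)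
    | succ n ih =>
      intro j
      have h : deriv (fun a => translate a (hW.toBCF j)) =
          fun a => translate a (hW.toBCF (j + 1)) := by
        ext1 a; exact (hd j a).deriv
      rw [Nat.cast_add, Nat.cast_one, contDiff_succ_iff_deriv]
      refine ⟨fun a => (hd j a).differentiableAt, by simp, ?_⟩
      rw [h]; exact ih _
  exact contDiff_infty.2 fun n => this n j

/-- A bounded continuous function with a smooth orbit under translations is the bottom of a
tower. -/
theorem exists_isTower_of_contDiff_translate {w : ℝ × ℝ →ᵇ ℝ}
    (hw : ContDiff ℝ ∞ fun a => translate a w) :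
    ∃ W, IsTower W ∧ ∀ s x, W 0 s x = w (s, x) := by
  set c : ℝ → ℝ × ℝ →ᵇ ℝ := fun a => translate a w with hc
  have hdiff : ∀ j : ℕ, Differentiable ℝ (iteratedDeriv j c) := fun j =>
    hw.differentiable_iteratedDeriv j (by exact_mod_cast WithTop.coe_lt_top j)
  have hinv : ∀ j a b, iteratedDeriv j c (a + b) = translate b (iteratedDeriv j c a) := by
    intro j
    induction j with
    | zero => intro a b; simp [hc, translate_translate, add_comm]
    | succ j ih =>
      intro a b
      rw [iteratedDeriv_succ]
      have h1 : HasDerivAt (fun a => iteratedDeriv j c (a + b))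
          (deriv (iteratedDeriv j c) (a + b)) a :=
        (hdiff j (a + b)).hasDerivAt.comp_add_const a b
      have h2 : HasDerivAt (fun a => iteratedDeriv j c (a + b))
          (translate b (deriv (iteratedDeriv j c) a)) a := by
        simp only [ih]
        exact (translate b).hasFDerivAt.comp_hasDerivAt a (hdiff j a).hasDerivAt
      exact h1.unique h2
  refine ⟨fun j s x => iteratedDeriv j c x (s, 0), ⟨fun j => ?_, fun j => ?_, fun j s x => ?_⟩,
    fun s x => by simp [hc]⟩
  · have h : Continuous fun p : ℝ × ℝ => (iteratedDeriv j c p.2, ((p.1, 0) : ℝ × ℝ)) :=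
      ((hdiff j).continuous.comp continuous_snd).prodMk (by fun_prop)
    exact Continuous.eval h.fst h.snd
  · refine ⟨‖iteratedDeriv j c 0‖, fun s x => ?_⟩
    calc _ ≤ ‖iteratedDeriv j c x‖ := (iteratedDeriv j c x).norm_coe_le_norm _
      _ = ‖translate x (iteratedDeriv j c 0)‖ := by rw [← hinv, zero_add]
      _ ≤ _ := norm_translate_le _ _
  · rw [iteratedDeriv_succ]
    have h := (hdiff j x).hasDerivAt
    exact (BoundedContinuousFunction.evalCLM ℝ ((s, 0) : ℝ × ℝ)).hasFDerivAt.comp_hasDerivAt x h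

/-! ### The quadratic fixed point equation -/

/-- The equation `w = H + B (w²)` has a solution for small `B`, by the contraction principle. If
`B` commutes with translations then `w` inherits the smoothness of `H` along translations: the
map `w ↦ w - B (w²)` is smooth with invertible derivative, so the translates of `w` are the
images of the translates of `H` under a smooth local inverse. -/
theorem exists_fixedPoint {B : (ℝ × ℝ →ᵇ ℝ) →L[ℝ] (ℝ × ℝ →ᵇ ℝ)} (hB : ‖B‖ ≤ 1 / 8)
    (hcomm : ∀ a f, B (translate a f) = translate a (B f)) {H : ℝ × ℝ →ᵇ ℝ} (hH : ‖H‖ ≤ 1)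
    (hsm : ContDiff ℝ ∞ fun a => translate a H) :
    ∃ w, w = H + B (w * w) ∧ ContDiff ℝ ∞ fun a => translate a w := by
  -- differences of squares
  have hdiff : ∀ v w : ℝ × ℝ →ᵇ ℝ, ‖v‖ ≤ 2 → ‖w‖ ≤ 2 →
      ‖B (v * v) - B (w * w)‖ ≤ 1 / 2 * ‖v - w‖ := by
    intro v w hv hw
    have h1 : v * v - w * w = (v + w) * (v - w) := by ring
    rw [← map_sub, h1]
    calc _ ≤ ‖B‖ * ‖(v + w) * (v - w)‖ := B.le_opNorm _
      _ ≤ 1 / 8 * (‖v + w‖ * ‖v - w‖) := by gcongr; exact norm_mul_le _ _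
      _ ≤ 1 / 8 * ((2 + 2) * ‖v - w‖) := by
          gcongr; exact (norm_add_le _ _).trans (add_le_add hv hw)
      _ = _ := by ring
  obtain ⟨w, hw2, hw⟩ : ∃ w : ℝ × ℝ →ᵇ ℝ, ‖w‖ ≤ 2 ∧ w = H + B (w * w) := by
    have hmaps : MapsTo (fun w : ℝ × ℝ →ᵇ ℝ => H + B (w * w)) (Metric.closedBall 0 2)
        (Metric.closedBall 0 2) := by
      intro w hw
      rw [mem_closedBall_zero_iff] at hw ⊢
      have := hdiff w 0 hw (by simp)
      simp only [mul_zero, map_zero, sub_zero] at this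
      exact (norm_add_le _ _).trans (by linarith)
    have hlip : ContractingWith (1 / 2) (hmaps.restrict _ _ _) := by
      refine ⟨by rw [← NNReal.coe_lt_coe]; norm_num, LipschitzWith.of_dist_le_mul ?_⟩
      rintro ⟨v, hv⟩ ⟨w, hw⟩
      rw [mem_closedBall_zero_iff] at hv hw
      rw [Subtype.dist_eq, Subtype.dist_eq, dist_eq_norm, dist_eq_norm]
      simpa using hdiff v w hv hw
    obtain ⟨w, hw, hfix, -⟩ := hlip.exists_fixedPoint'
      (Metric.isClosed_closedBall.isComplete) hmaps (x := 0)
      (by simp) (edist_ne_top _ _)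
    exact ⟨w, mem_closedBall_zero_iff.1 hw, hfix.symm⟩
  refine ⟨w, hw, ?_⟩
  set Φ : (ℝ × ℝ →ᵇ ℝ) → ℝ × ℝ →ᵇ ℝ := fun v => v - B (v * v) with hΦ
  have hΦw : ∀ a, Φ (translate a w) = translate a H := by
    intro a
    have : H = w - B (w * w) := by rw [eq_sub_iff_add_eq]; exact hw.symm
    rw [this, hΦ, map_sub, ← hcomm, translate_mul]
  have hΦc : ContDiff ℝ ∞ Φ := contDiff_id.sub (B.contDiff.comp (contDiff_id.mul contDiff_id))
  set K : (ℝ × ℝ →ᵇ ℝ) →L[ℝ] (ℝ × ℝ →ᵇ ℝ) :=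
    B.comp (ContinuousLinearMap.mul ℝ (ℝ × ℝ →ᵇ ℝ) w) +
      B.comp (ContinuousLinearMap.mul ℝ (ℝ × ℝ →ᵇ ℝ) w) with hK
  have hKn : ‖K‖ < 1 := by
    have h1 : ‖ContinuousLinearMap.mul ℝ (ℝ × ℝ →ᵇ ℝ) w‖ ≤ 2 :=
      (ContinuousLinearMap.opNorm_mul_apply_le ℝ _ w).trans hw2
    have h2 := ContinuousLinearMap.opNorm_comp_le B (ContinuousLinearMap.mul ℝ (ℝ × ℝ →ᵇ ℝ) w)
    have h3 : ‖B‖ * ‖ContinuousLinearMap.mul ℝ (ℝ × ℝ →ᵇ ℝ) w‖ ≤ 1 / 8 * 2 := by gcongr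
    have h4 := norm_add_le (B.comp (ContinuousLinearMap.mul ℝ (ℝ × ℝ →ᵇ ℝ) w))
      (B.comp (ContinuousLinearMap.mul ℝ (ℝ × ℝ →ᵇ ℝ) w))
    rw [← hK] at h4
    linarith
  set e : (ℝ × ℝ →ᵇ ℝ) ≃L[ℝ] (ℝ × ℝ →ᵇ ℝ) :=
    ContinuousLinearEquiv.ofUnit (Units.oneSub K hKn) with he
  have hΦ' : HasFDerivAt Φ (e : (ℝ × ℝ →ᵇ ℝ) →L[ℝ] (ℝ × ℝ →ᵇ ℝ)) w := by
    have h1 := (hasFDerivAt_id (𝕜 := ℝ) w).mul (hasFDerivAt_id w)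
    have h2 := (hasFDerivAt_id (𝕜 := ℝ) w).sub (B.hasFDerivAt.comp w h1)
    convert! h2 using 1
    ext1 v
    change v - (B (w * v) + B (w * v)) = v - B (w * v + w * v)
    rw [map_add]
  have hcontΦ : ContDiffAt ℝ ∞ Φ w := hΦc.contDiffAt
  have hinf : (∞ : WithTop ℕ∞) ≠ 0 := by simp
  -- the orbit of `w` is continuous at `0`
  have hcont : Filter.Tendsto (fun a => translate a w) (nhds 0) (nhds w) := by
    have h1 : Filter.Tendsto (fun a => 2 * ‖translate a H - H‖) (nhds 0) (nhds 0) := by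
      have : Continuous fun a => 2 * ‖translate a H - H‖ :=
        continuous_const.mul (hsm.continuous.sub continuous_const).norm
      simpa [translate_zero] using this.tendsto 0
    rw [tendsto_iff_norm_sub_tendsto_zero]
    refine squeeze_zero (fun _ => norm_nonneg _) (fun a => ?_) h1
    have h2 : translate a w - w = (translate a H - H) +
        (B (translate a w * translate a w) - B (w * w)) := by
      nth_rw 1 2 [hw]
      rw [map_add, ← hcomm, translate_mul]; abel
    have h3 := norm_add_le (translate a H - H) (B (translate a w * translate a w) - B (w * w))
    rw [← h2] at h3
    have := hdiff (translate a w) w ((norm_translate_le a w).trans hw2) hw2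
    linarith
  have hev : ∀ᶠ a in nhds (0 : ℝ),
      hcontΦ.localInverse hΦ' hinf (translate a H) = translate a w := by
    have := (hcontΦ.hasStrictFDerivAt' hΦ' hinf).eventually_left_inverse
    filter_upwards [hcont.eventually this] with a ha
    rw [hΦw] at ha
    exact ha
  have hloc : ContDiffAt ℝ ∞ (fun a => translate a w) 0 := by
    have h1 := hcontΦ.to_localInverse hΦ' hinf
    have h0 : Φ w = translate 0 H := by rw [← hΦw 0, translate_zero]
    rw [h0] at h1
    exact (h1.comp 0 hsm.contDiffAt).congr_of_eventuallyEq (hev.mono fun a ha => ha.symm)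
  refine contDiff_iff_contDiffAt.2 fun b => ?_
  have h1 : (fun a => translate a w) = fun a => translate b (translate (a - b) w) := by
    ext1 a; rw [translate_translate]; congr 2; ring
  rw [h1]
  refine (translate b).contDiff.contDiffAt.comp b (ContDiffAt.comp (g := fun a => translate a w) b ?_
    (contDiff_id.sub contDiff_const).contDiffAt)
  simpa using hloc

theorem intervalIntegrable_of_bounded {f : ℝ → ℝ} (hf : Measurable f) {C : ℝ}
    (hC : ∀ r, |f r| ≤ C) (a b : ℝ) : IntervalIntegrable f volume a b :=
  (intervalIntegrable_const (c := C)).mono_fun hf.aestronglyMeasurable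
    (Filter.Eventually.of_forall fun r => (hC r).trans (le_abs_self C))

theorem integral_integral_triangle {F : ℝ → ℝ → ℝ} (hF : Measurable (uncurry F)) {C : ℝ}
    (hC : ∀ q r, |F q r| ≤ C) {s : ℝ} (hs : 0 ≤ s) :
    ∫ q in 0..s, ∫ r in 0..q, F q r = ∫ r in 0..s, ∫ q in r..s, F q r := by
  have h1 : ∫ q in 0..s, ∫ r in 0..q, F q r =
      ∫ q in Ioc 0 s, ∫ r in Ioc 0 s, {p : ℝ × ℝ | p.2 ≤ p.1}.indicator (uncurry F) (q, r) := by
    rw [intervalIntegral.integral_of_le hs]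
    refine setIntegral_congr_fun measurableSet_Ioc fun q hq => ?_
    rw [intervalIntegral.integral_of_le hq.1.le]
    have : (fun r => {p : ℝ × ℝ | p.2 ≤ p.1}.indicator (uncurry F) (q, r)) =
        (Iic q).indicator (fun r => F q r) := by
      ext r; simp [indicator]
    rw [this, setIntegral_indicator measurableSet_Iic, Ioc_inter_Iic, min_eq_right hq.2]
  have h2 : ∫ r in 0..s, ∫ q in r..s, F q r =
      ∫ r in Ioc 0 s, ∫ q in Ioc 0 s, {p : ℝ × ℝ | p.2 ≤ p.1}.indicator (uncurry F) (q, r) := by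
    rw [intervalIntegral.integral_of_le hs]
    refine setIntegral_congr_fun measurableSet_Ioc fun r hr => ?_
    rw [intervalIntegral.integral_of_le hr.2, ← integral_Icc_eq_integral_Ioc]
    have : (fun q => {p : ℝ × ℝ | p.2 ≤ p.1}.indicator (uncurry F) (q, r)) =
        (Ici r).indicator (fun q => F q r) := by
      ext q; simp [indicator]
    rw [this, setIntegral_indicator measurableSet_Ici]
    congr 2
    ext q; simp only [mem_Icc, mem_inter_iff, mem_Ioc, mem_Ici]
    exact ⟨fun h => ⟨⟨hr.1.trans_le h.1, h.2⟩, h.1⟩, fun h => ⟨h.2, h.1.2⟩⟩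
  rw [h1, h2]
  refine integral_integral_swap (f := fun q r =>
    {p : ℝ × ℝ | p.2 ≤ p.1}.indicator (uncurry F) (q, r)) ?_
  refine Integrable.of_bound
    (hF.indicator (measurableSet_le measurable_snd measurable_fst)).aestronglyMeasurable C
    (Filter.Eventually.of_forall fun p => ?_)
  exact (norm_indicator_le_norm_self _ _).trans (hC p.1 p.2)

/-! ### The Duhamel operator -/

/-- The law of `(A, Z)` with `A` uniform on `[0,1]` and `Z` an independent standard Gaussian. -/
noncomputable def kernelMeasure : Measure (ℝ × ℝ) := (volume.restrict (Icc (0 : ℝ) 1)).prod gauss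

theorem integrable_abs_snd_kernelMeasure : Integrable (fun p : ℝ × ℝ => |p.2|) kernelMeasure :=
  integrable_abs_gauss.comp_snd _

/-- The function `½ ∫_0^s m(r) ∂_x P_{s-r} f(r) dr`, where `P` is the heat semigroup. The
singularity of `∂_x P_{s-r}` at `r = s` is removed by the substitution `r = s (1 - a²)`. -/
noncomputable def duhamel (m : ℝ → ℝ) (f : ℝ → ℝ → ℝ) (s x : ℝ) : ℝ :=
  √s * ∫ p, m (s * (1 - p.1 ^ 2)) * f (s * (1 - p.1 ^ 2)) (x + √s * p.1 * p.2) * p.2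
    ∂kernelMeasure

section

variable {m : ℝ → ℝ} {f : ℝ → ℝ → ℝ} {C : ℝ}

theorem abs_duhamel_integrand_le (h0 : ∀ r, 0 ≤ m r) (h1 : ∀ r, m r ≤ 1) (hC : ∀ s x, |f s x| ≤ C)
    (s x : ℝ) (p : ℝ × ℝ) :
    |m (s * (1 - p.1 ^ 2)) * f (s * (1 - p.1 ^ 2)) (x + √s * p.1 * p.2) * p.2| ≤ C * |p.2| := by
  rw [abs_mul, abs_mul, abs_of_nonneg (h0 _)]
  refine mul_le_mul_of_nonneg_right ?_ (abs_nonneg _)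
  calc _ ≤ 1 * |f (s * (1 - p.1 ^ 2)) (x + √s * p.1 * p.2)| := by gcongr; exact h1 _
    _ ≤ C := by rw [one_mul]; exact hC _ _

theorem measurable_duhamel_integrand (hm : Measurable m) (hf : Continuous (uncurry f)) (s x : ℝ) :
    Measurable fun p : ℝ × ℝ =>
      m (s * (1 - p.1 ^ 2)) * f (s * (1 - p.1 ^ 2)) (x + √s * p.1 * p.2) * p.2 := by
  refine ((hm.comp (by fun_prop)).mul ?_).mul measurable_snd
  have : Continuous fun p : ℝ × ℝ => f (s * (1 - p.1 ^ 2)) (x + √s * p.1 * p.2) :=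
    hf.comp (f := fun p : ℝ × ℝ => (s * (1 - p.1 ^ 2), x + √s * p.1 * p.2)) (by fun_prop)
  exact this.measurable

theorem integrable_duhamel_integrand (hm : Measurable m) (h0 : ∀ r, 0 ≤ m r) (h1 : ∀ r, m r ≤ 1)
    (hf : Continuous (uncurry f)) (hC : ∀ s x, |f s x| ≤ C) (s x : ℝ) :
    Integrable (fun p : ℝ × ℝ =>
      m (s * (1 - p.1 ^ 2)) * f (s * (1 - p.1 ^ 2)) (x + √s * p.1 * p.2) * p.2) kernelMeasure :=
  Integrable.mono' (integrable_abs_snd_kernelMeasure.const_mul C)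
    (measurable_duhamel_integrand hm hf s x).aestronglyMeasurable
    (Filter.Eventually.of_forall (abs_duhamel_integrand_le h0 h1 hC s x))

theorem abs_duhamel_le (h0 : ∀ r, 0 ≤ m r) (h1 : ∀ r, m r ≤ 1)
    (hC : ∀ s x, |f s x| ≤ C) (s x : ℝ) :
    |duhamel m f s x| ≤ √s * (C * ∫ p, |p.2| ∂kernelMeasure) := by
  rw [duhamel, abs_mul, abs_of_nonneg (Real.sqrt_nonneg s)]
  refine mul_le_mul_of_nonneg_left ?_ (Real.sqrt_nonneg s)
  rw [← integral_const_mul]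
  rw [← Real.norm_eq_abs]
  exact norm_integral_le_of_norm_le (integrable_abs_snd_kernelMeasure.const_mul C)
    (Filter.Eventually.of_forall (abs_duhamel_integrand_le h0 h1 hC s x))

theorem continuous_duhamel (hm : Antitone m) (h0 : ∀ r, 0 ≤ m r) (h1 : ∀ r, m r ≤ 1)
    (hf : Continuous (uncurry f)) (hC : ∀ s x, |f s x| ≤ C) :
    Continuous fun q : ℝ × ℝ => duhamel m f q.1 q.2 := by
  rw [continuous_iff_continuousAt]
  rintro ⟨s, x⟩
  rcases le_or_gt s 0 with hs | hs
  · have hz : duhamel m f s x = 0 := by simp [duhamel, Real.sqrt_eq_zero_of_nonpos hs]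
    rw [ContinuousAt, hz]
    refine squeeze_zero_norm (fun q => abs_duhamel_le h0 h1 hC q.1 q.2) ?_
    have : Continuous fun q : ℝ × ℝ => √q.1 * (C * ∫ p, |p.2| ∂kernelMeasure) := by fun_prop
    simpa [Real.sqrt_eq_zero_of_nonpos hs] using this.tendsto (s, x)
  · refine ContinuousAt.mul (f := fun q : ℝ × ℝ => √q.1) (by fun_prop) ?_
    refine continuousAt_of_dominated (bound := fun p => C * |p.2|)
      (Filter.Eventually.of_forall fun q =>
        (measurable_duhamel_integrand hm.measurable hf q.1 q.2).aestronglyMeasurable)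
      (Filter.Eventually.of_forall fun q => Filter.Eventually.of_forall fun p =>
        abs_duhamel_integrand_le h0 h1 hC q.1 q.2 p)
      (integrable_abs_snd_kernelMeasure.const_mul C) ?_
    -- `m` has countably many jumps, so `m (s (1 - a²))` is continuous in `s` for almost every `a`
    have hae : ∀ᵐ a ∂(volume.restrict (Icc (0 : ℝ) 1)), ContinuousAt m (s * (1 - a ^ 2)) := by
      rw [ae_restrict_iff' measurableSet_Icc]
      have hinj : InjOn (fun a : ℝ => s * (1 - a ^ 2)) (Icc 0 1) := by
        intro a ha b hb hab
        have h2 : a ^ 2 = b ^ 2 := by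
          have := mul_left_cancel₀ hs.ne' hab
          linarith
        exact (sq_eq_sq₀ ha.1 hb.1).1 h2
      have hcount : {a ∈ Icc (0 : ℝ) 1 | ¬ ContinuousAt m (s * (1 - a ^ 2))}.Countable :=
        (MapsTo.countable_of_injOn (t := {r | ¬ ContinuousAt m r})
          (f := fun a : ℝ => s * (1 - a ^ 2)) (fun a ha => ha.2)
          (hinj.mono fun a ha => ha.1) hm.countable_not_continuousAt)
      filter_upwards [hcount.ae_notMem volume] with a ha haI
      by_contra hcon
      exact ha ⟨haI, hcon⟩
    have hae' : ∀ᵐ p ∂kernelMeasure, ContinuousAt m (s * (1 - p.1 ^ 2)) :=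
      Measure.quasiMeasurePreserving_fst.ae hae
    filter_upwards [hae'] with p hp
    refine ContinuousAt.mul (ContinuousAt.mul ?_ ?_) continuousAt_const
    · exact ContinuousAt.comp (f := fun q : ℝ × ℝ => q.1 * (1 - p.1 ^ 2)) (x := (s, x)) hp
        (by fun_prop)
    · exact (hf.comp (f := fun q : ℝ × ℝ => (q.1 * (1 - p.1 ^ 2), q.2 + √q.1 * p.1 * p.2))
        (by fun_prop)).continuousAt

/-- The Duhamel operator on bounded continuous functions, stopped at time `δ`. -/
noncomputable def duhamelCLM (hm : Antitone m) (h0 : ∀ r, 0 ≤ m r) (h1 : ∀ r, m r ≤ 1) (δ : ℝ) :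
    (ℝ × ℝ →ᵇ ℝ) →L[ℝ] (ℝ × ℝ →ᵇ ℝ) :=
  have hb : ∀ (f : ℝ × ℝ →ᵇ ℝ) (s x : ℝ), |duhamel m (curry f) (min s δ) x| ≤
      √δ * (∫ p, |p.2| ∂kernelMeasure) * ‖f‖ := fun f s x => by
    refine (abs_duhamel_le h0 h1 (fun s x => f.norm_coe_le_norm (s, x)) (min s δ) x).trans ?_
    have h2 : √(min s δ) ≤ √δ := Real.sqrt_le_sqrt (min_le_right _ _)
    have h3 : 0 ≤ ∫ p, |p.2| ∂kernelMeasure := integral_nonneg fun p => abs_nonneg p.2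
    calc _ ≤ √δ * (‖f‖ * ∫ p, |p.2| ∂kernelMeasure) := by gcongr
      _ = _ := by ring
  LinearMap.mkContinuous
    { toFun := fun f => BoundedContinuousFunction.ofNormedAddCommGroup
        (fun q => duhamel m (curry f) (min q.1 δ) q.2)
        ((continuous_duhamel hm h0 h1 (f := curry f) f.continuous
          (fun s x => f.norm_coe_le_norm (s, x))).comp
          (f := fun q : ℝ × ℝ => (min q.1 δ, q.2)) (by fun_prop))
        (√δ * (∫ p, |p.2| ∂kernelMeasure) * ‖f‖) (fun q => hb f q.1 q.2)
      map_add' := fun f g => by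
        ext q
        have hf := integrable_duhamel_integrand hm.measurable h0 h1 (f := curry f) f.continuous
          (fun s x => f.norm_coe_le_norm (s, x)) (min q.1 δ) q.2
        have hg := integrable_duhamel_integrand hm.measurable h0 h1 (f := curry g) g.continuous
          (fun s x => g.norm_coe_le_norm (s, x)) (min q.1 δ) q.2
        change duhamel m (curry (f + g)) (min q.1 δ) q.2 =
          duhamel m (curry f) (min q.1 δ) q.2 + duhamel m (curry g) (min q.1 δ) q.2
        rw [duhamel, duhamel, duhamel, ← mul_add, ← integral_add hf hg]
        simp only [curry_apply, Pi.add_apply, mul_add, add_mul]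
      map_smul' := fun c f => by
        ext q
        change duhamel m (curry (c • f)) (min q.1 δ) q.2 =
          c * duhamel m (curry f) (min q.1 δ) q.2
        rw [duhamel, duhamel, mul_left_comm, ← integral_const_mul c]
        refine congrArg (√(min q.1 δ) * ·) (integral_congr_ae
          (Filter.Eventually.of_forall fun p => ?_))
        change m _ * (c * f (_, _)) * p.2 = c * (m _ * f (_, _) * p.2)
        ring }
    (√δ * ∫ p, |p.2| ∂kernelMeasure) fun f => by
      have h3 : 0 ≤ ∫ p, |p.2| ∂kernelMeasure := integral_nonneg fun p => abs_nonneg p.2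
      exact (BoundedContinuousFunction.norm_le (by positivity)).2 fun q => hb f q.1 q.2

theorem duhamelCLM_apply (hm : Antitone m) (h0 : ∀ r, 0 ≤ m r) (h1 : ∀ r, m r ≤ 1) (δ : ℝ)
    (f : ℝ × ℝ →ᵇ ℝ) (q : ℝ × ℝ) :
    duhamelCLM hm h0 h1 δ f q = duhamel m (curry f) (min q.1 δ) q.2 := rfl

theorem norm_duhamelCLM_le (hm : Antitone m) (h0 : ∀ r, 0 ≤ m r) (h1 : ∀ r, m r ≤ 1) (δ : ℝ) :
    ‖duhamelCLM hm h0 h1 δ‖ ≤ √δ * ∫ p, |p.2| ∂kernelMeasure := by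
  unfold duhamelCLM
  refine LinearMap.mkContinuous_norm_le _ ?_ _
  exact mul_nonneg (Real.sqrt_nonneg δ) (integral_nonneg fun p => abs_nonneg p.2)

theorem duhamelCLM_translate (hm : Antitone m) (h0 : ∀ r, 0 ≤ m r) (h1 : ∀ r, m r ≤ 1) (δ a : ℝ)
    (f : ℝ × ℝ →ᵇ ℝ) :
    duhamelCLM hm h0 h1 δ (translate a f) = translate a (duhamelCLM hm h0 h1 δ f) := by
  ext q
  rw [translate_apply, duhamelCLM_apply, duhamelCLM_apply, duhamel, duhamel]
  simp only [curry_apply, translate_apply]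
  refine congrArg (√(min q.1 δ) * ·) (integral_congr_ae (Filter.Eventually.of_forall fun p => ?_))
  simp only
  rw [add_right_comm]

end

/-- Short-time solutions of the mild equation, on a time interval that does not depend on `m` and
on the datum. -/
theorem exists_mild : ∃ δ : ℝ, 0 < δ ∧ ∀ (m : ℝ → ℝ), Antitone m → (∀ r, 0 ≤ m r) →
    (∀ r, m r ≤ 1) → ∀ h : ℕ → ℝ → ℝ, IsTower (fun j _ => h j) → (∀ x, |h 0 x| ≤ 1) →
    ∃ W, IsTower W ∧ ∀ s ≤ δ, ∀ x, W 0 s x =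
      heat s (h 0) x + duhamel m (fun r y => W 0 r y * W 0 r y) s x := by
  set κ : ℝ := ∫ p, |p.2| ∂kernelMeasure with hκ
  have hκ0 : 0 ≤ κ := integral_nonneg fun p => abs_nonneg p.2
  refine ⟨(1 / (8 * (κ + 1))) ^ 2, by positivity, fun m hm h0 h1 h hh hb => ?_⟩
  set δ : ℝ := (1 / (8 * (κ + 1))) ^ 2 with hδ
  have hB : ‖duhamelCLM hm h0 h1 δ‖ ≤ 1 / 8 := by
    refine (norm_duhamelCLM_le hm h0 h1 δ).trans ?_
    rw [← hκ, hδ, Real.sqrt_sq (by positivity), div_mul_eq_mul_div, div_le_div_iff₀ (by positivity)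
      (by norm_num)]
    linarith
  have hH : ‖hh.heat.toBCF 0‖ ≤ 1 :=
    (BoundedContinuousFunction.norm_le zero_le_one).2 fun q => abs_heat_le hb q.1 q.2
  obtain ⟨w, hw, hsm⟩ := exists_fixedPoint hB (duhamelCLM_translate hm h0 h1 δ) hH
    (hh.heat.contDiff_translate 0)
  obtain ⟨W, hW, hWw⟩ := exists_isTower_of_contDiff_translate hsm
  refine ⟨W, hW, fun s hs x => ?_⟩
  rw [hWw, hw]
  simp only [BoundedContinuousFunction.add_apply, IsTower.toBCF_apply, duhamelCLM_apply,
    min_eq_left hs]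
  congr 2
  ext r y
  simp [hWw]

/-- The Duhamel operator in the original time variable. -/
theorem duhamel_eq_integral {m : ℝ → ℝ} (hm : Measurable m) (h0 : ∀ r, 0 ≤ m r)
    (h1 : ∀ r, m r ≤ 1) {V : ℕ → ℝ → ℝ → ℝ} (hV : IsTower V) {s : ℝ} (hs : 0 ≤ s) (x : ℝ) :
    duhamel m (V 0) s x = ∫ r in 0..s, m r * (1 / 2 * heat (s - r) (V 1 r) x) := by
  obtain ⟨C, hC⟩ := hV.bdd 0
  obtain ⟨C', hC'⟩ := hV.bdd 1
  have hs' : 0 ≤ √s := Real.sqrt_nonneg s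
  set φ : ℝ → ℝ := fun a => s * (1 - a ^ 2) with hφ
  have himg : φ '' Icc 0 1 = Icc 0 s := by
    ext r; constructor
    · rintro ⟨a, ha, rfl⟩
      have : a ^ 2 ≤ 1 := pow_le_one₀ ha.1 ha.2
      exact ⟨mul_nonneg hs (by linarith), by simp only [hφ]; nlinarith [sq_nonneg a]⟩
    · intro hr
      rcases hs.eq_or_lt with rfl | hs0
      · exact ⟨0, by simp, by simp [hφ]; linarith [hr.1, hr.2]⟩
      · have h2 : 0 ≤ 1 - r / s := by
          rw [sub_nonneg, div_le_one hs0]; exact hr.2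
        have h3 : 0 ≤ r / s := div_nonneg hr.1 hs
        refine ⟨√(1 - r / s), ⟨Real.sqrt_nonneg _, Real.sqrt_le_one.2 (by linarith)⟩, ?_⟩
        simp only [hφ]
        rw [Real.sq_sqrt h2]; field_simp; ring
  have hanti : AntitoneOn φ (Icc 0 1) := by
    intro a ha b hb hab
    have : a ^ 2 ≤ b ^ 2 := pow_le_pow_left₀ ha.1 hab 2
    exact mul_le_mul_of_nonneg_left (by linarith) hs
  have hder : ∀ a ∈ Icc (0 : ℝ) 1, HasDerivWithinAt φ (-(2 * s * a)) (Icc 0 1) a := by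
    intro a _
    have := (((hasDerivAt_pow 2 a).const_sub 1).const_mul s).hasDerivWithinAt (s := Icc 0 1)
    convert! this using 1
    simp; ring
  rw [intervalIntegral.integral_of_le hs, ← integral_Icc_eq_integral_Ioc, ← himg,
    integral_image_eq_integral_deriv_smul_of_antitoneOn measurableSet_Icc hder hanti, duhamel,
    kernelMeasure, integral_prod _ (integrable_duhamel_integrand hm h0 h1 (hV.cont 0) hC s x),
    ← integral_const_mul]
  refine setIntegral_congr_fun measurableSet_Icc fun a ha => ?_
  have hsa : √(s - φ a) = √s * a := by
    have : s - φ a = s * a ^ 2 := by simp only [hφ]; ring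
    rw [this, Real.sqrt_mul hs, Real.sqrt_sq ha.1]
  have hstein : ∫ z, V 0 (φ a) (x + √s * a * z) * z ∂gauss =
      √s * a * heat (s - φ a) (V 1 (φ a)) x := by
    have hc : Continuous (V 1 (φ a)) := (hV.cont 1).comp (continuous_const.prodMk continuous_id)
    rw [integral_mul_id_gauss (f := fun z => V 0 (φ a) (x + √s * a * z))
      (f' := fun z => √s * a * V 1 (φ a) (x + √s * a * z)) (C := C) (C' := √s * a * C') ?_ ?_ ?_ ?_,
      integral_const_mul, heat, hsa]
    · intro z
      have h2 : HasDerivAt (fun z => x + √s * a * z) (√s * a) z := by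
        simpa using ((hasDerivAt_id z).const_mul (√s * a)).const_add x
      exact ((hV.hasDerivAt 0 (φ a) _).comp z h2).congr_deriv (mul_comm _ _)
    · exact (continuous_const.mul (hc.comp (by fun_prop))).measurable
    · exact fun z => hC _ _
    · intro z
      rw [abs_mul, abs_of_nonneg (mul_nonneg hs' ha.1)]
      exact mul_le_mul_of_nonneg_left (hC' _ _) (mul_nonneg hs' ha.1)
  calc √s * ∫ z, m (φ a) * V 0 (φ a) (x + √s * a * z) * z ∂gauss
      = √s * (m (φ a) * ∫ z, V 0 (φ a) (x + √s * a * z) * z ∂gauss) := by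
        rw [← integral_const_mul (m (φ a))]; simp only [mul_assoc]
    _ = (√s * √s) * a * (m (φ a) * heat (s - φ a) (V 1 (φ a)) x) := by rw [hstein]; ring
    _ = - -(2 * s * a) • (m (φ a) * (1 / 2 * heat (s - φ a) (V 1 (φ a)) x)) := by
        rw [Real.mul_self_sqrt hs, smul_eq_mul]; ring

/-- `W` is the tower of a solution on `[0,S]` of `∂_s w = ½ ∂_xx w + m (½ w²)_x`, `w(0) = h 0`, in
integrated form together with all its space derivatives. -/
structure IsSol (m : ℝ → ℝ) (h : ℕ → ℝ → ℝ) (S : ℝ) (W : ℕ → ℝ → ℝ → ℝ) : Prop where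
  tower : IsTower W
  eq : ∀ j, ∀ s ∈ Icc 0 S, ∀ x, W j s x = h j x + ∫ r in 0..s, (1 / 2 * W (j + 2) r x +
    m r * (1 / 2 * iteratedDeriv (j + 1) (fun y => W 0 r y * W 0 r y) x))

/-- The space derivatives of a mild solution of `∂_s w = ½ ∂_xx w + m K 0` are mild solutions. -/
theorem mild_deriv {m : ℝ → ℝ} (hm : Measurable m) (h0 : ∀ r, 0 ≤ m r)
    (h1 : ∀ r, m r ≤ 1) {h : ℕ → ℝ → ℝ} (hh : IsTower fun j _ => h j)
    {W K : ℕ → ℝ → ℝ → ℝ} (hW : IsTower W) (hK : IsTower K) {S : ℝ}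
    (hmild : ∀ s ∈ Icc 0 S, ∀ x, W 0 s x =
      heat s (h 0) x + ∫ r in 0..s, m r * heat (s - r) (K 0 r) x) :
    ∀ j, ∀ s ∈ Icc 0 S, ∀ x, W j s x =
      heat s (h j) x + ∫ r in 0..s, m r * heat (s - r) (K j r) x := by
  choose CK hCK using hK.bdd
  have hKs : ∀ j r, Continuous (K j r) := fun j r =>
    (hK.cont j).comp (continuous_const.prodMk continuous_id)
  have hheatc : ∀ j x s, Continuous fun r => heat (s - r) (K j r) x := fun j x s =>
    continuous_heat (f := fun r => K j r) (hK.cont j) (hCK j) (by fun_prop) continuous_const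
  have hmeas : ∀ j x s, Measurable fun r => m r * heat (s - r) (K j r) x := fun j x s =>
    hm.mul (hheatc j x s).measurable
  have hbd : ∀ j x s r, |m r * heat (s - r) (K j r) x| ≤ CK j := fun j x s r => by
    rw [abs_mul, abs_of_nonneg (h0 r)]
    calc _ ≤ 1 * |heat (s - r) (K j r) x| := by gcongr; exact h1 r
      _ ≤ CK j := by rw [one_mul]; exact abs_heat_le (hCK j r) _ _
  intro j s hs
  induction j with
  | zero => exact hmild s hs
  | succ j ih =>
    intro x
    have e1 := hW.hasDerivAt j s x
    have e2 : HasDerivAt (fun x => heat s (h j) x + ∫ r in 0..s, m r * heat (s - r) (K j r) x)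
        (heat s (h (j + 1)) x + ∫ r in 0..s, m r * heat (s - r) (K (j + 1) r) x) x := by
      refine (hh.heat.hasDerivAt j s x).add ?_
      simp only [intervalIntegral.integral_of_le hs.1]
      refine hasDerivAt_integral_of_bounded (F := fun r x => m r * heat (s - r) (K j r) x)
        (F' := fun r x => m r * heat (s - r) (K (j + 1) r) x) (bound := fun _ => CK (j + 1)) x
        (fun y => (hmeas j y s).aestronglyMeasurable) (hmeas _ x s).aestronglyMeasurable ?_
        (fun r y => hbd _ _ _ _) (integrable_const _) (fun r y => ?_)
      · exact Integrable.of_bound (hmeas j x s).aestronglyMeasurable (CK j)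
          (Filter.Eventually.of_forall fun r => hbd _ _ _ _)
      · exact (hasDerivAt_heat (hK.hasDerivAt j r)
          (hKs (j + 1) r) (hCK j r)
          (hCK (j + 1) r) (s - r) y).const_mul (m r)
    have e3 : W j s = fun x => heat s (h j) x + ∫ r in 0..s, m r * heat (s - r) (K j r) x :=
      funext ih
    rw [e3] at e1
    exact e1.unique e2

/-- A mild solution of `∂_s w = ½ ∂_xx w + m K` is a solution in integrated form. -/
theorem integrated_of_mild {m : ℝ → ℝ} (hm : Measurable m) (h0 : ∀ r, 0 ≤ m r)
    (h1 : ∀ r, m r ≤ 1) {h : ℕ → ℝ → ℝ} (hh : IsTower fun j _ => h j)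
    {W K : ℕ → ℝ → ℝ → ℝ} (hW : IsTower W) (hK : IsTower K)
    (j : ℕ) {s : ℝ} (hs : 0 ≤ s) (x : ℝ)
    (hmild : W j s x = heat s (h j) x + ∫ r in 0..s, m r * heat (s - r) (K j r) x)
    (hmild2 : ∀ q ∈ Icc 0 s, W (j + 2) q x =
      heat q (h (j + 2)) x + ∫ r in 0..q, m r * heat (q - r) (K (j + 2) r) x) :
    W j s x = h j x + ∫ r in 0..s, (1 / 2 * W (j + 2) r x + m r * K j r x) := by
  choose CK hCK using hK.bdd
  have hKs : ∀ j r, Continuous (K j r) := fun j r =>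
    (hK.cont j).comp (continuous_const.prodMk continuous_id)
  have hheatc : ∀ j x s, Continuous fun r => heat (s - r) (K j r) x := fun j x s =>
    continuous_heat (f := fun r => K j r) (hK.cont j) (hCK j) (by fun_prop) continuous_const
  have hmeas : ∀ j x s, Measurable fun r => m r * heat (s - r) (K j r) x := fun j x s =>
    hm.mul (hheatc j x s).measurable
  have hbd : ∀ j x s r, |m r * heat (s - r) (K j r) x| ≤ CK j := fun j x s r => by
    rw [abs_mul, abs_of_nonneg (h0 r)]
    calc _ ≤ 1 * |heat (s - r) (K j r) x| := by gcongr; exact h1 r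
      _ ≤ CK j := by rw [one_mul]; exact abs_heat_le (hCK j r) _ _
  choose Ch hCh using hh.bdd
  have hcont2 : Continuous fun p : ℝ × ℝ => heat (p.1 - p.2) (K (j + 2) p.2) x :=
    continuous_heat (f := fun p : ℝ × ℝ => K (j + 2) p.2)
      ((hK.cont (j + 2)).comp (f := fun q : (ℝ × ℝ) × ℝ => (q.1.2, q.2)) (by fun_prop))
      (fun p => hCK (j + 2) p.2) (by fun_prop) continuous_const
  have hWc : ∀ i, Continuous fun r => W i r x := fun i =>
    (hW.cont i).comp (continuous_id.prodMk continuous_const)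
  have hKc : ∀ i, Continuous fun r => K i r x := fun i =>
    (hK.cont i).comp (continuous_id.prodMk continuous_const)
  have hmK : IntervalIntegrable (fun r => m r * K j r x) volume 0 s := by
    refine intervalIntegrable_of_bounded (hm.mul (hKc j).measurable) (C := CK j) (fun r => ?_) 0 s
    rw [Pi.mul_apply, abs_mul, abs_of_nonneg (h0 r)]
    calc _ ≤ 1 * |K j r x| := by gcongr; exact h1 r
      _ ≤ CK j := by rw [one_mul]; exact hCK j r x
  have hmh : IntervalIntegrable (fun r => m r * heat (s - r) (K j r) x) volume 0 s :=
    intervalIntegrable_of_bounded (hmeas j x s) (hbd j x s) 0 s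
  have hWi : IntervalIntegrable (fun r => 1 / 2 * W (j + 2) r x) volume 0 s :=
    (continuous_const.mul (hWc _)).intervalIntegrable _ _
  have hheat : ∫ q in 0..s, 1 / 2 * heat q (h (j + 2)) x = heat s (h j) x - h j x :=
    (heat_sub_eq_integral (hh.hasDerivAt j 0) (hh.hasDerivAt (j + 1) 0)
      ((hh.cont (j + 2)).comp ((continuous_const (y := (0:ℝ))).prodMk continuous_id))
      (hCh j 0) (hCh (j + 1) 0) (hCh (j + 2) 0) hs x).symm
  have htri : ∫ q in 0..s, ∫ r in 0..q, 1 / 2 * (m r * heat (q - r) (K (j + 2) r) x) =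
      ∫ r in 0..s, (m r * heat (s - r) (K j r) x - m r * K j r x) := by
    rw [integral_integral_triangle (F := fun q r => 1 / 2 * (m r * heat (q - r) (K (j + 2) r) x))
      (C := CK (j + 2)) ?_ ?_ hs]
    · refine intervalIntegral.integral_congr fun r hr => ?_
      rw [uIcc_of_le hs] at hr
      have h2 := heat_sub_eq_integral (hK.hasDerivAt j r) (hK.hasDerivAt (j + 1) r)
        (hKs (j + 2) r) (hCK j r)
        (hCK (j + 1) r) (hCK (j + 2) r) (sub_nonneg.2 hr.2) x
      have h3 := intervalIntegral.integral_comp_sub_right (a := r) (b := s)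
        (fun θ => 1 / 2 * heat θ (K (j + 2) r) x) r
      rw [sub_self] at h3
      rw [← mul_sub, h2, ← h3, ← intervalIntegral.integral_const_mul]
      congr 1; ext q; ring
    · exact measurable_const.mul ((hm.comp measurable_snd).mul hcont2.measurable)
    · intro q r
      have := hbd (j + 2) x q r
      rw [abs_mul, abs_of_pos (by norm_num : (0:ℝ) < 1 / 2)]
      linarith [abs_nonneg (m r * heat (q - r) (K (j + 2) r) x)]
  have hW2 : ∫ q in 0..s, 1 / 2 * W (j + 2) q x = (heat s (h j) x - h j x) +
      ∫ r in 0..s, (m r * heat (s - r) (K j r) x - m r * K j r x) := by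
    have hc1 : Continuous fun q => 1 / 2 * heat q (h (j + 2)) x :=
      continuous_const.mul
        ((hh.heat.cont (j + 2)).comp (continuous_id.prodMk continuous_const))
    have hsplit : ∀ q ∈ uIcc 0 s, 1 / 2 * W (j + 2) q x - 1 / 2 * heat q (h (j + 2)) x =
        ∫ r in 0..q, 1 / 2 * (m r * heat (q - r) (K (j + 2) r) x) := by
      intro q hq
      rw [uIcc_of_le hs] at hq
      rw [hmild2 q hq, intervalIntegral.integral_const_mul]; ring
    rw [← hheat, ← htri, ← intervalIntegral.integral_congr hsplit,
      intervalIntegral.integral_sub hWi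
        (hc1.intervalIntegrable _ _)]
    ring
  rw [intervalIntegral.integral_add hWi hmK,
    hW2, intervalIntegral.integral_sub hmh hmK, hmild]
  ring

theorem isSol_of_mild {m : ℝ → ℝ} (hm : Measurable m) (h0 : ∀ r, 0 ≤ m r)
    (h1 : ∀ r, m r ≤ 1) {h : ℕ → ℝ → ℝ} (hh : IsTower fun j _ => h j) {S : ℝ}
    {W : ℕ → ℝ → ℝ → ℝ} (hW : IsTower W)
    (hmild : ∀ s ≤ S, ∀ x, W 0 s x =
      heat s (h 0) x + duhamel m (fun r y => W 0 r y * W 0 r y) s x) :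
    IsSol m h S W := by
  have hV := hW.mul hW
  obtain ⟨K, hKdef, hK⟩ : ∃ K : ℕ → ℝ → ℝ → ℝ, (∀ j s x, K j s x =
      1 / 2 * iteratedDeriv (j + 1) (fun y => W 0 s y * W 0 s y) x) ∧ IsTower K := by
    refine ⟨_, fun _ _ _ => rfl, ?_⟩
    have := (hV.shift 1).const_mul (1 / 2)
    simpa only [add_comm 1] using this
  have hmildj := mild_deriv hm h0 h1 hh hW hK (S := S) (fun s hs x => by
    rw [hmild s hs.2 x]
    congr 1
    have := duhamel_eq_integral hm h0 h1 hV hs.1 x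
    simp only [iteratedDeriv_zero] at this
    rw [this]
    refine intervalIntegral.integral_congr fun r _ => ?_
    simp only [heat, hKdef, integral_const_mul, zero_add])
  refine ⟨hW, fun j s hs x => ?_⟩
  rw [integrated_of_mild hm h0 h1 hh hW hK j hs.1 x (hmildj j s hs x)
    fun q hq => hmildj (j + 2) q ⟨hq.1, hq.2.trans hs.2⟩ x]
  simp only [hKdef]

/-! ### The maximum principle -/

theorem abs_sub_zero_le_of_deriv {g g' : ℝ → ℝ} (hd : ∀ y, HasDerivAt g (g' y) y) {k M : ℝ}
    (hM : ∀ y, |y| ≤ |k| → |g' y| ≤ M) : |g k - g 0| ≤ M * |k| := by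
  have := (convex_uIcc 0 k).norm_image_sub_le_of_norm_hasDerivWithin_le (f := g) (f' := g')
    (C := M) (fun y _ => (hd y).hasDerivWithinAt)
    (fun y hy => hM y (by simpa using abs_sub_left_of_mem_uIcc hy)) left_mem_uIcc right_mem_uIcc
  simpa using this

theorem abs_taylor_two_le {f f' f'' f''' : ℝ → ℝ} (h1 : ∀ y, HasDerivAt f (f' y) y)
    (h2 : ∀ y, HasDerivAt f' (f'' y) y) (h3 : ∀ y, HasDerivAt f'' (f''' y) y) {C : ℝ}
    (hC : ∀ y, |f''' y| ≤ C) (x k : ℝ) :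
    |f (x + k) - (f x + k * f' x + k ^ 2 / 2 * f'' x)| ≤ C * |k| ^ 3 := by
  have hC0 : 0 ≤ C := (abs_nonneg _).trans (hC 0)
  have e2 : ∀ k, |f'' (x + k) - f'' x| ≤ C * |k| := fun k => by
    simpa using abs_sub_zero_le_of_deriv (g := fun y => f'' (x + y))
      (fun y => (h3 (x + y)).comp_const_add x y) (k := k) (fun y _ => hC (x + y))
  have e1 : ∀ k, |f' (x + k) - (f' x + k * f'' x)| ≤ C * |k| * |k| := fun k => by
    have hd : ∀ y, HasDerivAt (fun y => f' (x + y) - (f' x + y * f'' x))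
        (f'' (x + y) - f'' x) y := fun y =>
      ((h2 (x + y)).comp_const_add x y).sub
        (by simpa using ((hasDerivAt_id y).mul_const (f'' x)).const_add (f' x))
    simpa using abs_sub_zero_le_of_deriv hd (k := k)
      (fun y hy => (e2 y).trans (mul_le_mul_of_nonneg_left hy hC0))
  have hd : ∀ y, HasDerivAt (fun y => f (x + y) - (f x + y * f' x + y ^ 2 / 2 * f'' x))
      (f' (x + y) - (f' x + y * f'' x)) y := fun y => by
    refine ((h1 (x + y)).comp_const_add x y).sub ?_
    have e3 := (((hasDerivAt_id y).mul_const (f' x)).const_add (f x)).add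
      (((hasDerivAt_pow 2 y).div_const 2).mul_const (f'' x))
    convert! e3 using 1
    simp
  have := abs_sub_zero_le_of_deriv hd (k := k)
    (M := C * |k| * |k|) (fun y hy => (e1 y).trans (by gcongr))
  simpa [pow_succ, mul_assoc] using this

section

variable {m : ℝ → ℝ} {h : ℕ → ℝ → ℝ} {S : ℝ} {W : ℕ → ℝ → ℝ → ℝ}

theorem IsTower.isTower_halfSquare (hW : IsTower W) : IsTower fun j s x =>
    1 / 2 * iteratedDeriv (j + 1) (fun y => W 0 s y * W 0 s y) x := by
  have := ((hW.mul hW).shift 1).const_mul (1 / 2)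
  simpa only [add_comm 1] using this

theorem IsTower.halfSquare_zero (hW : IsTower W) (s x : ℝ) :
    1 / 2 * iteratedDeriv (0 + 1) (fun y => W 0 s y * W 0 s y) x = W 0 s x * W 1 s x := by
  rw [zero_add, iteratedDeriv_one]
  have := ((hW.hasDerivAt 0 s x).mul (hW.hasDerivAt 0 s x)).deriv
  have h2 : (W 0 s * W 0 s) = fun y => W 0 s y * W 0 s y := rfl
  rw [h2] at this
  rw [this]; ring

theorem IsTower.exists_bound_rhs (hW : IsTower W) (h0 : ∀ r, 0 ≤ m r) (h1 : ∀ r, m r ≤ 1)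
    (j : ℕ) : ∃ C, ∀ r x, |1 / 2 * W (j + 2) r x +
      m r * (1 / 2 * iteratedDeriv (j + 1) (fun y => W 0 r y * W 0 r y) x)| ≤ C := by
  obtain ⟨C, hC⟩ := hW.bdd (j + 2)
  obtain ⟨D, hD⟩ := hW.isTower_halfSquare.bdd j
  refine ⟨1 / 2 * C + 1 * D, fun r x => ?_⟩
  refine (abs_add_le _ _).trans (add_le_add ?_ ?_)
  · rw [abs_mul, abs_of_pos (by norm_num : (0:ℝ) < 1 / 2)]
    exact mul_le_mul_of_nonneg_left (hC r x) (by norm_num)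
  · rw [abs_mul, abs_of_nonneg (h0 r)]
    exact mul_le_mul (h1 r) (hD r x) (abs_nonneg _) zero_le_one

theorem IsTower.intervalIntegrable_rhs (hW : IsTower W) (hm : Measurable m) (h0 : ∀ r, 0 ≤ m r)
    (h1 : ∀ r, m r ≤ 1) (j : ℕ) (x a b : ℝ) :
    IntervalIntegrable (fun r => 1 / 2 * W (j + 2) r x +
      m r * (1 / 2 * iteratedDeriv (j + 1) (fun y => W 0 r y * W 0 r y) x)) volume a b := by
  obtain ⟨C, hC⟩ := hW.exists_bound_rhs h0 h1 j
  have hs : Continuous fun r : ℝ => (r, x) := by fun_prop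
  refine intervalIntegrable_of_bounded ?_ (fun r => hC r x) a b
  exact (continuous_const.mul ((hW.cont _).comp hs)).measurable.add
    (hm.mul ((hW.isTower_halfSquare.cont j).comp hs).measurable)

theorem IsSol.sub_eq (hW : IsSol m h S W) (hm : Measurable m) (h0 : ∀ r, 0 ≤ m r)
    (h1 : ∀ r, m r ≤ 1) (j : ℕ) {s s' : ℝ} (hs : s ∈ Icc 0 S) (hs' : s' ∈ Icc 0 S) (x : ℝ) :
    W j s' x - W j s x = ∫ r in s..s', (1 / 2 * W (j + 2) r x +
      m r * (1 / 2 * iteratedDeriv (j + 1) (fun y => W 0 r y * W 0 r y) x)) := by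
  rw [hW.eq j s hs, hW.eq j s' hs', add_sub_add_left_eq_sub,
    intervalIntegral.integral_interval_sub_left] <;>
  exact hW.tower.intervalIntegrable_rhs hm h0 h1 _ _ _ _

theorem IsSol.exists_lipschitz (hW : IsSol m h S W) (hm : Measurable m) (h0 : ∀ r, 0 ≤ m r)
    (h1 : ∀ r, m r ≤ 1) (j : ℕ) : ∃ L, 0 ≤ L ∧ ∀ s ∈ Icc 0 S, ∀ s' ∈ Icc 0 S, ∀ x,
      |W j s' x - W j s x| ≤ L * |s' - s| := by
  obtain ⟨C, hC⟩ := hW.tower.exists_bound_rhs h0 h1 j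
  refine ⟨C, (abs_nonneg _).trans (hC 0 0), fun s hs s' hs' x => ?_⟩
  rw [hW.sub_eq hm h0 h1 j hs hs' x, ← Real.norm_eq_abs]
  exact intervalIntegral.norm_integral_le_of_norm_le_const fun r _ => hC r x

/-- Over a time step of length `η` the supremum of `|w|` grows by at most `O(η^{3/2})`, since up to
that error `w (s + η, x)` is the average of `w (s, ·)` over the two points `x + d ± √η`, where `d`
is the displacement due to the drift. -/
theorem IsSol.exists_step_bound (hW : IsSol m h S W) (hm : Measurable m) (h0 : ∀ r, 0 ≤ m r)
    (h1 : ∀ r, m r ≤ 1) : ∃ C, 0 ≤ C ∧ ∀ s η A, 0 ≤ s → 0 ≤ η → η ≤ 1 → s + η ≤ S →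
      (∀ x, |W 0 s x| ≤ A) → ∀ x, |W 0 (s + η) x| ≤ A + C * (η * √η) := by
  obtain ⟨C0, hC0⟩ := hW.tower.bdd 0
  obtain ⟨C1, hC1⟩ := hW.tower.bdd 1
  obtain ⟨C2, hC2⟩ := hW.tower.bdd 2
  obtain ⟨C3, hC3⟩ := hW.tower.bdd 3
  obtain ⟨L0, hL0, hL0'⟩ := hW.exists_lipschitz hm h0 h1 0
  obtain ⟨L1, hL1, hL1'⟩ := hW.exists_lipschitz hm h0 h1 1
  obtain ⟨L2, hL2, hL2'⟩ := hW.exists_lipschitz hm h0 h1 2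
  have p0 : 0 ≤ C0 := (abs_nonneg _).trans (hC0 0 0)
  have p1 : 0 ≤ C1 := (abs_nonneg _).trans (hC1 0 0)
  have p2 : 0 ≤ C2 := (abs_nonneg _).trans (hC2 0 0)
  have p3 : 0 ≤ C3 := (abs_nonneg _).trans (hC3 0 0)
  refine ⟨(1 / 2 * L2 + (C0 * L1 + C1 * L0)) + 1 / 2 * C0 ^ 2 * C2 + C3 * (1 + C0) ^ 3,
    by positivity, fun s η A hs hη hη1 hsS hA x => ?_⟩
  set ℓ := √η with hℓ
  have hℓ0 : 0 ≤ ℓ := Real.sqrt_nonneg η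
  have hℓη : ℓ ^ 2 = η := Real.sq_sqrt hη
  have hℓ1 : ℓ ≤ 1 := Real.sqrt_le_one.2 hη1
  have hηℓ : η ≤ ℓ := by nlinarith
  set β := ∫ r in s..(s + η), m r with hβ
  have hmi : IntervalIntegrable m volume s (s + η) :=
    intervalIntegrable_of_bounded hm (C := 1)
      (fun r => by rw [abs_of_nonneg (h0 r)]; exact h1 r) _ _
  have hsη : s ≤ s + η := by linarith
  have hβ0 : 0 ≤ β := intervalIntegral.integral_nonneg hsη fun r _ => h0 r
  have hβ1 : β ≤ η := by
    have := intervalIntegral.integral_mono_on hsη hmi (intervalIntegrable_const (c := (1 : ℝ)))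
      fun r _ => h1 r
    simpa using this
  set f := W 0 s with hf
  set a0 := W 0 s x with ha0
  set a1 := W 1 s x with ha1
  set a2 := W 2 s x with ha2
  have b0 : |a0| ≤ C0 := hC0 s x
  have b2 : |a2| ≤ C2 := hC2 s x
  -- Euler step
  have hEuler : |W 0 (s + η) x - (a0 + (1 / 2 * a2 * η + β * (a0 * a1)))| ≤
      (1 / 2 * L2 + (C0 * L1 + C1 * L0)) * η * η := by
    have e1 := hW.sub_eq hm h0 h1 0 (s := s) (s' := s + η) ⟨hs, by linarith⟩ ⟨by linarith, hsS⟩ x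
    have e2 : 1 / 2 * a2 * η + β * (a0 * a1) =
        ∫ r in s..(s + η), (1 / 2 * a2 + m r * (a0 * a1)) := by
      rw [intervalIntegral.integral_add intervalIntegrable_const (hmi.mul_const _),
        intervalIntegral.integral_mul_const, intervalIntegral.integral_const]
      simp; ring
    have e3 : W 0 (s + η) x - (a0 + (1 / 2 * a2 * η + β * (a0 * a1))) =
        ∫ r in s..(s + η), ((1 / 2 * W (0 + 2) r x +
          m r * (1 / 2 * iteratedDeriv (0 + 1) (fun y => W 0 r y * W 0 r y) x)) -
          (1 / 2 * a2 + m r * (a0 * a1))) := by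
      rw [intervalIntegral.integral_sub (hW.tower.intervalIntegrable_rhs hm h0 h1 _ _ _ _)
        (intervalIntegrable_const.add (hmi.mul_const _)), ← e1, ← e2]
      ring
    rw [e3]
    have e4 := intervalIntegral.norm_integral_le_of_norm_le_const (a := s) (b := s + η)
      (C := (1 / 2 * L2 + (C0 * L1 + C1 * L0)) * η)
      (f := fun r => (1 / 2 * W (0 + 2) r x +
          m r * (1 / 2 * iteratedDeriv (0 + 1) (fun y => W 0 r y * W 0 r y) x)) -
          (1 / 2 * a2 + m r * (a0 * a1))) ?_
    · simpa [abs_of_nonneg hη] using e4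
    intro r hr
    rw [uIoc_of_le hsη] at hr
    have hrS : r ∈ Icc 0 S := ⟨by linarith [hr.1], by linarith [hr.2]⟩
    have hsS' : s ∈ Icc 0 S := ⟨hs, by linarith⟩
    have hrs : |r - s| ≤ η := by rw [abs_of_pos (by linarith [hr.1])]; linarith [hr.2]
    rw [hW.tower.halfSquare_zero]
    have d0 : |W 0 r x - a0| ≤ L0 * η := (hL0' s hsS' r hrS x).trans (by gcongr)
    have d1 : |W 1 r x - a1| ≤ L1 * η := (hL1' s hsS' r hrS x).trans (by gcongr)
    have d2 : |W 2 r x - a2| ≤ L2 * η := (hL2' s hsS' r hrS x).trans (by gcongr)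
    have e5 : (1 / 2 * W (0 + 2) r x + m r * (W 0 r x * W 1 r x)) -
        (1 / 2 * a2 + m r * (a0 * a1)) = 1 / 2 * (W 2 r x - a2) +
        m r * (a0 * (W 1 r x - a1) + W 1 r x * (W 0 r x - a0)) := by rw [zero_add]; ring
    rw [e5, Real.norm_eq_abs]
    have e6 : |a0 * (W 1 r x - a1) + W 1 r x * (W 0 r x - a0)| ≤ C0 * (L1 * η) + C1 * (L0 * η) := by
      refine (abs_add_le _ _).trans ?_
      rw [abs_mul, abs_mul]
      gcongr
      exact hC1 r x
    calc _ ≤ 1 / 2 * |W 2 r x - a2| +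
          m r * |a0 * (W 1 r x - a1) + W 1 r x * (W 0 r x - a0)| := by
          refine (abs_add_le _ _).trans ?_
          rw [abs_mul, abs_mul, abs_of_pos (by norm_num : (0:ℝ) < 1 / 2), abs_of_nonneg (h0 r)]
      _ ≤ 1 / 2 * (L2 * η) + 1 * (C0 * (L1 * η) + C1 * (L0 * η)) := by
          gcongr
          exact h1 r
      _ = _ := by ring
  -- the Euler step as an average
  set d := β * a0 with hd
  have hdb : |d| ≤ η * C0 := by
    rw [hd, abs_mul, abs_of_nonneg hβ0]; gcongr
  have hT := abs_taylor_two_le (hW.tower.hasDerivAt 0 s) (hW.tower.hasDerivAt 1 s)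
    (hW.tower.hasDerivAt 2 s) (hC3 s) x
  have hR : ∀ k, |k| ≤ ℓ * (1 + C0) → C3 * |k| ^ 3 ≤ C3 * (1 + C0) ^ 3 * (η * ℓ) := by
    intro k hk
    calc C3 * |k| ^ 3 ≤ C3 * (ℓ * (1 + C0)) ^ 3 := by gcongr
      _ = C3 * (1 + C0) ^ 3 * (ℓ ^ 2 * ℓ) := by ring
      _ = _ := by rw [hℓη]
  have hk1 : |d + ℓ| ≤ ℓ * (1 + C0) := by
    refine (abs_add_le _ _).trans ?_
    rw [abs_of_nonneg hℓ0]
    nlinarith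
  have hk2 : |d - ℓ| ≤ ℓ * (1 + C0) := by
    refine (abs_sub _ _).trans ?_
    rw [abs_of_nonneg hℓ0]
    nlinarith
  have t1 := (hT (d + ℓ)).trans (hR _ hk1)
  have t2 := (hT (d - ℓ)).trans (hR _ hk2)
  have hA1 := hA (x + (d + ℓ))
  have hA2 := hA (x + (d - ℓ))
  have hq : |1 / 2 * d ^ 2 * a2| ≤ 1 / 2 * C0 ^ 2 * C2 * (η * ℓ) := by
    rw [abs_mul, abs_mul, abs_of_pos (by norm_num : (0:ℝ) < 1 / 2), abs_pow]
    calc 1 / 2 * |d| ^ 2 * |a2| ≤ 1 / 2 * (η * C0) ^ 2 * C2 := by gcongr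
      _ = 1 / 2 * C0 ^ 2 * C2 * (η * η) := by ring
      _ ≤ _ := by gcongr
  have hE2 : (1 / 2 * L2 + (C0 * L1 + C1 * L0)) * η * η ≤
      (1 / 2 * L2 + (C0 * L1 + C1 * L0)) * (η * ℓ) := by
    rw [mul_assoc]; gcongr
  have hid : a0 + (1 / 2 * a2 * η + β * (a0 * a1)) =
      1 / 2 * ((a0 + (d + ℓ) * a1 + (d + ℓ) ^ 2 / 2 * a2) +
        (a0 + (d - ℓ) * a1 + (d - ℓ) ^ 2 / 2 * a2)) - 1 / 2 * d ^ 2 * a2 := by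
    rw [← hℓη, hd]; ring
  rw [hid] at hEuler
  have hE := hEuler.trans hE2
  rw [abs_le] at *
  constructor <;> linarith

/-- Maximum principle. -/
theorem IsSol.abs_le_one (hW : IsSol m h S W) (hm : Measurable m) (h0 : ∀ r, 0 ≤ m r)
    (h1 : ∀ r, m r ≤ 1) (hh : ∀ x, |h 0 x| ≤ 1) {s : ℝ} (hs : s ∈ Icc 0 S) (x : ℝ) :
    |W 0 s x| ≤ 1 := by
  obtain ⟨C, hC0, hC⟩ := hW.exists_step_bound hm h0 h1
  have hev : ∀ᶠ n : ℕ in Filter.atTop, |W 0 s x| ≤ 1 + C * (s * √(s / n)) := by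
    filter_upwards [Filter.eventually_ge_atTop (max 1 ⌈s⌉₊)] with n hn
    have hn1 : 1 ≤ n := (le_max_left _ _).trans hn
    have hn0 : (0 : ℝ) < n := by exact_mod_cast hn1
    have hsn : s ≤ n := (Nat.le_ceil s).trans (by exact_mod_cast (le_max_right _ _).trans hn)
    set η := s / n with hη
    have hη0 : 0 ≤ η := div_nonneg hs.1 hn0.le
    have hη1 : η ≤ 1 := (div_le_one hn0).2 hsn
    have hk : ∀ k : ℕ, k ≤ n → ∀ x, |W 0 (k * η) x| ≤ 1 + k * (C * (η * √η)) := by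
      intro k
      induction k with
      | zero =>
        intro _ x
        have := hW.eq 0 0 ⟨le_rfl, hs.1.trans hs.2⟩ x
        simp only [intervalIntegral.integral_same, add_zero] at this
        simpa [this] using hh x
      | succ k ih =>
        intro hkn x
        have e1 : ((k + 1 : ℕ) : ℝ) * η = k * η + η := by push_cast; ring
        have e2 : ((k + 1 : ℕ) : ℝ) * η ≤ S := by
          refine le_trans ?_ hs.2
          calc ((k + 1 : ℕ) : ℝ) * η ≤ n * η := by gcongr
            _ = s := by rw [hη]; field_simp
        rw [e1] at e2 ⊢
        have := hC (k * η) η _ (by positivity) hη0 hη1 e2 (ih (by omega)) x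
        refine this.trans (le_of_eq ?_)
        push_cast; ring
    have := hk n le_rfl x
    have e3 : (n : ℝ) * η = s := by rw [hη]; field_simp
    rw [e3] at this
    refine this.trans (le_of_eq ?_)
    rw [← e3]; ring
  have hlim : Filter.Tendsto (fun n : ℕ => 1 + C * (s * √(s / n))) Filter.atTop (nhds 1) := by
    have e1 : Filter.Tendsto (fun n : ℕ => s / (n : ℝ)) Filter.atTop (nhds 0) :=
      tendsto_const_div_atTop_nhds_zero_nat s
    have e2 := ((Real.continuous_sqrt.tendsto 0).comp e1).const_mul s |>.const_mul C |>.const_add 1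
    simpa using e2
  exact ge_of_tendsto hlim hev

/-! ### Global solutions -/

/-- Concatenation of solutions. -/
theorem IsSol.glue {V : ℕ → ℝ → ℝ → ℝ} {δ : ℝ} (hm : Measurable m) (h0 : ∀ r, 0 ≤ m r)
    (h1 : ∀ r, m r ≤ 1) (hS : 0 ≤ S) (hδ : 0 ≤ δ) (hW : IsSol m h S W)
    (hV : IsSol (fun r => m (r + S)) (fun j => W j S) δ V) :
    ∃ U, IsSol m h (S + δ) U := by
  have hV0 : ∀ j x, V j 0 x = W j S x := fun j x => by
    have := hV.eq j 0 ⟨le_rfl, hδ⟩ x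
    simpa using this
  set U : ℕ → ℝ → ℝ → ℝ := fun j s => if s ≤ S then W j s else V j (s - S) with hU
  have hUW : ∀ j s, s ≤ S → U j s = W j s := fun j s hs => if_pos hs
  have hUV : ∀ j s, S < s → U j s = V j (s - S) := fun j s hs => if_neg hs.not_ge
  have hUt : IsTower U := by
    refine ⟨fun j => ?_, fun j => ?_, fun j s x => ?_⟩
    · have e1 : uncurry (U j) =
          fun p => if p.1 ≤ S then uncurry (W j) p else uncurry (V j) (p.1 - S, p.2) := by
        ext ⟨s, x⟩
        simp only [hU, uncurry]
        split_ifs <;> rfl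
      rw [e1]
      refine Continuous.if_le (hW.tower.cont j)
        ((hV.tower.cont j).comp (by fun_prop)) continuous_fst continuous_const ?_
      rintro ⟨s, x⟩ hs
      have hs' : s = S := hs
      subst hs'
      simp [uncurry, hV0]
    · obtain ⟨C, hC⟩ := hW.tower.bdd j
      obtain ⟨D, hD⟩ := hV.tower.bdd j
      refine ⟨max C D, fun s x => ?_⟩
      rcases le_or_gt s S with hs | hs
      · rw [hUW j s hs]; exact (hC s x).trans (le_max_left _ _)
      · rw [hUV j s hs]; exact (hD _ x).trans (le_max_right _ _)
    · rcases le_or_gt s S with hs | hs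
      · rw [hUW j s hs, hUW (j + 1) s hs]; exact hW.tower.hasDerivAt j s x
      · rw [hUV j s hs, hUV (j + 1) s hs]; exact hV.tower.hasDerivAt j _ x
  have hleft : ∀ j, ∀ s ∈ Icc 0 S, ∀ x, U j s x = h j x + ∫ r in 0..s, (1 / 2 * U (j + 2) r x +
      m r * (1 / 2 * iteratedDeriv (j + 1) (fun y => U 0 r y * U 0 r y) x)) := by
    intro j s hs x
    rw [hUW j s hs.2, hW.eq j s hs]
    congr 1
    refine intervalIntegral.integral_congr fun r hr => ?_
    rw [uIcc_of_le hs.1] at hr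
    simp only [hUW _ r (hr.2.trans hs.2)]
  refine ⟨U, hUt, fun j s hs x => ?_⟩
  rcases le_or_gt s S with hsS | hsS
  · exact hleft j s ⟨hs.1, hsS⟩ x
  · rw [← intervalIntegral.integral_add_adjacent_intervals
      (hUt.intervalIntegrable_rhs hm h0 h1 j x 0 S) (hUt.intervalIntegrable_rhs hm h0 h1 j x S s),
      ← add_assoc, ← hleft j S ⟨hS, le_rfl⟩ x, hUV j s hsS, hUW j S le_rfl,
      hV.eq j (s - S) ⟨by linarith, by linarith [hs.2]⟩ x]
    congr 1
    have e1 := intervalIntegral.integral_comp_sub_right (a := S) (b := s)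
      (fun r => 1 / 2 * V (j + 2) r x +
        m (r + S) * (1 / 2 * iteratedDeriv (j + 1) (fun y => V 0 r y * V 0 r y) x)) S
    rw [sub_self] at e1
    rw [← e1]
    refine intervalIntegral.integral_congr_ae (Filter.Eventually.of_forall fun r hr => ?_)
    rw [uIoc_of_le hsS.le] at hr
    simp only [hUV _ r hr.1, sub_add_cancel]

theorem exists_isSol (hm : Antitone m) (h0 : ∀ r, 0 ≤ m r) (h1 : ∀ r, m r ≤ 1)
    (hh : IsTower fun j _ => h j) (hb : ∀ x, |h 0 x| ≤ 1) (S : ℝ) : ∃ W, IsSol m h S W := by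
  obtain ⟨δ, hδ, hex⟩ := exists_mild
  have key : ∀ n : ℕ, ∃ W, IsSol m h (n * δ) W := by
    intro n
    induction n with
    | zero =>
      refine ⟨fun j _ => h j, hh, fun j s hs x => ?_⟩
      have : s = 0 := le_antisymm (by simpa using hs.2) hs.1
      simp [this]
    | succ n ih =>
      obtain ⟨W, hW⟩ := ih
      have hn : 0 ≤ n * δ := by positivity
      have hm' : Antitone fun r => m (r + n * δ) := fun a b hab => hm (by linarith)
      have hh' : IsTower fun j _ => W j (n * δ) :=
        hW.tower.comp_time (σ := fun _ => n * δ) continuous_const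
      obtain ⟨V, hV, hV'⟩ := hex _ hm' (fun _ => h0 _) (fun _ => h1 _) _ hh'
        (hW.abs_le_one hm.measurable h0 h1 hb ⟨hn, le_rfl⟩)
      obtain ⟨U, hU⟩ := hW.glue hm.measurable h0 h1 hn hδ.le
        (isSol_of_mild hm'.measurable (fun _ => h0 _) (fun _ => h1 _) hh' hV hV')
      refine ⟨U, ?_⟩
      have : ((n + 1 : ℕ) : ℝ) * δ = n * δ + δ := by push_cast; ring
      rwa [this]
  obtain ⟨n, hn⟩ := exists_nat_ge (S / δ)
  obtain ⟨W, hW⟩ := key n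
  rw [div_le_iff₀ hδ] at hn
  exact ⟨W, hW.tower, fun j s hs x => hW.eq j s ⟨hs.1, hs.2.trans hn⟩ x⟩

end

/-! ### The mixture -/

theorem Admissible.analyticAt_mixture {β : ℕ+ → ℝ} (hβ : Admissible β) :
    ∃ ε > 0, (∀ t, |t| ≤ 1 + ε → Summable fun p : ℕ+ => β p ^ 2 * t ^ (p : ℕ)) ∧
      ∀ t, |t| < 1 + ε → AnalyticAt ℝ (mixture β) t := by
  obtain ⟨ε, hε, hs⟩ := hβ
  refine ⟨ε, hε, fun t ht => ?_, ?_⟩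
  · refine Summable.of_norm_bounded hs fun p => ?_
    rw [norm_mul, norm_pow _ (p : ℕ), Real.norm_of_nonneg (sq_nonneg (β p)), Real.norm_eq_abs]
    gcongr
  set c : ℕ → ℝ := fun n => if h : 0 < n then β ⟨n, h⟩ ^ 2 else 0 with hc
  have hc0 : ∀ n ∉ range ((↑) : ℕ+ → ℕ), c n = 0 := by
    intro n hn
    have : ¬ 0 < n := fun h => hn ⟨⟨n, h⟩, rfl⟩
    simp [hc, this]
  have hcp : ∀ p : ℕ+, c p = β p ^ 2 := fun p => by
    simp only [hc, p.pos, dite_true]; rfl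
  set P : FormalMultilinearSeries ℝ ℝ ℝ := FormalMultilinearSeries.ofScalars ℝ c with hP
  have hsum : P.sum = mixture β := by
    ext t
    rw [mixture, FormalMultilinearSeries.sum, ← PNat.coe_injective.tsum_eq (f := fun n => P n fun _ => t)]
    · refine tsum_congr fun p => ?_
      rw [hP, FormalMultilinearSeries.ofScalars_apply_eq, hcp, smul_eq_mul]
    · intro n hn
      by_contra hcon
      apply hn
      simp only [hP]
      rw [FormalMultilinearSeries.ofScalars_apply_eq, hc0 n hcon, zero_smul]
  have hrad : ((1 + ε).toNNReal : ENNReal) ≤ P.radius := by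
    apply P.le_radius_of_summable
    rw [← PNat.coe_injective.summable_iff]
    · refine hs.congr fun p => ?_
      simp only [comp_apply, hP, FormalMultilinearSeries.ofScalars_norm, hcp,
        Real.coe_toNNReal (1 + ε) (by linarith)]
      rw [Real.norm_of_nonneg (sq_nonneg _)]
    · intro n hn
      simp [hP, hc0 n hn]
  have hfp := P.hasFPowerSeriesOnBall (lt_of_lt_of_le (by simp; linarith) hrad)
  rw [hsum] at hfp
  intro t ht
  refine hfp.analyticAt_of_mem (Metric.mem_eball.2 (lt_of_lt_of_le ?_ hrad))
  rw [edist_zero_right, enorm_eq_nnnorm, ENNReal.coe_lt_coe, ← NNReal.coe_lt_coe,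
    Real.coe_toNNReal _ (by linarith)]
  exact ht

theorem Admissible.mixture_facts {β : ℕ+ → ℝ} (hβ : Admissible β) :
    ContinuousOn (deriv (deriv (mixture β))) (Icc 0 1) ∧
    (∀ t ∈ Icc (0 : ℝ) 1, HasDerivWithinAt (deriv (mixture β)) (deriv (deriv (mixture β)) t)
      (Icc 0 1) t) ∧
    ∀ t ∈ Icc (0 : ℝ) 1, 0 ≤ deriv (deriv (mixture β)) t := by
  obtain ⟨ε, hε, hsum, han⟩ := hβ.analyticAt_mixture
  have han' : ∀ t ∈ Icc (0 : ℝ) 1, AnalyticAt ℝ (mixture β) t := fun t ht =>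
    han t (by rw [abs_of_nonneg ht.1]; linarith [ht.2])
  have hder : ∀ t ∈ Icc (0 : ℝ) 1, HasDerivWithinAt (deriv (mixture β))
      (deriv (deriv (mixture β)) t) (Icc 0 1) t := fun t ht =>
    (han' t ht).deriv.differentiableAt.hasDerivAt.hasDerivWithinAt
  refine ⟨fun t ht => (han' t ht).deriv.deriv.continuousAt.continuousWithinAt, hder,
    fun t ht => ?_⟩
  have hconv : ConvexOn ℝ (Icc 0 1) (mixture β) := by
    have hs : ∀ t ∈ Icc (0 : ℝ) 1, Summable fun p : ℕ+ => β p ^ 2 * t ^ (p : ℕ) := fun t ht =>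
      hsum t (by rw [abs_of_nonneg ht.1]; linarith [ht.2])
    refine ⟨convex_Icc 0 1, fun x hx y hy a b ha hb hab => ?_⟩
    have hxy := (convex_Icc (0 : ℝ) 1) hx hy ha hb hab
    simp only [mixture, smul_eq_mul] at *
    rw [← tsum_mul_left, ← tsum_mul_left, ← ((hs x hx).mul_left a).tsum_add ((hs y hy).mul_left b)]
    refine (hs _ hxy).tsum_le_tsum (fun p => ?_) (((hs x hx).mul_left a).add ((hs y hy).mul_left b))
    have := (convexOn_pow (𝕜 := ℝ) (p : ℕ)).2 (mem_Ici.2 hx.1) (mem_Ici.2 hy.1) ha hb hab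
    simp only [smul_eq_mul] at this
    nlinarith [mul_le_mul_of_nonneg_left this (sq_nonneg (β p))]
  have hmono := hconv.monotoneOn_deriv fun t ht => (han' t ht).differentiableAt
  rw [← (hder t ht).derivWithin ((uniqueDiffOn_Icc zero_lt_one) t ht)]
  exact hmono.derivWithin_nonneg

/-! ### The terminal datum -/

theorem hasDerivAt_tanh (x : ℝ) : HasDerivAt Real.tanh (1 - Real.tanh x ^ 2) x := by
  have hc := (Real.cosh_pos x).ne'
  have := (Real.hasDerivAt_sinh x).div (Real.hasDerivAt_cosh x) hc
  have e : Real.tanh = fun y => Real.sinh y / Real.cosh y := by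
    ext y; exact Real.tanh_eq_sinh_div_cosh y
  rw [e]
  convert! this using 1
  simp only; field_simp

theorem hasDerivAt_logCosh (x : ℝ) : HasDerivAt logCosh (Real.tanh x) x := by
  have := (Real.hasDerivAt_cosh x).log (Real.cosh_pos x).ne'
  rwa [← Real.tanh_eq_sinh_div_cosh] at this

theorem abs_tanh_le_one (x : ℝ) : |Real.tanh x| ≤ 1 :=
  abs_le.2 ⟨(Real.neg_one_lt_tanh x).le, (Real.tanh_lt_one x).le⟩

theorem isTower_logCosh : IsTower fun j _ => iteratedDeriv (j + 1) logCosh := by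
  -- the derivatives are polynomials in `tanh`
  let P : ℕ → Polynomial ℝ := fun j => Nat.rec Polynomial.X
    (fun _ Q => Polynomial.derivative Q * (1 - Polynomial.X ^ 2)) j
  have hd : ∀ j x, HasDerivAt (fun y => (P j).eval (Real.tanh y)) ((P (j + 1)).eval (Real.tanh x))
      x := by
    intro j x
    have := ((P j).hasDerivAt (Real.tanh x)).comp x (hasDerivAt_tanh x)
    convert! this using 1
    change (Polynomial.derivative (P j) * (1 - Polynomial.X ^ 2)).eval _ = _
    simp
  have heq : ∀ j, iteratedDeriv (j + 1) logCosh = fun y => (P j).eval (Real.tanh y) := by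
    intro j
    induction j with
    | zero =>
      rw [zero_add, iteratedDeriv_one]; ext x
      rw [(hasDerivAt_logCosh x).deriv]
      change _ = (Polynomial.X : Polynomial ℝ).eval _
      simp
    | succ j ih =>
      rw [iteratedDeriv_succ, ih]; ext x; exact (hd j x).deriv
  have hc : ∀ j, Continuous fun y => (P j).eval (Real.tanh y) := fun j =>
    continuous_iff_continuousAt.2 fun x => (hd j x).continuousAt
  refine ⟨fun j => ?_, fun j => ?_, fun j _ x => ?_⟩
  · simp only [heq]; exact (hc j).comp continuous_snd
  · obtain ⟨C, hC⟩ := (isCompact_Icc (a := (-1 : ℝ)) (b := 1)).exists_bound_of_continuousOn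
      (P j).continuous.continuousOn
    refine ⟨C, fun _ x => ?_⟩
    rw [heq]
    exact hC _ (abs_le.1 (abs_tanh_le_one x))
  · simp only [heq]; exact hd j x

/-! ### Change of the time variable -/

/-- The projection of `ℝ` to `[0,1]`. -/
noncomputable def clamp (t : ℝ) : ℝ := max 0 (min 1 t)

theorem clamp_mem (t : ℝ) : clamp t ∈ Icc (0 : ℝ) 1 :=
  ⟨le_max_left _ _, max_le zero_le_one (min_le_left _ _)⟩

theorem clamp_of_mem {t : ℝ} (ht : t ∈ Icc (0 : ℝ) 1) : clamp t = t := by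
  simp [clamp, ht.1, ht.2]

theorem continuous_clamp : Continuous clamp := by unfold clamp; fun_prop

theorem clamp_clamp (t : ℝ) : clamp (clamp t) = clamp t := clamp_of_mem (clamp_mem t)

theorem clamp_mono : Monotone clamp := fun _ _ h => max_le_max le_rfl (min_le_min le_rfl h)

/-- Solutions of the backward equation with time coefficient `α = A'/2`, obtained from the forward
equation with constant coefficients in the time variable `A 1 - A t`. -/
theorem exists_backward_tower {A α m : ℝ → ℝ}
    (hA : ∀ t ∈ Icc (0 : ℝ) 1, HasDerivWithinAt A (2 * α t) (Icc 0 1) t)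
    (hα : ∀ t, 0 ≤ α t) (hm : Monotone m) (h0 : ∀ r, 0 ≤ m r) (h1 : ∀ r, m r ≤ 1)
    {h : ℕ → ℝ → ℝ} (hh : IsTower fun j _ => h j) (hb : ∀ x, |h 0 x| ≤ 1) :
    ∃ W, IsTower W ∧ (∀ j t, W j (clamp t) = W j t) ∧ ∀ j, ∀ t ∈ Icc (0 : ℝ) 1, ∀ x,
      W j t x = h j x + ∫ r in t..1, α r * (W (j + 2) r x +
        m r * iteratedDeriv (j + 1) (fun y => W 0 r y * W 0 r y) x) := by
  have hAc : ContinuousOn A (Icc 0 1) := fun t ht => (hA t ht).continuousWithinAt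
  have hAmono : MonotoneOn A (Icc 0 1) := by
    refine monotoneOn_of_hasDerivWithinAt_nonneg (convex_Icc 0 1) hAc (f' := fun t => 2 * α t)
      (fun t ht => (hA t (interior_subset ht)).mono interior_subset)
      fun t _ => mul_nonneg zero_le_two (hα t)
  set σ : ℝ → ℝ := fun t => A 1 - A (clamp t) with hσ
  have hσc : Continuous σ :=
    continuous_const.sub (hAc.comp_continuous continuous_clamp clamp_mem)
  have hσanti : Antitone σ := fun s t hst =>
    sub_le_sub_left (hAmono (clamp_mem s) (clamp_mem t) (clamp_mono hst)) _
  have hσ1 : σ 1 = 0 := by simp [hσ, clamp]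
  have hσd : ∀ t ∈ Icc (0 : ℝ) 1, HasDerivWithinAt σ (-(2 * α t)) (Icc 0 1) t := fun t ht => by
    refine ((hA t ht).const_sub (A 1)).congr (fun s hs => ?_) ?_
    · simp only [hσ, clamp_of_mem hs]
    · simp only [hσ, clamp_of_mem ht]
  set S := σ 0 with hS
  have hS0 : 0 ≤ S := by rw [← hσ1]; exact hσanti zero_le_one
  have hsurj : ∀ t ∈ Icc (0 : ℝ) 1, σ '' Icc t 1 = Icc 0 (σ t) := fun t ht => by
    refine Subset.antisymm ?_ ?_
    · rintro _ ⟨r, hr, rfl⟩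
      exact ⟨by rw [← hσ1]; exact hσanti hr.2, hσanti hr.1⟩
    · have := intermediate_value_Icc' ht.2 (hσc.continuousOn (s := Icc t 1))
      rwa [hσ1] at this
  have hchoice : ∀ s : ℝ, ∃ t ∈ Icc (0 : ℝ) 1, s ∈ Icc 0 S → σ t = s := fun s => by
    by_cases hs : s ∈ Icc 0 S
    · rw [hS, ← hsurj 0 ⟨le_rfl, zero_le_one⟩] at hs
      obtain ⟨t, ht, hts⟩ := hs
      exact ⟨t, ht, fun _ => hts⟩
    · exact ⟨0, ⟨le_rfl, zero_le_one⟩, fun h => absurd h hs⟩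
  choose τ hτ hστ using hchoice
  have hcl : ∀ s : ℝ, max 0 (min s S) ∈ Icc 0 S := fun s =>
    ⟨le_max_left _ _, max_le hS0 (min_le_right _ _)⟩
  set m' : ℝ → ℝ := fun s => m (τ (max 0 (min s S))) with hm'
  have hm'anti : Antitone m' := by
    intro s s' hss
    refine hm ?_
    have hle : max 0 (min s S) ≤ max 0 (min s' S) := max_le_max le_rfl (min_le_min hss le_rfl)
    rcases hle.eq_or_lt with he | hlt
    · rw [he]
    · by_contra hcon
      have := hσanti (not_le.1 hcon).le
      rw [hστ _ (hcl s), hστ _ (hcl s')] at this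
      exact absurd hlt this.not_gt
  -- where `τ (σ r) ≠ r`, the function `σ` is constant near `r` on one side, so `α r = 0`
  have hαm : ∀ r ∈ Icc (0 : ℝ) 1, α r * m' (σ r) = α r * m r := by
    intro r hr
    have hσr : σ r ∈ Icc 0 S := by
      rw [← hσ1]; exact ⟨hσanti hr.2, hσanti hr.1⟩
    have hmax : max 0 (min (σ r) S) = σ r := by rw [min_eq_left hσr.2, max_eq_right hσr.1]
    simp only [hm', hmax]
    set r' := τ (σ r) with hr'
    have hr'm : r' ∈ Icc (0 : ℝ) 1 := hτ _
    have hσrr : σ r' = σ r := hστ _ hσr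
    by_cases hne : r' = r
    · rw [hne]
    · have hsub : uIcc r r' ⊆ Icc 0 1 := uIcc_subset_Icc hr hr'm
      have hconst : ∀ y ∈ uIcc r r', σ y = σ r := by
        intro y hy
        rcases le_total r r' with hle | hle
        · rw [uIcc_of_le hle] at hy
          exact le_antisymm (hσanti hy.1) (by rw [← hσrr]; exact hσanti hy.2)
        · rw [uIcc_of_ge hle] at hy
          exact le_antisymm (by rw [← hσrr]; exact hσanti hy.1) (hσanti hy.2)
      have d1 := (hσd r hr).mono hsub
      have d2 : HasDerivWithinAt σ 0 (uIcc r r') r :=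
        (hasDerivWithinAt_const r (uIcc r r') (σ r)).congr hconst rfl
      have hu : UniqueDiffWithinAt ℝ (uIcc r r') r := by
        have : min r r' < max r r' := by
          rcases lt_or_gt_of_ne hne with h | h <;> simp [h]
        exact uniqueDiffOn_Icc this r left_mem_uIcc
      have := hu.eq_deriv _ d1 d2
      have : α r = 0 := by linarith
      rw [this, zero_mul, zero_mul]
  obtain ⟨W, hW⟩ := exists_isSol hm'anti (fun _ => h0 _) (fun _ => h1 _) hh hb S
  refine ⟨fun j t => W j (σ t), hW.tower.comp_time hσc, fun j t => ?_, fun j t ht x => ?_⟩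
  · simp only [hσ, clamp_clamp]
  · have hσt : σ t ∈ Icc 0 S := by
      rw [← hσ1]; exact ⟨hσanti ht.2, hσanti ht.1⟩
    have hsub : Icc t 1 ⊆ Icc 0 1 := Icc_subset_Icc_left ht.1
    refine (hW.eq j (σ t) hσt x).trans ?_
    congr 1
    rw [intervalIntegral.integral_of_le hσt.1, ← integral_Icc_eq_integral_Ioc, ← hsurj t ht,
      integral_image_eq_integral_deriv_smul_of_antitoneOn measurableSet_Icc
        (fun r hr => (hσd r (hsub hr)).mono hsub) (hσanti.antitoneOn _),
      intervalIntegral.integral_of_le ht.2, ← integral_Icc_eq_integral_Ioc]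
    refine setIntegral_congr_fun measurableSet_Icc fun r hr => ?_
    have := hαm r (hsub hr)
    simp only [smul_eq_mul, neg_neg]
    linear_combination (iteratedDeriv (j + 1) (fun y => W 0 (σ r) y * W 0 (σ r) y) x) * this

/-! ### Test functions and integration over the strip -/

/-- Smooth compactly supported functions on `ℝ × ℝ`. -/
structure IsTest (φ : ℝ → ℝ → ℝ) : Prop where
  smooth : ContDiff ℝ ∞ (uncurry φ)
  hasCompactSupport : HasCompactSupport (uncurry φ)

theorem IsTestFunction.isTest {Ω : Set (ℝ × ℝ)} {φ : ℝ → ℝ → ℝ} (h : IsTestFunction Ω φ) :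
    IsTest φ := ⟨h.smooth, h.hasCompactSupport⟩

theorem IsTestFunction.eq_zero {Ω : Set (ℝ × ℝ)} {φ : ℝ → ℝ → ℝ} (h : IsTestFunction Ω φ)
    {t x : ℝ} (ht : (t, x) ∉ Ω) : φ t x = 0 :=
  image_eq_zero_of_notMem_tsupport (f := uncurry φ) fun hm => ht (h.tsupport_subset hm)

namespace IsTest

variable {φ : ℝ → ℝ → ℝ}

theorem hasDerivAt_dt (h : IsTest φ) (t x : ℝ) : HasDerivAt (fun s => φ s x) (dt φ t x) t := by
  have h1 : Differentiable ℝ (uncurry φ) := h.smooth.differentiable (by simp)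
  have h2 : Differentiable ℝ fun s => φ s x :=
    h1.comp (f := fun s : ℝ => (s, x)) (by fun_prop)
  exact (h2 t).hasDerivAt

theorem hasDerivAt_dx (h : IsTest φ) (t x : ℝ) : HasDerivAt (φ t) (dx 1 φ t x) x := by
  have h1 : Differentiable ℝ (uncurry φ) := h.smooth.differentiable (by simp)
  have h2 : Differentiable ℝ (φ t) := h1.comp (f := fun y : ℝ => (t, y)) (by fun_prop)
  rw [dx, iteratedDeriv_one]
  exact (h2 x).hasDerivAt

theorem fderiv_apply (h : IsTest φ) (v : ℝ × ℝ) :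
    IsTest fun t x => fderiv ℝ (uncurry φ) (t, x) v :=
  ⟨(h.smooth.fderiv_right (m := ∞) le_rfl).clm_apply contDiff_const,
    h.hasCompactSupport.fderiv_apply (𝕜 := ℝ) v⟩

theorem dt (h : IsTest φ) : IsTest (dt φ) := by
  have : Parisi.dt φ = fun t x => fderiv ℝ (uncurry φ) (t, x) (1, 0) := by
    ext t x
    refine (h.hasDerivAt_dt t x).unique ?_
    have h1 : HasFDerivAt (uncurry φ) _ (t, x) :=
      ((h.smooth.differentiable (by simp)) (t, x)).hasFDerivAt
    exact h1.comp_hasDerivAt (f := fun s : ℝ => (s, x)) t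
      ((hasDerivAt_id t).prodMk (hasDerivAt_const t x))
  rw [this]; exact h.fderiv_apply _

theorem dx_one (h : IsTest φ) : IsTest (dx 1 φ) := by
  have : Parisi.dx 1 φ = fun t x => fderiv ℝ (uncurry φ) (t, x) (0, 1) := by
    ext t x
    refine (h.hasDerivAt_dx t x).unique ?_
    have h1 : HasFDerivAt (uncurry φ) _ (t, x) :=
      ((h.smooth.differentiable (by simp)) (t, x)).hasFDerivAt
    exact h1.comp_hasDerivAt (f := fun y : ℝ => (t, y)) x
      ((hasDerivAt_const x t).prodMk (hasDerivAt_id x))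
  rw [this]; exact h.fderiv_apply _

theorem dx_two_eq : dx 2 φ = dx 1 (dx 1 φ) := by
  ext t x
  change iteratedDeriv 2 (φ t) x = iteratedDeriv 1 (fun y => iteratedDeriv 1 (φ t) y) x
  simp only [iteratedDeriv_succ, iteratedDeriv_zero]

theorem dx_two (h : IsTest φ) : IsTest (dx 2 φ) := by
  rw [dx_two_eq]; exact h.dx_one.dx_one

theorem continuous (h : IsTest φ) : Continuous (uncurry φ) := h.smooth.continuous

theorem continuous_slice (h : IsTest φ) (t : ℝ) : Continuous (φ t) :=
  h.continuous.comp (continuous_const.prodMk continuous_id)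

theorem hasCompactSupport_slice (h : IsTest φ) (t : ℝ) : HasCompactSupport (φ t) :=
  h.hasCompactSupport.comp_isClosedEmbedding (g := fun x : ℝ => (t, x))
    (Topology.IsClosedEmbedding.of_continuous_injective_isClosedMap (by fun_prop)
      (Prod.mk_right_injective t) (isClosedMap_prodMk_left t))

theorem integrable_mul (h : IsTest φ) {w : ℝ × ℝ → ℝ} (hw : Continuous w) :
    Integrable fun z : ℝ × ℝ => w z * φ z.1 z.2 :=
  (hw.mul h.continuous).integrable_of_hasCompactSupport h.hasCompactSupport.mul_left

theorem integrable_uncurry_mul (h : IsTest φ) {w : ℝ → ℝ → ℝ} (hw : Continuous (uncurry w)) :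
    Integrable fun z : ℝ × ℝ => w z.1 z.2 * φ z.1 z.2 := h.integrable_mul hw

theorem integrable_slice_mul (h : IsTest φ) {w : ℝ → ℝ} (hw : Continuous w) (t : ℝ) :
    Integrable fun x => w x * φ t x :=
  (hw.mul (h.continuous_slice t)).integrable_of_hasCompactSupport
    (h.hasCompactSupport_slice t).mul_left

theorem integrable (h : IsTest φ) : Integrable fun z : ℝ × ℝ => φ z.1 z.2 :=
  h.continuous.integrable_of_hasCompactSupport h.hasCompactSupport

/-- Integration by parts in the space variable on a time slice. -/
theorem integral_mul_dx (h : IsTest φ) {w w' : ℝ → ℝ} (hw : ∀ x, HasDerivAt w (w' x) x)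
    (hw' : Continuous w') (t : ℝ) : ∫ x, w x * Parisi.dx 1 φ t x = -∫ x, w' x * φ t x := by
  have hc : Continuous w := continuous_iff_continuousAt.2 fun x => (hw x).continuousAt
  exact integral_mul_deriv_eq_deriv_mul_of_integrable (fun x _ => hw x)
    (fun x _ => h.hasDerivAt_dx t x) (h.dx_one.integrable_slice_mul hc t)
    (h.integrable_slice_mul hw' t) (h.integrable_slice_mul hc t)

end IsTest

theorem volume_restrict_strip :
    (volume : Measure (ℝ × ℝ)).restrict strip = (volume.restrict (Icc (0:ℝ) 1)).prod volume := by
  rw [strip, Measure.volume_eq_prod, ← Measure.prod_restrict, Measure.restrict_univ]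

theorem measurableSet_strip : MeasurableSet strip := measurableSet_Icc.prod MeasurableSet.univ

theorem setIntegral_strip {F : ℝ × ℝ → ℝ} (hF : IntegrableOn F strip) :
    ∫ z in strip, F z = ∫ t in Icc (0:ℝ) 1, ∫ x, F (t, x) := by
  rw [IntegrableOn, volume_restrict_strip] at hF
  rw [volume_restrict_strip, integral_prod _ hF]

theorem setIntegral_strip_symm {F : ℝ × ℝ → ℝ} (hF : IntegrableOn F strip) :
    ∫ z in strip, F z = ∫ x, ∫ t in Icc (0:ℝ) 1, F (t, x) := by
  rw [IntegrableOn, volume_restrict_strip] at hF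
  rw [volume_restrict_strip, integral_prod_symm _ hF]

/-! ### From integrated equations to weak equations -/

section

variable {α : ℝ → ℝ} {w w₁ w₂ f : ℝ → ℝ → ℝ}

theorem isWeakDx_of_hasDerivAt (hw : Continuous (uncurry w)) (hw₁ : Continuous (uncurry w₁))
    (hd : ∀ t x, HasDerivAt (w t) (w₁ t x) x) : IsWeakDx w w₁ := by
  intro φ hφ
  have h := hφ.isTest
  rw [setIntegral_strip (h.dx_one.integrable_uncurry_mul hw).integrableOn,
    setIntegral_strip (h.integrable_uncurry_mul hw₁).integrableOn, ← integral_neg]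
  refine integral_congr_ae (Filter.Eventually.of_forall fun t => ?_)
  exact h.integral_mul_dx (hd t) (hw₁.comp (continuous_const.prodMk continuous_id)) t

/-- Integration by parts in time on a line `x = const`. -/
theorem integral_mul_dt_line {φ : ℝ → ℝ → ℝ} (h : IsTest φ) {D k : ℝ → ℝ}
    (hk : IntervalIntegrable k volume 0 1)
    (hDk : ∀ t ∈ Icc (0 : ℝ) 1, D t = D 1 + ∫ r in t..1, k r) (x : ℝ) :
    ∫ t in Icc (0:ℝ) 1, (-(D t * dt φ t x) + k t * φ t x) = D 0 * φ 0 x - D 1 * φ 1 x := by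
  have hc : Continuous fun t => dt φ t x := h.dt.continuous.comp (Continuous.prodMk_left x)
  have := mul_eq_add_integral hk (hc.neg.intervalIntegrable 0 1) hDk (E := fun t => φ t x)
    (fun t _ => by
      rw [Pi.neg_def, intervalIntegral.integral_neg,
        intervalIntegral.integral_eq_sub_of_hasDerivAt (f := fun t => φ t x)
          (fun s _ => h.hasDerivAt_dt s x) (hc.intervalIntegrable _ _)]
      ring) 0 ⟨le_rfl, zero_le_one⟩
  rw [integral_Icc_eq_integral_Ioc, ← intervalIntegral.integral_of_le zero_le_one]
  rw [this, add_sub_cancel_left]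
  refine intervalIntegral.integral_congr fun t _ => ?_
  simp

theorem integrable_rhs_mul (hα : Continuous α) (hw₂ : Continuous (uncurry w₂)) {C : ℝ}
    (hf : Measurable (uncurry f)) (hfC : ∀ t x, |f t x| ≤ C)
    {φ : ℝ → ℝ → ℝ} (h : IsTest φ) :
    Integrable fun z : ℝ × ℝ => α z.1 * (w₂ z.1 z.2 + f z.1 z.2) * φ z.1 z.2 := by
  have h1 := h.integrable_mul (w := fun z : ℝ × ℝ => α z.1 * w₂ z.1 z.2)
    ((hα.comp continuous_fst).mul hw₂)
  have h2 : Integrable fun z : ℝ × ℝ => f z.1 z.2 * (α z.1 * φ z.1 z.2) :=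
    (h.integrable_mul (w := fun z : ℝ × ℝ => α z.1) (hα.comp continuous_fst)).bdd_mul
      hf.aestronglyMeasurable (Filter.Eventually.of_forall fun z => hfC z.1 z.2)
  refine (h1.add h2).congr (Filter.Eventually.of_forall fun z => ?_)
  simp only [Pi.add_apply]; ring

theorem integral_mul_dt_strip (hα : Continuous α) (hw : Continuous (uncurry w))
    (hw₂ : Continuous (uncurry w₂)) {C : ℝ} (hf : Measurable (uncurry f))
    (hfC : ∀ t x, |f t x| ≤ C)
    (heq : ∀ t ∈ Icc (0 : ℝ) 1, ∀ x, w t x = w 1 x + ∫ r in t..1, α r * (w₂ r x + f r x))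
    {φ : ℝ → ℝ → ℝ} (h : IsTest φ) :
    ∫ z in strip, (-(w z.1 z.2 * dt φ z.1 z.2) +
      α z.1 * (w₂ z.1 z.2 + f z.1 z.2) * φ z.1 z.2) =
      ∫ x, (w 0 x * φ 0 x - w 1 x * φ 1 x) := by
  rw [setIntegral_strip_symm (F := fun z => -(w z.1 z.2 * dt φ z.1 z.2) +
      α z.1 * (w₂ z.1 z.2 + f z.1 z.2) * φ z.1 z.2) ((h.dt.integrable_uncurry_mul hw).neg.add
    (integrable_rhs_mul hα hw₂ hf hfC h)).integrableOn]
  refine integral_congr_ae (Filter.Eventually.of_forall fun x => ?_)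
  refine integral_mul_dt_line h (D := fun t => w t x) (k := fun t => α t * (w₂ t x + f t x))
    ?_ (fun t ht => heq t ht x) x
  have h1 : IntervalIntegrable (fun t => f t x) volume 0 1 :=
    intervalIntegrable_of_bounded (hf.comp measurable_prodMk_right) (fun t => hfC t x) 0 1
  exact (((hw₂.comp (Continuous.prodMk_left x)).intervalIntegrable 0 1).add h1).continuousOn_mul
    hα.continuousOn

theorem isWeakDt_of_integrated (hα : Continuous α) (hw : Continuous (uncurry w))
    (hw₂ : Continuous (uncurry w₂)) {C : ℝ} (hf : Measurable (uncurry f))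
    (hfC : ∀ t x, |f t x| ≤ C)
    (heq : ∀ t ∈ Icc (0 : ℝ) 1, ∀ x, w t x = w 1 x + ∫ r in t..1, α r * (w₂ r x + f r x)) :
    IsWeakDt w fun t x => -(α t * (w₂ t x + f t x)) := by
  intro φ hφ
  have h := hφ.isTest
  have h1 := integral_mul_dt_strip hα hw hw₂ hf hfC heq h
  have h0 : ∀ x, w 0 x * φ 0 x - w 1 x * φ 1 x = 0 := fun x => by
    rw [hφ.eq_zero (t := 0) (by simp), hφ.eq_zero (t := 1) (by simp)]; simp
  simp only [h0, integral_zero] at h1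
  have h2 := (h.dt.integrable_uncurry_mul hw).integrableOn (s := strip)
  have h3 := (integrable_rhs_mul hα hw₂ hf hfC h).integrableOn (s := strip)
  have h4 := integral_add h2.neg h3
  simp only [Pi.neg_apply] at h4
  rw [integral_neg, h1] at h4
  simp only [neg_mul, integral_neg]
  linarith

theorem weak_of_integrated (hα : Continuous α) (hw : Continuous (uncurry w))
    (hw₂ : Continuous (uncurry w₂)) {C : ℝ} (hf : Measurable (uncurry f))
    (hfC : ∀ t x, |f t x| ≤ C)
    (heq : ∀ t ∈ Icc (0 : ℝ) 1, ∀ x, w t x = w 1 x + ∫ r in t..1, α r * (w₂ r x + f r x))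
    (hw₁ : Continuous (uncurry w₁))
    (hd : ∀ t x, HasDerivAt (w t) (w₁ t x) x) (hd₁ : ∀ t x, HasDerivAt (w₁ t) (w₂ t x) x)
    {φ : ℝ → ℝ → ℝ} (hφ : IsTestFunction (Ioi 0 ×ˢ univ) φ) :
    0 = (∫ z in strip, (-(w z.1 z.2 * dt φ z.1 z.2) +
      α z.1 * (w z.1 z.2 * dx 2 φ z.1 z.2 + f z.1 z.2 * φ z.1 z.2))) + ∫ x, φ 1 x * w 1 x := by
  have h := hφ.isTest
  have h1 := integral_mul_dt_strip hα hw hw₂ hf hfC heq h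
  have hαc : Continuous fun z : ℝ × ℝ => α z.1 := hα.comp continuous_fst
  have i1 := (h.dx_two.integrable_mul (w := fun z : ℝ × ℝ => α z.1 * w z.1 z.2)
    (hαc.mul hw)).integrableOn (s := strip)
  have i2 := (h.integrable_mul (w := fun z : ℝ × ℝ => α z.1 * w₂ z.1 z.2)
    (hαc.mul hw₂)).integrableOn (s := strip)
  have h2 : ∫ z in strip, (α z.1 * w z.1 z.2) * dx 2 φ z.1 z.2 =
      ∫ z in strip, (α z.1 * w₂ z.1 z.2) * φ z.1 z.2 := by
    rw [setIntegral_strip i1, setIntegral_strip i2]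
    refine integral_congr_ae (Filter.Eventually.of_forall fun t => ?_)
    simp only [mul_assoc]
    rw [integral_const_mul, integral_const_mul, IsTest.dx_two_eq,
      h.dx_one.integral_mul_dx (hd t) (hw₁.comp (continuous_const.prodMk continuous_id)) t,
      h.integral_mul_dx (hd₁ t) (hw₂.comp (continuous_const.prodMk continuous_id)) t, neg_neg]
  have h3 : ∫ z in strip, (-(w z.1 z.2 * dt φ z.1 z.2) +
      α z.1 * (w z.1 z.2 * dx 2 φ z.1 z.2 + f z.1 z.2 * φ z.1 z.2)) =
      (∫ z in strip, (-(w z.1 z.2 * dt φ z.1 z.2) +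
      α z.1 * (w₂ z.1 z.2 + f z.1 z.2) * φ z.1 z.2)) +
      ((∫ z in strip, (α z.1 * w z.1 z.2) * dx 2 φ z.1 z.2) -
      ∫ z in strip, (α z.1 * w₂ z.1 z.2) * φ z.1 z.2) := by
    rw [← integral_sub i1 i2, ← integral_add]
    · congr 1; ext z; ring
    · exact ((h.dt.integrable_uncurry_mul hw).neg.add
        (integrable_rhs_mul hα hw₂ hf hfC h)).integrableOn
    · exact i1.sub i2
  have h0 : ∀ x, w 0 x * φ 0 x - w 1 x * φ 1 x = -(φ 1 x * w 1 x) := fun x => by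
    rw [hφ.eq_zero (t := 0) (by simp)]; ring
  simp only [h0, integral_neg] at h1
  rw [h3, h2, h1]; ring

end

/-! ### The distribution function -/

section

variable (μ : Measure unitInterval)

theorem distFun_nonneg (t : ℝ) : 0 ≤ distFun μ t := measureReal_nonneg

variable [IsProbabilityMeasure μ]

theorem distFun_mono : Monotone (distFun μ) := fun _ _ h =>
  measureReal_mono fun _ hs => le_trans hs h

theorem distFun_le_one (t : ℝ) : distFun μ t ≤ 1 := measureReal_le_one

theorem continuousAt_distFun (t : unitInterval) (ht : μ {t} = 0) :
    ContinuousAt (distFun μ) t := by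
  set ν : Measure ℝ := μ.map ((↑) : unitInterval → ℝ) with hν
  have : IsProbabilityMeasure ν := Measure.isProbabilityMeasure_map measurable_subtype_coe.aemeasurable
  have hcdf : distFun μ = ProbabilityTheory.cdf ν := by
    ext s
    rw [ProbabilityTheory.cdf_eq_real, hν, map_measureReal_apply measurable_subtype_coe
      measurableSet_Iic]
    rfl
  have h0 : ν {(t : ℝ)} = 0 := by
    rw [hν, Measure.map_apply measurable_subtype_coe (measurableSet_singleton _)]
    have : ((↑) : unitInterval → ℝ) ⁻¹' {(t : ℝ)} = {t} := by
      ext s; simp [Subtype.ext_iff]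
    rwa [this]
  rw [← ProbabilityTheory.measure_cdf ν, StieltjesFunction.measure_singleton,
    ENNReal.ofReal_eq_zero] at h0
  have hmono := (ProbabilityTheory.cdf ν).mono
  rw [hcdf, hmono.continuousAt_iff_leftLim_eq_rightLim, StieltjesFunction.rightLim_eq]
  exact le_antisymm (hmono.leftLim_le le_rfl) (by linarith)

end

/-! ### The potential `u` -/

/-- `U j = ∂_x^j u` for a solution `u` of the Parisi PDE with time coefficient `α` and distribution
function `m`, where the differentiated equations hold in time-integrated form. -/
structure IsPotential (α m : ℝ → ℝ) (U : ℕ → ℝ → ℝ → ℝ) : Prop where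
  cont_zero : Continuous (uncurry (U 0))
  hasDerivAt_zero : ∀ t x, HasDerivAt (U 0 t) (U 1 t x) x
  tower : IsTower fun j => U (j + 1)
  eq : ∀ j, ∀ t ∈ Icc (0 : ℝ) 1, ∀ x, U j t x = iteratedDeriv j logCosh x +
    ∫ r in t..1, α r * (U (j + 2) r x + m r * iteratedDeriv j (fun y => U 1 r y ^ 2) x)

section

variable {α m : ℝ → ℝ}

theorem exists_isPotential {A : ℝ → ℝ}
    (hA : ∀ t ∈ Icc (0 : ℝ) 1, HasDerivWithinAt A (2 * α t) (Icc 0 1) t)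
    (hα : ∀ t, 0 ≤ α t) (hαc : Continuous α) (hαb : ∃ C, ∀ t, α t ≤ C)
    (hm : Monotone m) (h0 : ∀ r, 0 ≤ m r) (h1 : ∀ r, m r ≤ 1) :
    ∃ U, IsPotential α m U := by
  obtain ⟨W, hW, hWclamp, heq⟩ := exists_backward_tower hA hα hm h0 h1 isTower_logCosh
    (fun x => by
      rw [zero_add, iteratedDeriv_one, (hasDerivAt_logCosh x).deriv]; exact abs_tanh_le_one x)
  obtain ⟨Cα, hCα⟩ := hαb
  have hαabs : ∀ t, |α t| ≤ Cα := fun t => by rw [abs_of_nonneg (hα t)]; exact hCα t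
  have hCα0 : 0 ≤ Cα := (hα 0).trans (hCα 0)
  have hQ : IsTower fun j s x => iteratedDeriv j (fun y => W 0 s y * W 0 s y) x := hW.mul hW
  set K : ℕ → ℝ → ℝ → ℝ := fun j r x => α r * (W (j + 1) r x +
    m r * iteratedDeriv j (fun y => W 0 r y * W 0 r y) x) with hK
  have hKm : ∀ j x, Measurable fun r => K j r x := fun j x =>
    hαc.measurable.mul (((hW.cont (j + 1)).comp (Continuous.prodMk_left x)).measurable.add
      (hm.measurable.mul ((hQ.cont j).comp (Continuous.prodMk_left x)).measurable))
  have hKb : ∀ j, ∃ C, ∀ r x, |K j r x| ≤ C := fun j => by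
    obtain ⟨C, hC⟩ := hW.bdd (j + 1)
    obtain ⟨D, hD⟩ := hQ.bdd j
    refine ⟨Cα * (C + 1 * D), fun r x => ?_⟩
    rw [hK, abs_mul]
    refine mul_le_mul (hαabs r) ((abs_add_le _ _).trans (add_le_add (hC r x) ?_)) (abs_nonneg _)
      hCα0
    rw [abs_mul, abs_of_nonneg (h0 r)]
    exact mul_le_mul (h1 r) (hD r x) (abs_nonneg _) zero_le_one
  have hKd : ∀ j r x, HasDerivAt (K j r) (K (j + 1) r x) x := fun j r x =>
    ((hW.hasDerivAt (j + 1) r x).add ((hQ.hasDerivAt j r x).const_mul (m r))).const_mul (α r)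
  choose C hC using hKb
  set u : ℝ → ℝ → ℝ := fun t x => logCosh x + ∫ r in clamp t..1, K 0 r x with hu
  have hud : ∀ t x, HasDerivAt (u t) (W 0 t x) x := by
    intro t x
    have e1 : W 0 t x = Real.tanh x + ∫ r in clamp t..1, K 1 r x := by
      rw [← hWclamp, heq 0 (clamp t) (clamp_mem t) x, zero_add, iteratedDeriv_one,
        (hasDerivAt_logCosh x).deriv]
    rw [e1]
    refine (hasDerivAt_logCosh x).add ?_
    simp only [intervalIntegral.integral_of_le (clamp_mem t).2]
    exact hasDerivAt_integral_of_bounded (F := K 0) (F' := K 1) (bound := fun _ => C 1) x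
      (fun y => (hKm 0 y).aestronglyMeasurable) (hKm 1 x).aestronglyMeasurable
      (Integrable.of_bound (hKm 0 x).aestronglyMeasurable (C 0)
        (Filter.Eventually.of_forall fun r => hC 0 r x))
      (fun r y => hC 1 r y) (integrable_const _) (fun r y => hKd 0 r y)
  refine ⟨fun j => Nat.casesOn j u W, ?_, hud, hW, fun j t ht x => ?_⟩
  · -- continuous in `x`, Lipschitz in `t`
    have hlip : ∀ x, LipschitzWith (C 0).toNNReal fun t => u t x := by
      intro x
      refine LipschitzWith.of_dist_le_mul fun s t => ?_
      have hC0 : 0 ≤ C 0 := (abs_nonneg _).trans (hC 0 0 0)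
      have hi : ∀ a b, IntervalIntegrable (fun r => K 0 r x) volume a b :=
        intervalIntegrable_of_bounded (hKm 0 x) (fun r => hC 0 r x)
      rw [Real.coe_toNNReal _ hC0, dist_eq_norm, hu]
      simp only
      rw [add_sub_add_left_eq_sub, ← intervalIntegral.integral_add_adjacent_intervals
        (hi (clamp s) (clamp t)) (hi (clamp t) 1), add_sub_cancel_right]
      refine (intervalIntegral.norm_integral_le_of_norm_le_const fun r _ => hC 0 r x).trans ?_
      refine mul_le_mul_of_nonneg_left ?_ hC0
      rw [Real.dist_eq, abs_sub_comm s t]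
      exact (abs_max_sub_max_le_max _ _ _ _).trans (by
        rw [sub_self, abs_zero, max_eq_right (abs_nonneg _)]
        refine (abs_min_sub_min_le_max _ _ _ _).trans ?_
        rw [sub_self, abs_zero, max_eq_right (abs_nonneg _)])
    exact continuous_prod_of_continuous_lipschitzWith (uncurry u) (C 0).toNNReal
      (fun t => continuous_iff_continuousAt.2 fun x => (hud t x).continuousAt) hlip
  · have hsq : ∀ r, (fun y => W 0 r y ^ 2) = fun y => W 0 r y * W 0 r y := fun r => by
      ext y; exact sq _
    cases j with
    | zero =>
      change u t x = iteratedDeriv 0 logCosh x + ∫ r in t..1, α r * (W (0 + 1) r x +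
        m r * iteratedDeriv 0 (fun y => W 0 r y ^ 2) x)
      simp only [hu, clamp_of_mem ht, hK, hsq, iteratedDeriv_zero]
    | succ j =>
      change W j t x = iteratedDeriv (j + 1) logCosh x + ∫ r in t..1, α r * (W (j + 2) r x +
        m r * iteratedDeriv (j + 1) (fun y => W 0 r y ^ 2) x)
      simp only [hsq]
      exact heq j t ht x

namespace IsPotential

variable {U : ℕ → ℝ → ℝ → ℝ}

theorem cont (hU : IsPotential α m U) (j : ℕ) : Continuous (uncurry (U j)) := by
  cases j with
  | zero => exact hU.cont_zero
  | succ j => exact hU.tower.cont j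

theorem hasDerivAt (hU : IsPotential α m U) (j : ℕ) (t x : ℝ) :
    HasDerivAt (U j t) (U (j + 1) t x) x := by
  cases j with
  | zero => exact hU.hasDerivAt_zero t x
  | succ j => exact hU.tower.hasDerivAt j t x

theorem dx_eq (hU : IsPotential α m U) (j : ℕ) : dx j (U 0) = U j := by
  ext t x
  change iteratedDeriv j (U 0 t) x = U j t x
  suffices iteratedDeriv j (U 0 t) = U j t by rw [this]
  induction j with
  | zero => simp
  | succ j ih => rw [iteratedDeriv_succ, ih]; ext y; exact (hU.hasDerivAt j t y).deriv

theorem contDiff (hU : IsPotential α m U) (t : ℝ) : ContDiff ℝ ∞ (U 0 t) := by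
  refine contDiff_of_differentiable_iteratedDeriv fun j _ => ?_
  have : iteratedDeriv j (U 0 t) = U j t := congrFun (hU.dx_eq j) t
  rw [this]
  exact fun x => (hU.hasDerivAt j t x).differentiableAt

theorem isTower_sq (hU : IsPotential α m U) :
    IsTower fun j t x => iteratedDeriv j (fun y => U 1 t y ^ 2) x := by
  have := hU.tower.mul hU.tower
  simpa only [zero_add, ← sq] using this

theorem measurable_source (hU : IsPotential α m U) (hm : Measurable m) (j : ℕ) :
    Measurable (uncurry fun t x => m t * iteratedDeriv j (fun y => U 1 t y ^ 2) x) :=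
  (hm.comp measurable_fst).mul (hU.isTower_sq.cont j).measurable

theorem exists_bound_source (hU : IsPotential α m U) (h0 : ∀ r, 0 ≤ m r) (h1 : ∀ r, m r ≤ 1)
    (j : ℕ) : ∃ C, ∀ t x, |m t * iteratedDeriv j (fun y => U 1 t y ^ 2) x| ≤ C := by
  obtain ⟨C, hC⟩ := hU.isTower_sq.bdd j
  refine ⟨1 * C, fun t x => ?_⟩
  rw [abs_mul, abs_of_nonneg (h0 t)]
  exact mul_le_mul (h1 t) (hC t x) (abs_nonneg _) zero_le_one

theorem eq_one (hU : IsPotential α m U) (j : ℕ) (x : ℝ) : U j 1 x = iteratedDeriv j logCosh x := by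
  rw [hU.eq j 1 ⟨zero_le_one, le_rfl⟩ x, intervalIntegral.integral_same, add_zero]

theorem eq' (hU : IsPotential α m U) (j : ℕ) : ∀ t ∈ Icc (0 : ℝ) 1, ∀ x, U j t x = U j 1 x +
    ∫ r in t..1, α r * (U (j + 2) r x + m r * iteratedDeriv j (fun y => U 1 r y ^ 2) x) := by
  intro t ht x
  rw [hU.eq_one]; exact hU.eq j t ht x

theorem hasWeakDt (hU : IsPotential α m U) (hα : Continuous α) (hαb : ∃ C, ∀ t, |α t| ≤ C)
    (hm : Measurable m) (h0 : ∀ r, 0 ≤ m r) (h1 : ∀ r, m r ≤ 1) (j : ℕ) :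
    ∃ q, EssBounded q ∧ IsWeakDt (U j) q := by
  obtain ⟨C, hC⟩ := hU.exists_bound_source h0 h1 j
  obtain ⟨D, hD⟩ := hU.tower.bdd (j + 1)
  obtain ⟨E, hE⟩ := hαb
  refine ⟨_, ?_, isWeakDt_of_integrated hα (hU.cont j) (hU.cont (j + 2))
    (hU.measurable_source hm j) hC (hU.eq' j)⟩
  refine memLp_top_of_bound ?_ (E * (D + C)) (Filter.Eventually.of_forall fun z => ?_)
  · exact ((hα.measurable.comp measurable_fst).mul
      ((hU.cont (j + 2)).measurable.add (hU.measurable_source hm j))).neg.aestronglyMeasurable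
  · have hE0 : 0 ≤ E := (abs_nonneg _).trans (hE 0)
    rw [uncurry, norm_neg, norm_mul]
    exact mul_le_mul (hE _) ((abs_add_le _ _).trans (add_le_add (hD _ _) (hC _ _)))
      (norm_nonneg _) hE0

theorem hasWeakDx (hU : IsPotential α m U) (j : ℕ) :
    ∃ p, EssBounded p ∧ IsWeakDx (U j) p := by
  obtain ⟨C, hC⟩ := hU.tower.bdd j
  exact ⟨U (j + 1), memLp_top_of_bound (hU.cont (j + 1)).aestronglyMeasurable C
    (Filter.Eventually.of_forall fun z => hC z.1 z.2),
    isWeakDx_of_hasDerivAt (hU.cont j) (hU.cont (j + 1)) (hU.hasDerivAt j)⟩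

/-- At a point of continuity of `m`, the equation holds pointwise. -/
theorem differentiableWithinAt (hU : IsPotential α m U) (hα : Continuous α) (hm : Measurable m)
    (hαb : ∃ C, ∀ t, |α t| ≤ C) (h0 : ∀ r, 0 ≤ m r) (h1 : ∀ r, m r ≤ 1)
    {t : ℝ} (ht : t ∈ Icc (0 : ℝ) 1) (hmt : ContinuousAt m t) (x : ℝ) :
    DifferentiableWithinAt ℝ (fun s => U 0 s x) (Icc 0 1) t := by
  obtain ⟨C, hC⟩ := hU.exists_bound_source h0 h1 0
  obtain ⟨D, hD⟩ := hU.tower.bdd 1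
  obtain ⟨E, hE⟩ := hαb
  have hE0 : 0 ≤ E := (abs_nonneg _).trans (hE 0)
  set k : ℝ → ℝ := fun r => α r * (U (0 + 2) r x + m r * iteratedDeriv 0 (fun y => U 1 r y ^ 2) x)
    with hk
  have hs : Continuous fun r : ℝ => (r, x) := by fun_prop
  have hkm : Measurable k := hα.measurable.mul
    (((hU.cont 2).comp hs).measurable.add ((hU.measurable_source hm 0).comp hs.measurable))
  have hkb : ∀ r, |k r| ≤ E * (D + C) := fun r => by
    rw [hk, abs_mul]
    exact mul_le_mul (hE _) ((abs_add_le _ _).trans (add_le_add (hD _ _) (hC _ _)))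
      (abs_nonneg _) hE0
  have hkc : ContinuousAt k t := hα.continuousAt.mul
    ((((hU.cont 2).comp hs).continuousAt).add
      (hmt.mul ((hU.isTower_sq.cont 0).comp hs).continuousAt))
  have : Fact (t ∈ Icc (0 : ℝ) 1) := ⟨ht⟩
  have h := intervalIntegral.integral_hasDerivWithinAt_left
    (intervalIntegrable_of_bounded hkm hkb t 1) (s := Icc 0 1) (t := Icc 0 1)
    ⟨univ, Filter.univ_mem, hkm.aestronglyMeasurable⟩ hkc.continuousWithinAt
  refine (h.differentiableWithinAt.const_add (U 0 1 x)).congr (fun s hs => ?_) ?_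
  · exact hU.eq' 0 s hs x
  · exact hU.eq' 0 t ht x

/-- The weak form of the equations, for the coefficients of the Parisi PDE. -/
theorem weakForm {β : ℕ+ → ℝ} {μ : Measure unitInterval} [IsProbabilityMeasure μ]
    (hα : Continuous α) (hαβ : ∀ t ∈ Icc (0 : ℝ) 1, α t = deriv (deriv (mixture β)) t / 2)
    (hU : IsPotential α (distFun μ) U) (j : ℕ) :
    WeakForm β μ (U j) (fun t x => iteratedDeriv j (fun y => U 1 t y ^ 2) x)
      (iteratedDeriv j logCosh) := by
  intro φ hφ
  obtain ⟨C, hC⟩ := hU.exists_bound_source (distFun_nonneg μ) (distFun_le_one μ) j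
  have h := weak_of_integrated hα (hU.cont j) (hU.cont (j + 2))
    (hU.measurable_source (distFun_mono μ).measurable j) hC (hU.eq' j) (hU.cont (j + 1))
    (hU.hasDerivAt j) (hU.hasDerivAt (j + 1)) hφ
  simp only [hU.eq_one] at h
  rw [h]
  congr 1
  refine setIntegral_congr_fun measurableSet_strip fun z hz => ?_
  simp only [hαβ z.1 hz.1]

end IsPotential

end

/-! ### Gronwall and du Bois-Reymond lemmas -/

/-- Backward Gronwall inequality in integral form. -/
theorem eq_zero_of_le_integral {E : ℝ → ℝ} (hE : Continuous E) (h0 : ∀ t, 0 ≤ E t) {C : ℝ}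
    (hC : 0 ≤ C) (h : ∀ t ∈ Icc (0 : ℝ) 1, E t ≤ C * ∫ r in t..1, E r) :
    ∀ t ∈ Icc (0 : ℝ) 1, E t = 0 := by
  set F : ℝ → ℝ := fun t => ∫ r in t..1, E r with hF
  have hFd : ∀ t, HasDerivAt F (-E t) t := fun t =>
    intervalIntegral.integral_hasDerivAt_left (hE.intervalIntegrable _ _)
      hE.stronglyMeasurable.stronglyMeasurableAtFilter hE.continuousAt
  have hgd : ∀ t, HasDerivAt (fun t => Real.exp (C * t) * F t)
      (Real.exp (C * t) * (C * F t - E t)) t := fun t => by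
    have h1 : HasDerivAt (fun t => Real.exp (C * t)) (Real.exp (C * t) * C) t := by
      simpa using ((hasDerivAt_id t).const_mul C).exp
    convert! h1.mul (hFd t) using 1
    ring
  have hmono : MonotoneOn (fun t => Real.exp (C * t) * F t) (Icc 0 1) :=
    monotoneOn_of_hasDerivWithinAt_nonneg (convex_Icc 0 1)
      (fun t _ => (hgd t).continuousAt.continuousWithinAt)
      (fun t _ => (hgd t).hasDerivWithinAt) fun t ht => by
        have := h t (interior_subset ht)
        exact mul_nonneg (Real.exp_pos _).le (by linarith)
  intro t ht
  have h1 := hmono ht (right_mem_Icc.2 zero_le_one) ht.2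
  have hF1 : F 1 = 0 := intervalIntegral.integral_same
  simp only [hF1, mul_zero] at h1
  have h2 : F t ≤ 0 := nonpos_of_mul_nonpos_right h1 (Real.exp_pos _)
  exact le_antisymm ((h t ht).trans (mul_nonpos_of_nonneg_of_nonpos hC h2)) (h0 t)

/-- A test function on `(0,1)` is on `[0,1]` the derivative of a test function on `(0,∞)`, namely of
its primitive vanishing at `0`, cut off beyond `1`. -/
theorem exists_primitive_test {ψ : ℝ → ℝ} (hψ : ContDiff ℝ ∞ ψ) (hc : HasCompactSupport ψ)
    (hs : tsupport ψ ⊆ Ioo 0 1) :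
    ∃ η : ℝ → ℝ, ContDiff ℝ ∞ η ∧ HasCompactSupport η ∧ tsupport η ⊆ Ioi 0 ∧
      ∀ t ∈ Icc (0 : ℝ) 1, deriv η t = ψ t := by
  obtain ⟨δ, hδ, hψδ⟩ : ∃ δ > 0, ∀ t < δ, ψ t = 0 := by
    rcases (tsupport ψ).eq_empty_or_nonempty with he | hne
    · exact ⟨1, one_pos, fun t _ => image_eq_zero_of_notMem_tsupport (by simp [he])⟩
    · obtain ⟨δ, hδ, hmin⟩ := hc.isCompact.exists_isLeast hne
      exact ⟨δ, (hs hδ).1, fun t ht => image_eq_zero_of_notMem_tsupport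
        fun hmem => absurd (hmin hmem) (not_le.2 ht)⟩
  set P : ℝ → ℝ := fun t => ∫ r in 0..t, ψ r with hP
  have hPd : ∀ t, HasDerivAt P (ψ t) t := fun t =>
    hψ.continuous.integral_hasStrictDerivAt 0 t |>.hasDerivAt
  have hPc : ContDiff ℝ ∞ P := by
    have e : deriv P = ψ := funext fun t => (hPd t).deriv
    rw [contDiff_infty_iff_deriv]
    exact ⟨fun t => (hPd t).differentiableAt, by rwa [e]⟩
  have hP0 : ∀ t < δ, P t = 0 := by
    intro t ht
    refine intervalIntegral.integral_zero_ae (Filter.Eventually.of_forall fun r hr => ?_)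
    refine hψδ r (lt_of_le_of_lt (uIoc_subset_uIcc hr).2 ?_)
    exact max_lt hδ ht
  -- a cutoff equal to `1` on a neighbourhood of `[0,1]`
  let χ : ContDiffBump (0 : ℝ) := ⟨2, 3, by norm_num, by norm_num⟩
  refine ⟨fun t => χ t * P t, χ.contDiff.mul hPc, χ.hasCompactSupport.mul_right, ?_, ?_⟩
  · refine (closure_minimal (t := Ici δ) ?_ isClosed_Ici).trans fun t ht => lt_of_lt_of_le hδ ht
    intro t ht
    by_contra hcon
    exact ht (by simp [hP0 t (not_le.1 hcon)])
  · intro t ht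
    have hev : (fun t => χ t * P t) =ᶠ[nhds t] P := by
      filter_upwards [Metric.ball_mem_nhds t one_pos] with r hr
      have : r ∈ Metric.closedBall (0 : ℝ) χ.rIn := by
        rw [Metric.mem_ball, Real.dist_eq, abs_lt] at hr
        rw [mem_closedBall_zero_iff, Real.norm_eq_abs, abs_le]
        change -2 ≤ r ∧ r ≤ 2
        exact ⟨by linarith [ht.1], by linarith [ht.2]⟩
      simp [χ.one_of_mem_closedBall this]
    rw [hev.deriv_eq, (hPd t).deriv]

/-- A function whose weak derivative on `(0,1)` is `-k` and which vanishes at `1` in the weak sense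
is the primitive of `-k` vanishing at `1`. -/
theorem eq_integral_of_weak {D k : ℝ → ℝ} (hD : Continuous D) (hk : IntervalIntegrable k volume 0 1)
    (h : ∀ η : ℝ → ℝ, ContDiff ℝ ∞ η → HasCompactSupport η → tsupport η ⊆ Ioi 0 →
      ∫ t in Icc (0:ℝ) 1, (-(D t * deriv η t) + k t * η t) = 0) :
    ∀ t ∈ Icc (0 : ℝ) 1, D t = ∫ r in t..1, k r := by
  have h01 : (0:ℝ) ∈ uIcc (0:ℝ) 1 := by simp
  set P : ℝ → ℝ := fun t => ∫ r in t..1, k r with hP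
  have hPc : ContinuousOn P (Icc 0 1) := by
    have := intervalIntegral.continuousOn_primitive_interval_left (f := k) (μ := volume)
      (a := 0) (b := 1) (by
        rw [uIcc_of_le zero_le_one, integrableOn_Icc_iff_integrableOn_Ioc,
          ← intervalIntegrable_iff_integrableOn_Ioc_of_le zero_le_one]
        exact hk)
    rwa [uIcc_of_le zero_le_one] at this
  have hP1 : P 1 = 0 := intervalIntegral.integral_same
  have hae : ∀ᵐ t, t ∈ Ioo (0 : ℝ) 1 → P t - D t = 0 := by
    refine isOpen_Ioo.ae_eq_zero_of_integral_contDiff_smul_eq_zero ?_ fun ψ hψ hc hs => ?_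
    · refine ContinuousOn.locallyIntegrableOn ?_ measurableSet_Ioo
      exact (hPc.mono Ioo_subset_Icc_self).sub hD.continuousOn
    obtain ⟨η, hη, hηc, hηs, hηψ⟩ := exists_primitive_test hψ hc hs
    have hη0 : η 0 = 0 := image_eq_zero_of_notMem_tsupport fun hm => lt_irrefl (0 : ℝ) (hηs hm)
    have hη'c : Continuous (deriv η) := hη.continuous_deriv (by simp)
    have hηd : ∀ t, HasDerivAt η (deriv η t) t := fun t =>
      (hη.differentiable (by simp) t).hasDerivAt
    have h1 := mul_eq_add_integral hk (hη'c.neg.intervalIntegrable 0 1) (D := P) (E := η)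
      (fun t _ => by rw [hP1, zero_add])
      (fun t _ => by
        rw [Pi.neg_def, intervalIntegral.integral_neg,
          intervalIntegral.integral_eq_sub_of_hasDerivAt (fun s _ => hηd s)
            (hη'c.intervalIntegrable _ _)]
        ring) 0 ⟨le_rfl, zero_le_one⟩
    rw [hη0, mul_zero, hP1, zero_mul, zero_add] at h1
    have h2 := h η hη hηc hηs
    rw [integral_Icc_eq_integral_Ioc, ← intervalIntegral.integral_of_le zero_le_one] at h2
    have hPi : IntervalIntegrable (fun t => P t * (-deriv η) t) volume 0 1 := by
      refine ContinuousOn.intervalIntegrable ?_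
      rw [uIcc_of_le zero_le_one]
      exact hPc.mul hη'c.neg.continuousOn
    have hki : IntervalIntegrable (fun t => k t * η t) volume 0 1 :=
      hk.mul_continuousOn hη.continuous.continuousOn
    have hDi : IntervalIntegrable (fun t => -(D t * deriv η t)) volume 0 1 :=
      (hD.mul hη'c).neg.intervalIntegrable _ _
    rw [intervalIntegral.integral_add hPi hki] at h1
    rw [intervalIntegral.integral_add hDi hki] at h2
    have h3 : ∫ t, ψ t • (P t - D t) = ∫ t in 0..1, ψ t • (P t - D t) := by
      rw [intervalIntegral.integral_of_le zero_le_one,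
        setIntegral_eq_integral_of_forall_compl_eq_zero fun t ht => ?_]
      rw [image_eq_zero_of_notMem_tsupport fun hm => ht (Ioo_subset_Ioc_self (hs hm)), zero_smul]
    rw [h3]
    have h4 : ∫ t in 0..1, ψ t • (P t - D t) =
        ∫ t in 0..1, (-(P t * (-deriv η) t) + -(D t * deriv η t)) := by
      refine intervalIntegral.integral_congr fun t ht => ?_
      rw [uIcc_of_le zero_le_one] at ht
      simp only [Pi.neg_apply, hηψ t ht, smul_eq_mul]
      ring
    have hPn : IntervalIntegrable (fun t => -(P t * (-deriv η) t)) volume 0 1 := hPi.neg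
    rw [h4, intervalIntegral.integral_add hPn hDi, intervalIntegral.integral_neg]
    linarith
  have hae' : P =ᵐ[volume.restrict (Icc 0 1)] D := by
    rw [Filter.EventuallyEq, ae_restrict_iff' measurableSet_Icc]
    have hn0 : ∀ᵐ t : ℝ, t ≠ 0 := by simp [ae_iff]
    have hn1 : ∀ᵐ t : ℝ, t ≠ 1 := by simp [ae_iff]
    filter_upwards [hae, hn0, hn1] with t ht h0 h1 htI
    exact sub_eq_zero.1 (ht ⟨lt_of_le_of_ne htI.1 h0.symm, lt_of_le_of_ne htI.2 h1⟩)
  intro t ht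
  exact (Measure.eqOn_Icc_of_ae_eq volume zero_ne_one hae' hPc hD.continuousOn ht).symm

/-! ### Mollification in space -/

/-- The mollification `g ⋆ ρ`. -/
noncomputable def moll (ρ g : ℝ → ℝ) (x : ℝ) : ℝ := ∫ y, g y * ρ (x - y)

/-- Smooth functions with compact support on the line. -/
structure IsKernel (ρ : ℝ → ℝ) : Prop where
  smooth : ContDiff ℝ ∞ ρ
  hasCompactSupport : HasCompactSupport ρ

theorem IsKernel.deriv {ρ : ℝ → ℝ} (h : IsKernel ρ) : IsKernel (deriv ρ) :=
  ⟨(contDiff_infty_iff_deriv.1 h.smooth).2, h.hasCompactSupport.deriv⟩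

theorem moll_eq_integral_sub (ρ g : ℝ → ℝ) (x : ℝ) : moll ρ g x = ∫ y, g (x - y) * ρ y := by
  rw [moll, ← integral_sub_left_eq_self (fun y => g (x - y) * ρ y) volume x]
  simp

theorem IsKernel.hasDerivAt_moll {ρ g : ℝ → ℝ} (h : IsKernel ρ) (hg : LocallyIntegrable g) (x : ℝ) :
    HasDerivAt (moll ρ g) (moll (_root_.deriv ρ) g x) x :=
  h.hasCompactSupport.hasDerivAt_convolution_right (ContinuousLinearMap.mul ℝ ℝ) hg
    (h.smooth.of_le (by simp)) x

theorem IsKernel.continuous_moll {ρ : ℝ → ℝ} (h : IsKernel ρ) {d : ℝ → ℝ → ℝ}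
    (hd : Continuous (uncurry d)) : Continuous (uncurry fun t x => moll ρ (d t) x) := by
  have h1 : (uncurry fun t x => moll ρ (d t) x) =
      fun p : ℝ × ℝ => ∫ y in tsupport ρ, d p.1 (p.2 - y) * ρ y := by
    ext p
    rw [uncurry, moll_eq_integral_sub, setIntegral_eq_integral_of_forall_compl_eq_zero]
    intro y hy
    rw [image_eq_zero_of_notMem_tsupport hy, mul_zero]
  rw [h1]
  refine continuous_parametric_integral_of_continuous (f := fun (p : ℝ × ℝ) y => d p.1 (p.2 - y) * ρ y) ?_
    h.hasCompactSupport.isCompact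
  exact (hd.comp (f := fun q : (ℝ × ℝ) × ℝ => (q.1.1, q.1.2 - q.2)) (by fun_prop)).mul
    (h.smooth.continuous.comp continuous_snd)

theorem measurable_moll {ρ : ℝ → ℝ} (hρ : Measurable ρ) {q : ℝ → ℝ → ℝ}
    (hq : Measurable (uncurry q)) : Measurable (uncurry fun t x => moll ρ (q t) x) := by
  have : StronglyMeasurable fun z : (ℝ × ℝ) × ℝ => q z.1.1 z.2 * ρ (z.1.2 - z.2) :=
    ((hq.comp (by fun_prop : Measurable fun z : (ℝ × ℝ) × ℝ => (z.1.1, z.2))).mul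
      (hρ.comp (by fun_prop))).stronglyMeasurable
  exact this.integral_prod_right'.measurable

/-- A bound on `g` near `x` bounds `g ⋆ ρ` at `x`. -/
theorem IsKernel.abs_moll_le {ρ : ℝ → ℝ} (h : IsKernel ρ) (hs : ∀ y, 1 < |y| → ρ y = 0)
    {g : ℝ → ℝ} {x M : ℝ} (hM : ∀ y, |y| ≤ 1 → |g (x - y)| ≤ M) :
    |moll ρ g x| ≤ M * ∫ y, |ρ y| := by
  rw [moll_eq_integral_sub, ← integral_const_mul]
  have hi : Integrable fun y => M * |ρ y| :=
    (h.smooth.continuous.abs.integrable_of_hasCompactSupport h.hasCompactSupport.abs).const_mul M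
  rw [← Real.norm_eq_abs]
  refine norm_integral_le_of_norm_le hi (Filter.Eventually.of_forall fun y => ?_)
  rw [norm_mul]
  by_cases hy : |y| ≤ 1
  · exact mul_le_mul_of_nonneg_right (hM y hy) (norm_nonneg _)
  · rw [hs y (not_le.1 hy)]; simp

/-! ### Test functions in product form -/

section

variable {η ρ : ℝ → ℝ} (x : ℝ)

theorem IsKernel.isTest_prod (hη : IsKernel η) (hρ : IsKernel ρ) :
    IsTest fun r y => η r * ρ (x - y) := by
  refine ⟨(hη.smooth.comp contDiff_fst).mul (hρ.smooth.comp (contDiff_const.sub contDiff_snd)),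
    HasCompactSupport.intro (K := tsupport η ×ˢ ((fun y => x - y) '' tsupport ρ))
      (hη.hasCompactSupport.isCompact.prod
        (hρ.hasCompactSupport.isCompact.image (by fun_prop))) ?_⟩
  rintro ⟨r, y⟩ hry
  by_cases hr : r ∈ tsupport η
  · have : x - y ∉ tsupport ρ := fun hy => hry ⟨hr, x - y, hy, by simp⟩
    simp [uncurry, image_eq_zero_of_notMem_tsupport this]
  · simp [uncurry, image_eq_zero_of_notMem_tsupport hr]

theorem IsKernel.isTestFunction_prod (hη : IsKernel η) (hρ : IsKernel ρ) {I : Set ℝ}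
    (hI : tsupport η ⊆ I) : IsTestFunction (I ×ˢ univ) fun r y => η r * ρ (x - y) := by
  have h := hη.isTest_prod x hρ
  refine ⟨h.smooth, h.hasCompactSupport, (closure_minimal (t := tsupport η ×ˢ univ) ?_
    ((isClosed_tsupport η).prod isClosed_univ)).trans (prod_mono hI Subset.rfl)⟩
  rintro ⟨r, y⟩ hry
  refine ⟨?_, mem_univ _⟩
  by_contra hr
  exact hry (by simp [uncurry, image_eq_zero_of_notMem_tsupport hr])

theorem dt_prod (t y : ℝ) : dt (fun r y => η r * ρ (x - y)) t y = deriv η t * ρ (x - y) := by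
  simp [dt]

theorem dx_one_prod (hρ : IsKernel ρ) :
    dx 1 (fun r y => η r * ρ (x - y)) = fun t y => -η t * deriv ρ (x - y) := by
  ext t y
  have hd : HasDerivAt ρ (deriv ρ (x - y)) (x - y) :=
    (hρ.smooth.differentiable (by simp) _).hasDerivAt
  have := (hd.comp_const_sub x y).const_mul (η t)
  rw [dx, iteratedDeriv_one, this.deriv]
  ring

theorem dx_two_prod (hρ : IsKernel ρ) :
    dx 2 (fun r y => η r * ρ (x - y)) = fun t y => η t * deriv (deriv ρ) (x - y) := by
  rw [IsTest.dx_two_eq, dx_one_prod x hρ, dx_one_prod (η := fun t => -η t) x hρ.deriv]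
  simp

end

/-! ### Mollified equations for a difference of weak solutions -/

theorem locallyIntegrable_of_bounded {f : ℝ → ℝ} (hf : Measurable f) {C : ℝ}
    (hC : ∀ x, |f x| ≤ C) : LocallyIntegrable f :=
  (locallyIntegrable_const C).mono hf.aestronglyMeasurable
    (Filter.Eventually.of_forall fun x => (hC x).trans (le_abs_self C))

theorem IsKernel.comp_sub {ρ : ℝ → ℝ} (h : IsKernel ρ) (x : ℝ) : IsKernel fun y => ρ (x - y) :=
  ⟨h.smooth.comp (contDiff_const.sub contDiff_id),
    h.hasCompactSupport.comp_homeomorph (Homeomorph.subLeft x)⟩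

theorem IsKernel.integrable_mul {ρ g : ℝ → ℝ} (h : IsKernel ρ) (hg : LocallyIntegrable g) (x : ℝ) :
    Integrable fun y => g y * ρ (x - y) :=
  hg.integrable_smul_right_of_hasCompactSupport (h.comp_sub x).smooth.continuous
    (h.comp_sub x).hasCompactSupport

theorem IsKernel.continuous_moll_slice {ρ g : ℝ → ℝ} (h : IsKernel ρ) (hg : LocallyIntegrable g) :
    Continuous (moll ρ g) :=
  continuous_iff_continuousAt.2 fun x => (h.hasDerivAt_moll hg x).continuousAt

theorem IsKernel.integrable_abs {ρ : ℝ → ℝ} (h : IsKernel ρ) : Integrable fun y => |ρ y| :=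
  (h.smooth.continuous.integrable_of_hasCompactSupport h.hasCompactSupport).abs

theorem IsKernel.abs_moll_le_of_bounded {ρ g : ℝ → ℝ} (h : IsKernel ρ) {C : ℝ}
    (hg : ∀ y, |g y| ≤ C) (x : ℝ) : |moll ρ g x| ≤ C * ∫ y, |ρ y| := by
  rw [moll_eq_integral_sub, ← integral_const_mul, ← Real.norm_eq_abs]
  refine norm_integral_le_of_norm_le (h.integrable_abs.const_mul C)
    (Filter.Eventually.of_forall fun y => ?_)
  rw [norm_mul]
  exact mul_le_mul_of_nonneg_right (hg _) (norm_nonneg _)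

/-- The properties of the difference `d` of two weak solutions of the Parisi PDE that give
uniqueness; `q` stands for `∂_x d`, and `f` for the difference of the nonlinear terms. -/
structure IsDifference (α : ℝ → ℝ) (K L : ℝ) (d q f : ℝ → ℝ → ℝ) : Prop where
  cont : Continuous (uncurry d)
  clamp : ∀ t, d (clamp t) = d t
  measurable_q : Measurable (uncurry q)
  measurable_f : Measurable (uncurry f)
  abs_q_le : ∀ t x, |q t x| ≤ L
  abs_f_le : ∀ t x, |f t x| ≤ K * |q t x|
  K_nonneg : 0 ≤ K
  isWeakDx : IsWeakDx d q
  weak : ∀ φ, IsTestFunction (Ioi 0 ×ˢ univ) φ →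
    ∫ z in strip, (-(d z.1 z.2 * dt φ z.1 z.2) +
      α z.1 * (d z.1 z.2 * dx 2 φ z.1 z.2 + f z.1 z.2 * φ z.1 z.2)) = 0

theorem integrable_bounded_mul {φ : ℝ → ℝ → ℝ} (h : IsTest φ) {f : ℝ → ℝ → ℝ}
    (hf : Measurable (uncurry f)) {C : ℝ} (hC : ∀ t x, |f t x| ≤ C) :
    Integrable fun z : ℝ × ℝ => f z.1 z.2 * φ z.1 z.2 :=
  h.integrable.bdd_mul hf.aestronglyMeasurable (Filter.Eventually.of_forall fun z => hC z.1 z.2)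

namespace IsDifference

variable {α : ℝ → ℝ} {K L : ℝ} {d q f : ℝ → ℝ → ℝ}

theorem L_nonneg (h : IsDifference α K L d q f) : 0 ≤ L := (abs_nonneg _).trans (h.abs_q_le 0 0)

theorem abs_f_le' (h : IsDifference α K L d q f) (t x : ℝ) : |f t x| ≤ K * L :=
  (h.abs_f_le t x).trans (mul_le_mul_of_nonneg_left (h.abs_q_le t x) h.K_nonneg)

theorem cont_slice (h : IsDifference α K L d q f) (t : ℝ) : Continuous (d t) :=
  h.cont.comp (continuous_const.prodMk continuous_id)

theorem locallyIntegrable (h : IsDifference α K L d q f) (t : ℝ) : LocallyIntegrable (d t) :=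
  (h.cont_slice t).locallyIntegrable

theorem locallyIntegrable_q (h : IsDifference α K L d q f) (t : ℝ) : LocallyIntegrable (q t) :=
  locallyIntegrable_of_bounded (h.measurable_q.comp measurable_prodMk_left) (h.abs_q_le t)

theorem locallyIntegrable_f (h : IsDifference α K L d q f) (t : ℝ) : LocallyIntegrable (f t) :=
  locallyIntegrable_of_bounded (h.measurable_f.comp measurable_prodMk_left) (h.abs_f_le' t)

/-- On almost every time slice, `q` is the weak space derivative of `d`. -/
theorem ae_moll_deriv (h : IsDifference α K L d q f) {ρ : ℝ → ℝ} (hρ : IsKernel ρ) :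
    ∀ᵐ r ∂volume.restrict (Icc (0 : ℝ) 1), ∀ x, moll (deriv ρ) (d r) x = moll ρ (q r) x := by
  have hm1 : Measurable (uncurry fun r x => moll (deriv ρ) (d r) x) :=
    (hρ.deriv.continuous_moll h.cont).measurable
  have hm2 : Measurable (uncurry fun r x => moll ρ (q r) x) :=
    measurable_moll hρ.smooth.continuous.measurable h.measurable_q
  have hx : ∀ x, ∀ᵐ r ∂volume.restrict (Icc (0 : ℝ) 1),
      moll (deriv ρ) (d r) x = moll ρ (q r) x := by
    intro x
    have hc1 : Continuous fun r => moll (deriv ρ) (d r) x :=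
      (hρ.deriv.continuous_moll h.cont).comp (Continuous.prodMk_left x)
    have hq1 : LocallyIntegrable fun r => moll ρ (q r) x :=
      locallyIntegrable_of_bounded (hm2.comp measurable_prodMk_right)
        fun r => hρ.abs_moll_le_of_bounded (h.abs_q_le r) x
    have hae : ∀ᵐ r, r ∈ Ioo (0 : ℝ) 1 → moll (deriv ρ) (d r) x - moll ρ (q r) x = 0 := by
      refine isOpen_Ioo.ae_eq_zero_of_integral_contDiff_smul_eq_zero
        ((hc1.locallyIntegrable.sub hq1).locallyIntegrableOn _) fun η hη hηc hηs => ?_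
      have hηk : IsKernel η := ⟨hη, hηc⟩
      have h1 := h.isWeakDx _ (hηk.isTestFunction_prod x hρ hηs)
      have hT := hηk.isTest_prod x hρ
      rw [setIntegral_strip (hT.dx_one.integrable_uncurry_mul h.cont).integrableOn,
        setIntegral_strip (integrable_bounded_mul hT h.measurable_q h.abs_q_le).integrableOn,
        dx_one_prod x hρ] at h1
      have e1 : ∀ r, ∫ y, d r y * (-η r * deriv ρ (x - y)) = -(η r * moll (deriv ρ) (d r) x) := by
        intro r
        rw [moll, ← integral_const_mul, ← integral_neg]
        congr 1; ext y; ring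
      have e2 : ∀ r, ∫ y, q r y * (η r * ρ (x - y)) = η r * moll ρ (q r) x := by
        intro r
        rw [moll, ← integral_const_mul]
        congr 1; ext y; ring
      simp only [e1, e2] at h1
      rw [integral_neg, neg_inj] at h1
      have hi1 : Integrable fun r => η r * moll (deriv ρ) (d r) x :=
        hc1.locallyIntegrable.integrable_smul_left_of_hasCompactSupport hη.continuous hηc
      have hi2 : Integrable fun r => η r * moll ρ (q r) x :=
        hq1.integrable_smul_left_of_hasCompactSupport hη.continuous hηc
      have e3 : ∀ g : ℝ → ℝ, ∫ r, η r * g r = ∫ r in Icc (0 : ℝ) 1, η r * g r := fun g => by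
        rw [setIntegral_eq_integral_of_forall_compl_eq_zero fun r hr => ?_]
        rw [image_eq_zero_of_notMem_tsupport fun hm => hr (Ioo_subset_Icc_self (hηs hm)), zero_mul]
      simp only [smul_eq_mul, mul_sub]
      rw [integral_sub hi1 hi2, e3, e3, h1, sub_self]
    rw [ae_restrict_iff' measurableSet_Icc]
    have hn0 : ∀ᵐ t : ℝ, t ≠ 0 := by simp [ae_iff]
    have hn1 : ∀ᵐ t : ℝ, t ≠ 1 := by simp [ae_iff]
    filter_upwards [hae, hn0, hn1] with t ht h0 h1 htI
    exact sub_eq_zero.1 (ht ⟨lt_of_le_of_ne htI.1 h0.symm, lt_of_le_of_ne htI.2 h1⟩)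
  have hset : MeasurableSet {z : ℝ × ℝ | moll (deriv ρ) (d z.1) z.2 = moll ρ (q z.1) z.2} :=
    measurableSet_eq_fun hm1 hm2
  have hae := (Measure.ae_ae_comm (μ := volume.restrict (Icc (0 : ℝ) 1)) (ν := volume) hset).2
    (Filter.Eventually.of_forall hx)
  filter_upwards [hae] with r hr x
  exact congrFun ((Continuous.ae_eq_iff_eq volume
    (hρ.deriv.continuous_moll_slice (h.locallyIntegrable r))
    (hρ.continuous_moll_slice (h.locallyIntegrable_q r))).1 hr) x

/-- The mollification of `d` in space satisfies the mollified equation in time-integrated form. -/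
theorem moll_eq_integral (h : IsDifference α K L d q f) (hα : Continuous α) {ρ : ℝ → ℝ}
    (hρ : IsKernel ρ) (x : ℝ) : ∀ t ∈ Icc (0 : ℝ) 1, moll ρ (d t) x =
      ∫ r in t..1, α r * (moll (deriv (deriv ρ)) (d r) x + moll ρ (f r) x) := by
  have hfm : Measurable fun r => moll ρ (f r) x :=
    (measurable_moll hρ.smooth.continuous.measurable h.measurable_f).comp measurable_prodMk_right
  refine eq_integral_of_weak ((hρ.continuous_moll h.cont).comp (Continuous.prodMk_left x)) ?_ ?_
  · exact ((((hρ.deriv.deriv.continuous_moll h.cont).comp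
      (Continuous.prodMk_left x)).intervalIntegrable 0 1).add
      (intervalIntegrable_of_bounded hfm
        (fun r => hρ.abs_moll_le_of_bounded (h.abs_f_le' r) x) 0 1)).continuousOn_mul hα.continuousOn
  · intro η hη hηc hηs
    have hηk : IsKernel η := ⟨hη, hηc⟩
    have hT := hηk.isTest_prod x hρ
    have h1 := h.weak _ (hηk.isTestFunction_prod x hρ hηs)
    have hαc : Continuous fun z : ℝ × ℝ => α z.1 := hα.comp continuous_fst
    have i1 := (hT.dt.integrable_uncurry_mul h.cont).neg
    have i2 := hT.dx_two.integrable_mul (w := fun z : ℝ × ℝ => α z.1 * d z.1 z.2) (hαc.mul h.cont)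
    have i3 : Integrable fun z : ℝ × ℝ => f z.1 z.2 * (α z.1 * (η z.1 * ρ (x - z.2))) :=
      (hT.integrable_mul (w := fun z : ℝ × ℝ => α z.1) hαc).bdd_mul
        h.measurable_f.aestronglyMeasurable (Filter.Eventually.of_forall fun z => h.abs_f_le' z.1 z.2)
    rw [setIntegral_strip (F := fun z => -(d z.1 z.2 * dt (fun r y => η r * ρ (x - y)) z.1 z.2) +
      α z.1 * (d z.1 z.2 * dx 2 (fun r y => η r * ρ (x - y)) z.1 z.2 +
        f z.1 z.2 * (η z.1 * ρ (x - z.2))))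
      ((i1.add (i2.add i3)).congr (Filter.Eventually.of_forall fun z => by
        simp only [Pi.add_apply, Pi.neg_apply]; ring)).integrableOn] at h1
    refine Eq.trans ?_ h1
    refine integral_congr_ae (Filter.Eventually.of_forall fun r => ?_)
    simp only [dt_prod, dx_two_prod x hρ]
    have j1 := (hρ.integrable_mul (h.locallyIntegrable r) x).const_mul (-deriv η r)
    have j2 := (hρ.deriv.deriv.integrable_mul (h.locallyIntegrable r) x).const_mul (α r * η r)
    have j3 := (hρ.integrable_mul (h.locallyIntegrable_f r) x).const_mul (α r * η r)
    have e : ∀ y, -(d r y * (deriv η r * ρ (x - y))) + α r * (d r y * (η r * deriv (deriv ρ) (x - y))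
        + f r y * (η r * ρ (x - y))) = -deriv η r * (d r y * ρ (x - y)) +
        (α r * η r * (d r y * deriv (deriv ρ) (x - y)) + α r * η r * (f r y * ρ (x - y))) :=
      fun y => by ring
    simp only [e]
    have j23 : Integrable fun y => α r * η r * (d r y * deriv (deriv ρ) (x - y)) +
        α r * η r * (f r y * ρ (x - y)) := j2.add j3
    rw [integral_add j1 j23, integral_add j2 j3, integral_const_mul, integral_const_mul,
      integral_const_mul]
    simp only [moll]
    ring

end IsDifference

/-! ### The weighted energy identity -/

/-- The weight `(1 + x²)⁻²`, against which functions of linear growth are square integrable. -/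
noncomputable def wt (x : ℝ) : ℝ := ((1 + x ^ 2) ^ 2)⁻¹

/-- The derivative of `wt`. -/
noncomputable def wt' (x : ℝ) : ℝ := -(4 * x * (1 + x ^ 2)) / ((1 + x ^ 2) ^ 2) ^ 2

theorem wt_pos (x : ℝ) : 0 < wt x := by unfold wt; positivity

theorem hasDerivAt_wt (x : ℝ) : HasDerivAt wt (wt' x) x := by
  have h : HasDerivAt (fun x : ℝ => (1 + x ^ 2) ^ 2) (4 * x * (1 + x ^ 2)) x := by
    convert! ((hasDerivAt_pow 2 x).const_add 1).pow 2 using 1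
    simp; ring
  exact h.inv (by positivity)

theorem continuous_wt : Continuous wt :=
  continuous_iff_continuousAt.2 fun x => (hasDerivAt_wt x).continuousAt

theorem continuous_wt' : Continuous wt' :=
  Continuous.div (by fun_prop) (by fun_prop) fun x => by positivity

theorem abs_wt'_le (x : ℝ) : |wt' x| ≤ 2 * wt x := by
  have h1 : |4 * x * (1 + x ^ 2)| ≤ 2 * (1 + x ^ 2) ^ 2 := by
    rw [abs_mul, abs_of_pos (show 0 < 1 + x ^ 2 by positivity)]
    have : |4 * x| ≤ 2 * (1 + x ^ 2) := by
      rw [abs_le]; constructor <;> nlinarith [sq_nonneg (x - 1), sq_nonneg (x + 1)]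
    calc _ ≤ 2 * (1 + x ^ 2) * (1 + x ^ 2) := mul_le_mul_of_nonneg_right this (by positivity)
      _ = _ := by ring
  have h2 : 0 < ((1 + x ^ 2) ^ 2) ^ 2 := by positivity
  rw [wt', wt, abs_div, abs_neg, abs_of_pos h2, div_le_iff₀ h2]
  refine h1.trans (le_of_eq ?_)
  field_simp

theorem wt_mul_le {c a b x : ℝ} (ha : |a| ≤ c * (1 + |x|)) (hb : |b| ≤ c * (1 + |x|)) :
    wt x * (|a| * |b|) ≤ 2 * c ^ 2 * (1 + x ^ 2)⁻¹ := by
  have h1 : |a| * |b| ≤ 2 * c ^ 2 * (1 + x ^ 2) :=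
    calc |a| * |b| ≤ (c * (1 + |x|)) * (c * (1 + |x|)) :=
          mul_le_mul ha hb (abs_nonneg _) ((abs_nonneg _).trans ha)
      _ = c ^ 2 * (1 + |x|) ^ 2 := by ring
      _ ≤ c ^ 2 * (2 * (1 + x ^ 2)) := by
          refine mul_le_mul_of_nonneg_left ?_ (sq_nonneg c)
          nlinarith [sq_nonneg (1 - |x|), sq_abs x]
      _ = _ := by ring
  calc wt x * (|a| * |b|) ≤ wt x * (2 * c ^ 2 * (1 + x ^ 2)) :=
        mul_le_mul_of_nonneg_left h1 (wt_pos x).le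
    _ = _ := by rw [wt]; field_simp

theorem abs_mul_mul_le {κ c a b x : ℝ} (hκ : |κ| ≤ 2 * wt x) (ha : |a| ≤ c * (1 + |x|))
    (hb : |b| ≤ c * (1 + |x|)) : |κ * a * b| ≤ 4 * c ^ 2 * (1 + x ^ 2)⁻¹ := by
  rw [mul_assoc, abs_mul, abs_mul]
  have := wt_mul_le ha hb
  have h2 := mul_le_mul_of_nonneg_right hκ (mul_nonneg (abs_nonneg a) (abs_nonneg b))
  linarith

theorem abs_wt_le (x : ℝ) : |wt x| ≤ 2 * wt x := by
  rw [abs_of_pos (wt_pos x)]; linarith [wt_pos x]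

theorem integrable_const_mul_inv (c : ℝ) : Integrable fun x : ℝ => c * (1 + x ^ 2)⁻¹ :=
  integrable_inv_one_add_sq.const_mul c

theorem integrable_mul_mul {κ a b : ℝ → ℝ} {c : ℝ} (hκ : ∀ x, |κ x| ≤ 2 * wt x)
    (hκc : Continuous κ) (ham : Measurable a) (hbm : Measurable b)
    (ha : ∀ x, |a x| ≤ c * (1 + |x|)) (hb : ∀ x, |b x| ≤ c * (1 + |x|)) :
    Integrable fun x => κ x * a x * b x :=
  (integrable_const_mul_inv (4 * c ^ 2)).mono' ((hκc.measurable.mul ham).mul hbm).aestronglyMeasurable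
    (Filter.Eventually.of_forall fun x => abs_mul_mul_le (hκ x) (ha x) (hb x))

/-- The density of the energy balance after integration by parts in space; here `a`, `b`, `g` stand
for `D`, `∂_x D` and the source. -/
noncomputable def energyDensity (x a b g : ℝ) : ℝ :=
  2 * (-(wt x * b * b) - wt' x * a * b + wt x * a * g)

theorem abs_energyDensity_le {x a b g c : ℝ} (ha : |a| ≤ c * (1 + |x|))
    (hb : |b| ≤ c * (1 + |x|)) (hg : |g| ≤ c * (1 + |x|)) :
    |energyDensity x a b g| ≤ 24 * c ^ 2 * (1 + x ^ 2)⁻¹ := by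
  have h1 := abs_mul_mul_le (abs_wt_le x) hb hb
  have h2 := abs_mul_mul_le (abs_wt'_le x) ha hb
  have h3 := abs_mul_mul_le (abs_wt_le x) ha hg
  rw [abs_le] at *
  unfold energyDensity
  constructor <;> linarith

/-- Completing the square in the energy density. -/
theorem energyDensity_le {x a b g K : ℝ} (hK : 0 ≤ K) (hg : |g| ≤ K * |b|) :
    energyDensity x a b g ≤ (2 + K) ^ 2 / 2 * (wt x * a ^ 2) := by
  have h1 : -(wt' x * a * b) ≤ 2 * wt x * (|a| * |b|) := by
    refine (neg_le_abs _).trans ?_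
    rw [mul_assoc, abs_mul, abs_mul]
    exact mul_le_mul_of_nonneg_right (abs_wt'_le x) (by positivity)
  have h2 : wt x * a * g ≤ wt x * (|a| * (K * |b|)) := by
    refine (le_abs_self _).trans ?_
    rw [mul_assoc, abs_mul, abs_mul, abs_of_pos (wt_pos x)]
    exact mul_le_mul_of_nonneg_left (mul_le_mul_of_nonneg_left hg (abs_nonneg _)) (wt_pos x).le
  have h3 : 0 ≤ wt x * (2 * |b| - (2 + K) * |a|) ^ 2 := mul_nonneg (wt_pos x).le (sq_nonneg _)
  have h4 : wt x * b * b = wt x * |b| ^ 2 := by rw [sq_abs]; ring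
  rw [energyDensity, h4, ← sq_abs a]
  nlinarith

/-- The balance of the weighted energy `∫ wt D²` for a solution of `∂_t D + α (∂_xx D + F) = 0` with
`D(1) = 0`: the product rule in time, followed by integration by parts in space. -/
theorem energy_identity {α : ℝ → ℝ} {D D₁ D₂ F : ℝ → ℝ → ℝ} {A c : ℝ} (hα : Continuous α)
    (hA : ∀ t, |α t| ≤ A) (hD : Continuous (uncurry D)) (hD₁ : Continuous (uncurry D₁))
    (hD₂ : Continuous (uncurry D₂)) (hF : Measurable (uncurry F))
    (hd : ∀ t x, HasDerivAt (D t) (D₁ t x) x) (hd₁ : ∀ t x, HasDerivAt (D₁ t) (D₂ t x) x)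
    (bD : ∀ t x, |D t x| ≤ c * (1 + |x|)) (bD₁ : ∀ t x, |D₁ t x| ≤ c * (1 + |x|))
    (bD₂ : ∀ t x, |D₂ t x| ≤ c * (1 + |x|)) (bF : ∀ t x, |F t x| ≤ c * (1 + |x|))
    (heq : ∀ x, ∀ t ∈ Icc (0 : ℝ) 1, D t x = ∫ r in t..1, α r * (D₂ r x + F r x)) :
    ∀ t ∈ Icc (0 : ℝ) 1, ∫ x, wt x * D t x ^ 2 =
      ∫ r in t..1, α r * ∫ x, energyDensity x (D r x) (D₁ r x) (F r x) := by
  intro t ht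
  set G : ℝ → ℝ → ℝ := fun r x => α r * (2 * (wt x * D r x * D₂ r x + wt x * D r x * F r x)) with hG
  have hGm : Measurable (uncurry G) := by
    have := hD.measurable; have := hD₂.measurable
    have := continuous_wt.measurable; have := hα.measurable
    have e : uncurry G = fun z : ℝ × ℝ => α z.1 * (2 * (wt z.2 * uncurry D z * uncurry D₂ z +
      wt z.2 * uncurry D z * uncurry F z)) := rfl
    rw [e]; fun_prop
  -- the product rule in time on each line `x = const`
  have h1 : ∀ x, wt x * D t x ^ 2 = ∫ r in t..1, G r x := by
    intro x
    have hk : IntervalIntegrable (fun r => α r * (D₂ r x + F r x)) volume 0 1 :=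
      (((hD₂.comp (Continuous.prodMk_left x)).intervalIntegrable 0 1).add
        (intervalIntegrable_of_bounded (hF.comp measurable_prodMk_right)
          (fun r => bF r x) 0 1)).continuousOn_mul hα.continuousOn
    have h0 : D 1 x = 0 := by
      rw [heq x 1 ⟨zero_le_one, le_rfl⟩, intervalIntegral.integral_same]
    have he : ∀ s ∈ Icc (0 : ℝ) 1, D s x = D 1 x + ∫ r in s..1, α r * (D₂ r x + F r x) :=
      fun s hs => by rw [h0, zero_add, heq x s hs]
    have := mul_eq_add_integral (D := fun r => D r x) (E := fun r => D r x) hk hk he he t ht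
    rw [sq, this, h0, mul_zero, zero_add, ← intervalIntegral.integral_const_mul]
    congr 1; ext r; simp only [hG]; ring
  have hGb : ∀ r x, |G r x| ≤ A * (16 * c ^ 2 * (1 + x ^ 2)⁻¹) := by
    intro r x
    rw [hG, abs_mul]
    refine mul_le_mul (hA r) ?_ (abs_nonneg _) ((abs_nonneg _).trans (hA r))
    have h1 := abs_mul_mul_le (abs_wt_le x) (bD r x) (bD₂ r x)
    have h2 := abs_mul_mul_le (abs_wt_le x) (bD r x) (bF r x)
    rw [abs_le] at *
    constructor <;> linarith
  have hGi : Integrable (uncurry G) ((volume.restrict (uIoc t 1)).prod volume) := by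
    rw [uIoc_of_le ht.2]
    have hb := Integrable.mul_prod (μ := volume.restrict (Ioc t 1)) (f := fun _ : ℝ => A)
      (integrable_const A) (integrable_const_mul_inv (16 * c ^ 2))
    exact hb.mono' hGm.aestronglyMeasurable (Filter.Eventually.of_forall fun z => hGb z.1 z.2)
  simp only [h1]
  rw [← intervalIntegral_integral_swap hGi]
  refine intervalIntegral.integral_congr fun r _ => ?_
  -- integration by parts in space on each slice
  simp only [hG]
  rw [integral_const_mul]
  congr 1
  have sl : Continuous fun x : ℝ => (r, x) := by fun_prop
  have mD := (hD.comp sl).measurable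
  have mD₁ := (hD₁.comp sl).measurable
  have mD₂ := (hD₂.comp sl).measurable
  have i1 : Integrable fun x => wt x * D r x * D₂ r x :=
    integrable_mul_mul abs_wt_le continuous_wt mD mD₂ (bD r) (bD₂ r)
  have i2 : Integrable fun x => wt x * D r x * F r x :=
    integrable_mul_mul abs_wt_le continuous_wt mD (hF.comp measurable_prodMk_left) (bD r) (bF r)
  have i3 : Integrable fun x => wt x * D₁ r x * D₁ r x :=
    integrable_mul_mul abs_wt_le continuous_wt mD₁ mD₁ (bD₁ r) (bD₁ r)
  have i4 : Integrable fun x => wt' x * D r x * D₁ r x :=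
    integrable_mul_mul abs_wt'_le continuous_wt' mD mD₁ (bD r) (bD₁ r)
  have i5 : Integrable fun x => wt x * D r x * D₁ r x :=
    integrable_mul_mul abs_wt_le continuous_wt mD mD₁ (bD r) (bD₁ r)
  have e6 : ∀ x, (wt' x * D r x + wt x * D₁ r x) * D₁ r x =
      wt' x * D r x * D₁ r x + wt x * D₁ r x * D₁ r x := fun x => by ring
  have ibp : ∫ x, wt x * D r x * D₂ r x = -∫ x, (wt' x * D r x + wt x * D₁ r x) * D₁ r x :=
    integral_mul_deriv_eq_deriv_mul_of_integrable (u := fun x => wt x * D r x)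
      (fun x _ => (hasDerivAt_wt x).mul (hd r x)) (fun x _ => hd₁ r x) i1
      ((i4.add i3).congr (Filter.Eventually.of_forall fun x => (e6 x).symm)) i5
  simp only [e6] at ibp
  rw [integral_add i4 i3] at ibp
  have i3n : Integrable fun x => -(wt x * D₁ r x * D₁ r x) := i3.neg
  have i34 : Integrable fun x => -(wt x * D₁ r x * D₁ r x) - wt' x * D r x * D₁ r x := i3.neg.sub i4
  simp only [energyDensity]
  rw [integral_const_mul, integral_const_mul, integral_add i1 i2, ibp, integral_add i34 i2,
    integral_sub i3n i4, integral_neg]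
  ring

/-! ### Mollifiers shrinking to a point -/

/-- Bumps of outer radius `1 / (n + 1)`. -/
noncomputable def bump (n : ℕ) : ContDiffBump (0 : ℝ) where
  rIn := 1 / (2 * ((n : ℝ) + 1))
  rOut := 1 / ((n : ℝ) + 1)
  rIn_pos := by positivity
  rIn_lt_rOut := by
    have : (0 : ℝ) < n + 1 := by positivity
    rw [div_lt_div_iff₀ (by positivity) this]; linarith

/-- The associated mollifiers. -/
noncomputable def bumpKernel (n : ℕ) : ℝ → ℝ := (bump n).normed volume

theorem isKernel_bumpKernel (n : ℕ) : IsKernel (bumpKernel n) :=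
  ⟨(bump n).contDiff_normed, (bump n).hasCompactSupport_normed⟩

theorem integral_abs_bumpKernel (n : ℕ) : ∫ y, |bumpKernel n y| = 1 := by
  have h : ∀ y, |bumpKernel n y| = bumpKernel n y := fun y =>
    abs_of_nonneg ((bump n).nonneg_normed y)
  simp only [h]
  exact (bump n).integral_normed

theorem bumpKernel_eq_zero (n : ℕ) {y : ℝ} (hy : 1 < |y|) : bumpKernel n y = 0 := by
  have : y ∉ Function.support (bumpKernel n) := by
    rw [bumpKernel, (bump n).support_normed_eq, mem_ball_zero_iff, Real.norm_eq_abs, not_lt]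
    refine le_trans ?_ hy.le
    have : (0 : ℝ) < n + 1 := by positivity
    change 1 / ((n : ℝ) + 1) ≤ 1
    rw [div_le_one this]; linarith [(Nat.cast_nonneg n : (0 : ℝ) ≤ n)]
  simpa using this

theorem tendsto_rOut_bump : Filter.Tendsto (fun n => (bump n).rOut) Filter.atTop (nhds 0) :=
  tendsto_one_div_add_atTop_nhds_zero_nat

theorem moll_bumpKernel_eq (n : ℕ) (g : ℝ → ℝ) (x : ℝ) : moll (bumpKernel n) g x =
    convolution ((bump n).normed volume) g (ContinuousLinearMap.lsmul ℝ ℝ) volume x := by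
  rw [moll_eq_integral_sub, convolution]
  congr 1; ext y
  rw [ContinuousLinearMap.lsmul_apply, smul_eq_mul, mul_comm]; rfl

theorem tendsto_moll {g : ℝ → ℝ} (hg : Continuous g) (x : ℝ) :
    Filter.Tendsto (fun n => moll (bumpKernel n) g x) Filter.atTop (nhds (g x)) := by
  simp only [moll_bumpKernel_eq]
  exact ContDiffBump.convolution_tendsto_right_of_continuous tendsto_rOut_bump hg x

/-- Lebesgue differentiation. -/
theorem ae_tendsto_moll {g : ℝ → ℝ} (hg : LocallyIntegrable g) : ∀ᵐ x,
    Filter.Tendsto (fun n => moll (bumpKernel n) g x) Filter.atTop (nhds (g x)) := by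
  simp only [moll_bumpKernel_eq]
  refine ContDiffBump.ae_convolution_tendsto_right_of_locallyIntegrable (K := 2) tendsto_rOut_bump
    (Filter.Eventually.of_forall fun n => ?_) hg
  change 1 / ((n : ℝ) + 1) ≤ 2 * (1 / (2 * ((n : ℝ) + 1)))
  refine le_of_eq ?_
  field_simp

/-! ### Uniqueness -/

theorem measurable_energyDensity {X : Type*} [MeasurableSpace X] {x a b g : X → ℝ}
    (hx : Measurable x) (ha : Measurable a) (hb : Measurable b) (hg : Measurable g) :
    Measurable fun z => energyDensity (x z) (a z) (b z) (g z) := by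
  have := continuous_wt.measurable
  have := continuous_wt'.measurable
  unfold energyDensity
  fun_prop

theorem tendsto_energyDensity (x : ℝ) {a b g : ℕ → ℝ} {a₀ b₀ g₀ : ℝ}
    (ha : Filter.Tendsto a Filter.atTop (nhds a₀)) (hb : Filter.Tendsto b Filter.atTop (nhds b₀))
    (hg : Filter.Tendsto g Filter.atTop (nhds g₀)) :
    Filter.Tendsto (fun n => energyDensity x (a n) (b n) (g n)) Filter.atTop
      (nhds (energyDensity x a₀ b₀ g₀)) :=
  (((((hb.const_mul (wt x)).mul hb).neg.sub ((ha.const_mul (wt' x)).mul hb)).add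
    ((ha.const_mul (wt x)).mul hg)).const_mul 2)

namespace IsDifference

variable {α : ℝ → ℝ} {K L : ℝ} {d q f : ℝ → ℝ → ℝ}

theorem abs_moll_deriv_le (h : IsDifference α K L d q f) (n : ℕ) {t : ℝ} (ht : t ∈ Icc (0 : ℝ) 1)
    (x : ℝ) : |moll (deriv (bumpKernel n)) (d t) x| ≤ L := by
  have hρ := isKernel_bumpKernel n
  have hc : Continuous fun r => moll (deriv (bumpKernel n)) (d r) x :=
    (hρ.deriv.continuous_moll h.cont).comp (Continuous.prodMk_left x)
  have hae : (fun r => max |moll (deriv (bumpKernel n)) (d r) x| L)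
      =ᵐ[volume.restrict (Icc 0 1)] fun _ => L := by
    filter_upwards [h.ae_moll_deriv hρ] with r hr
    rw [hr x, max_eq_right]
    simpa [integral_abs_bumpKernel] using hρ.abs_moll_le_of_bounded (h.abs_q_le r) x
  exact max_eq_right_iff.1 (Measure.eqOn_Icc_of_ae_eq volume zero_ne_one hae
    (hc.abs.max continuous_const).continuousOn continuousOn_const ht)

theorem clamp_prop (h : IsDifference α K L d q f) {P : (ℝ → ℝ) → Prop}
    (hP : ∀ t ∈ Icc (0 : ℝ) 1, P (d t)) (t : ℝ) : P (d t) := by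
  rw [← h.clamp t]; exact hP _ (clamp_mem t)

theorem abs_sub_le (h : IsDifference α K L d q f) (t x y : ℝ) : |d t x - d t y| ≤ L * |x - y| := by
  refine h.clamp_prop (P := fun g => |g x - g y| ≤ L * |x - y|) (fun t ht => ?_) t
  have hlim := ((tendsto_moll (h.cont_slice t) x).sub (tendsto_moll (h.cont_slice t) y)).abs
  refine le_of_tendsto' hlim fun n => ?_
  have hd := (isKernel_bumpKernel n).hasDerivAt_moll (h.locallyIntegrable t)
  have := (convex_univ (𝕜 := ℝ) (E := ℝ)).norm_image_sub_le_of_norm_hasDerivWithin_le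
    (fun z _ => (hd z).hasDerivWithinAt) (fun z _ => h.abs_moll_deriv_le n ht z)
    (mem_univ y) (mem_univ x)
  exact this

/-- `d` and its mollifications have linear growth. -/
theorem exists_growth (h : IsDifference α K L d q f) :
    ∃ c, 0 ≤ c ∧ L ≤ c ∧ K * L ≤ c ∧ (∀ t x, |d t x| ≤ c * (1 + |x|)) ∧
      ∀ ρ, IsKernel ρ → (∀ y, 1 < |y| → ρ y = 0) → ∀ t x,
        |moll ρ (d t) x| ≤ (c * ∫ y, |ρ y|) * (1 + |x|) := by
  obtain ⟨B, hB⟩ := isCompact_Icc.exists_bound_of_continuousOn (s := Icc (0 : ℝ) 1)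
    (f := fun t => d t 0) (h.cont.comp (Continuous.prodMk_left 0)).continuousOn
  have hB' : ∀ t, |d t 0| ≤ B := h.clamp_prop (P := fun g => |g 0| ≤ B) hB
  have hB0 : 0 ≤ B := (abs_nonneg _).trans (hB' 0)
  have hL := h.L_nonneg
  have hKL : 0 ≤ K * L := mul_nonneg h.K_nonneg hL
  have hg : ∀ t x, |d t x| ≤ B + L * |x| := fun t x => by
    have h1 := h.abs_sub_le t x 0
    have h2 : |d t x| ≤ |d t x - d t 0| + |d t 0| := by
      simpa using abs_add_le (d t x - d t 0) (d t 0)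
    rw [sub_zero] at h1
    linarith [hB' t]
  refine ⟨B + L + K * L, by positivity, by linarith, by linarith, fun t x => ?_,
    fun ρ hρ hs t x => ?_⟩
  · have := mul_nonneg (add_nonneg hB0 hKL) (abs_nonneg x)
    nlinarith [hg t x]
  · refine (hρ.abs_moll_le (M := (B + L + K * L) * (1 + |x|)) hs fun y hy => ?_).trans
      (le_of_eq (by ring))
    have h1 : |x - y| ≤ |x| + 1 := (abs_sub x y).trans (by linarith)
    have h2 := mul_le_mul_of_nonneg_left h1 hL
    have := mul_nonneg (add_nonneg hB0 hKL) (abs_nonneg x)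
    nlinarith [hg t (x - y)]

/-- The energy identity for the mollifications of `d`. -/
theorem energy_moll (h : IsDifference α K L d q f) (hα : Continuous α) {A : ℝ}
    (hA : ∀ t, |α t| ≤ A) (n : ℕ) : ∀ t ∈ Icc (0 : ℝ) 1,
    ∫ x, wt x * moll (bumpKernel n) (d t) x ^ 2 = ∫ r in t..1, α r *
      ∫ x, energyDensity x (moll (bumpKernel n) (d r) x) (moll (deriv (bumpKernel n)) (d r) x)
        (moll (bumpKernel n) (f r) x) := by
  obtain ⟨c, hc0, -, hKL, -, hmoll⟩ := h.exists_growth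
  have hρ := isKernel_bumpKernel n
  have hs : ∀ y, 1 < |y| → bumpKernel n y = 0 := fun y hy => bumpKernel_eq_zero n hy
  have hs' : ∀ {ρ : ℝ → ℝ}, (∀ y, 1 < |y| → ρ y = 0) → ∀ y, 1 < |y| → deriv ρ y = 0 := by
    intro ρ hρ0 y hy
    have hev : ∀ᶠ z in nhds y, 1 < |z| := continuous_abs.continuousAt.eventually (lt_mem_nhds hy)
    have : ρ =ᶠ[nhds y] fun _ => 0 := hev.mono hρ0
    rw [this.deriv_eq, deriv_const]
  set I₀ := ∫ y, |bumpKernel n y|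
  set I₁ := ∫ y, |deriv (bumpKernel n) y|
  set I₂ := ∫ y, |deriv (deriv (bumpKernel n)) y|
  have h0 : 0 ≤ I₀ := integral_nonneg fun y => abs_nonneg _
  have h1 : 0 ≤ I₁ := integral_nonneg fun y => abs_nonneg _
  have h2 : 0 ≤ I₂ := integral_nonneg fun y => abs_nonneg _
  have hle : ∀ {b : ℝ}, b ≤ I₀ + I₁ + I₂ → ∀ x : ℝ,
      c * b * (1 + |x|) ≤ c * (I₀ + I₁ + I₂) * (1 + |x|) := fun hb x =>
    mul_le_mul_of_nonneg_right (mul_le_mul_of_nonneg_left hb hc0) (by positivity)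
  refine energy_identity (c := c * (I₀ + I₁ + I₂)) hα hA (hρ.continuous_moll h.cont)
    (hρ.deriv.continuous_moll h.cont) (hρ.deriv.deriv.continuous_moll h.cont)
    (measurable_moll hρ.smooth.continuous.measurable h.measurable_f)
    (fun t => hρ.hasDerivAt_moll (h.locallyIntegrable t))
    (fun t => hρ.deriv.hasDerivAt_moll (h.locallyIntegrable t)) (fun t x => ?_) (fun t x => ?_)
    (fun t x => ?_) (fun t x => ?_) (h.moll_eq_integral hα hρ)
  · exact (hmoll _ hρ hs t x).trans (hle (by linarith) x)
  · exact (hmoll _ hρ.deriv (hs' hs) t x).trans (hle (by linarith) x)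
  · exact (hmoll _ hρ.deriv.deriv (hs' (hs' hs)) t x).trans (hle (by linarith) x)
  · refine (hρ.abs_moll_le_of_bounded (h.abs_f_le' t) x).trans ?_
    refine le_trans ?_ (hle (b := I₀) (by linarith) x)
    refine (mul_le_mul_of_nonneg_right hKL h0).trans ?_
    exact le_mul_of_one_le_right (mul_nonneg hc0 h0) (by linarith [abs_nonneg x])

theorem abs_le_linear (h : IsDifference α K L d q f) {c : ℝ} (hL : L ≤ c) {b : ℝ} (hb : |b| ≤ L)
    (x : ℝ) : |b| ≤ c * (1 + |x|) :=
  (hb.trans hL).trans (le_mul_of_one_le_right (h.L_nonneg.trans hL) (by linarith [abs_nonneg x]))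

theorem abs_le_linear' (h : IsDifference α K L d q f) {c : ℝ} (hL : K * L ≤ c) {b : ℝ}
    (hb : |b| ≤ K * L) (x : ℝ) : |b| ≤ c * (1 + |x|) :=
  (hb.trans hL).trans (le_mul_of_one_le_right ((mul_nonneg h.K_nonneg h.L_nonneg).trans hL)
    (by linarith [abs_nonneg x]))

theorem continuous_energy (h : IsDifference α K L d q f) :
    Continuous fun t => ∫ x, wt x * d t x ^ 2 := by
  obtain ⟨c, -, -, -, hd, -⟩ := h.exists_growth
  refine continuous_of_dominated (bound := fun x => 4 * c ^ 2 * (1 + x ^ 2)⁻¹)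
    (fun t => (continuous_wt.mul ((h.cont_slice t).pow 2)).aestronglyMeasurable)
    (fun t => Filter.Eventually.of_forall fun x => ?_) (integrable_const_mul_inv _)
    (Filter.Eventually.of_forall fun x =>
      continuous_const.mul ((h.cont.comp (Continuous.prodMk_left x)).pow 2))
  rw [sq, ← mul_assoc]
  exact abs_mul_mul_le (abs_wt_le x) (hd t x) (hd t x)

/-- The energy identity passes to the limit as the mollification parameter tends to zero. -/
theorem energy_eq (h : IsDifference α K L d q f) (hα : Continuous α) {A : ℝ}
    (hA : ∀ t, |α t| ≤ A) : ∀ t ∈ Icc (0 : ℝ) 1,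
    ∫ x, wt x * d t x ^ 2 = ∫ r in t..1, α r *
      ∫ x, energyDensity x (d r x) (q r x) (f r x) := by
  intro t ht
  obtain ⟨c, hc0, hLc, hKLc, hd, hmoll⟩ := h.exists_growth
  have hDn : ∀ n t x, |moll (bumpKernel n) (d t) x| ≤ c * (1 + |x|) := fun n t x => by
    simpa [integral_abs_bumpKernel] using hmoll _ (isKernel_bumpKernel n)
      (fun y hy => bumpKernel_eq_zero n hy) t x
  have hD1n : ∀ n t x, |moll (deriv (bumpKernel n)) (d t) x| ≤ c * (1 + |x|) := fun n t x =>
    h.abs_le_linear hLc (h.clamp_prop (P := fun g => |moll (deriv (bumpKernel n)) g x| ≤ L)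
      (fun t ht => h.abs_moll_deriv_le n ht x) t) x
  have hFn : ∀ n t x, |moll (bumpKernel n) (f t) x| ≤ c * (1 + |x|) := fun n t x =>
    h.abs_le_linear' hKLc (by simpa [integral_abs_bumpKernel] using
      (isKernel_bumpKernel n).abs_moll_le_of_bounded (h.abs_f_le' t) x) x
  have hGn : ∀ n r x, |energyDensity x (moll (bumpKernel n) (d r) x)
      (moll (deriv (bumpKernel n)) (d r) x) (moll (bumpKernel n) (f r) x)| ≤
      24 * c ^ 2 * (1 + x ^ 2)⁻¹ := fun n r x =>
    abs_energyDensity_le (hDn n r x) (hD1n n r x) (hFn n r x)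
  have hGm : ∀ n, Measurable (uncurry fun r x => energyDensity x (moll (bumpKernel n) (d r) x)
      (moll (deriv (bumpKernel n)) (d r) x) (moll (bumpKernel n) (f r) x)) := fun n =>
    have hρ := isKernel_bumpKernel n
    measurable_energyDensity measurable_snd (hρ.continuous_moll h.cont).measurable
      (hρ.deriv.continuous_moll h.cont).measurable
      (measurable_moll hρ.smooth.continuous.measurable h.measurable_f)
  -- convergence of the left-hand sides
  have hlim1 : Filter.Tendsto (fun n => ∫ x, wt x * moll (bumpKernel n) (d t) x ^ 2) Filter.atTop
      (nhds (∫ x, wt x * d t x ^ 2)) := by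
    refine tendsto_integral_of_dominated_convergence (fun x => 4 * c ^ 2 * (1 + x ^ 2)⁻¹)
      (fun n => ?_) (integrable_const_mul_inv _)
      (fun n => Filter.Eventually.of_forall fun x => ?_)
      (Filter.Eventually.of_forall fun x => ((tendsto_moll (h.cont_slice t) x).pow 2).const_mul _)
    · exact (continuous_wt.mul (((isKernel_bumpKernel n).continuous_moll_slice
        (h.locallyIntegrable t)).pow 2)).aestronglyMeasurable
    · rw [sq, ← mul_assoc]
      exact abs_mul_mul_le (abs_wt_le x) (hDn n t x) (hDn n t x)
  -- convergence of the energy production on almost every time slice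
  have hslice : ∀ᵐ r, r ∈ Icc (0 : ℝ) 1 → Filter.Tendsto
      (fun n => ∫ x, energyDensity x (moll (bumpKernel n) (d r) x)
        (moll (deriv (bumpKernel n)) (d r) x) (moll (bumpKernel n) (f r) x)) Filter.atTop
      (nhds (∫ x, energyDensity x (d r x) (q r x) (f r x))) := by
    rw [← ae_restrict_iff' measurableSet_Icc]
    filter_upwards [ae_all_iff.2 fun n => h.ae_moll_deriv (isKernel_bumpKernel n)] with r hr
    refine tendsto_integral_of_dominated_convergence _
      (fun n => ((hGm n).comp measurable_prodMk_left).aestronglyMeasurable)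
      (integrable_const_mul_inv (24 * c ^ 2))
      (fun n => Filter.Eventually.of_forall fun x => hGn n r x) ?_
    filter_upwards [ae_tendsto_moll (h.locallyIntegrable_q r),
      ae_tendsto_moll (h.locallyIntegrable_f r)] with x hqx hfx
    refine tendsto_energyDensity x (tendsto_moll (h.cont_slice r) x) ?_ hfx
    simpa only [hr] using hqx
  set M := ∫ x : ℝ, 24 * c ^ 2 * (1 + x ^ 2)⁻¹
  have hlim2 : Filter.Tendsto (fun n => ∫ r in t..1, α r *
      ∫ x, energyDensity x (moll (bumpKernel n) (d r) x)
        (moll (deriv (bumpKernel n)) (d r) x) (moll (bumpKernel n) (f r) x)) Filter.atTop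
      (nhds (∫ r in t..1, α r * ∫ x, energyDensity x (d r x) (q r x) (f r x))) := by
    refine intervalIntegral.tendsto_integral_filter_of_dominated_convergence (fun _ => A * M)
      (Filter.Eventually.of_forall fun n => ?_)
      (Filter.Eventually.of_forall fun n => Filter.Eventually.of_forall fun r _ => ?_)
      intervalIntegrable_const ?_
    · exact (hα.stronglyMeasurable.mul
        (hGm n).stronglyMeasurable.integral_prod_right).aestronglyMeasurable
    · rw [norm_mul]
      exact mul_le_mul (hA r) (norm_integral_le_of_norm_le (integrable_const_mul_inv _)
        (Filter.Eventually.of_forall fun x => hGn n r x)) (norm_nonneg _)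
        ((abs_nonneg _).trans (hA r))
    · filter_upwards [hslice] with r hr hrt
      rw [uIoc_of_le ht.2] at hrt
      exact (hr ⟨ht.1.trans hrt.1.le, hrt.2⟩).const_mul _
  refine tendsto_nhds_unique hlim1 (hlim2.congr fun n => ?_)
  exact (h.energy_moll hα hA n t ht).symm

theorem energy_le (h : IsDifference α K L d q f) (hα : Continuous α) {A : ℝ}
    (hα0 : ∀ t, 0 ≤ α t) (hA : ∀ t, α t ≤ A) : ∀ t ∈ Icc (0 : ℝ) 1,
    ∫ x, wt x * d t x ^ 2 ≤
      (A * ((2 + K) ^ 2 / 2)) * ∫ r in t..1, ∫ x, wt x * d r x ^ 2 := by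
  intro t ht
  obtain ⟨c, -, hLc, hKLc, hd, -⟩ := h.exists_growth
  have hA' : ∀ t, |α t| ≤ A := fun t => by rw [abs_of_nonneg (hα0 t)]; exact hA t
  have hG : ∀ r x, |energyDensity x (d r x) (q r x) (f r x)| ≤ 24 * c ^ 2 * (1 + x ^ 2)⁻¹ :=
    fun r x => abs_energyDensity_le (hd r x) (h.abs_le_linear hLc (h.abs_q_le r x) x)
      (h.abs_le_linear' hKLc (h.abs_f_le' r x) x)
  have hGm : Measurable (uncurry fun r x => energyDensity x (d r x) (q r x) (f r x)) :=
    measurable_energyDensity measurable_snd h.cont.measurable h.measurable_q h.measurable_f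
  have hGi : ∀ r, Integrable fun x => energyDensity x (d r x) (q r x) (f r x) := fun r =>
    (integrable_const_mul_inv (24 * c ^ 2)).mono'
      (hGm.comp measurable_prodMk_left).aestronglyMeasurable
      (Filter.Eventually.of_forall fun x => hG r x)
  have hEi : ∀ r, Integrable fun x => wt x * d r x ^ 2 := fun r => by
    simpa only [sq, mul_assoc] using integrable_mul_mul abs_wt_le continuous_wt
      (h.cont_slice r).measurable (h.cont_slice r).measurable (hd r) (hd r)
  have hJm : Measurable fun r => ∫ x, energyDensity x (d r x) (q r x) (f r x) :=
    hGm.stronglyMeasurable.integral_prod_right.measurable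
  have hJi : IntervalIntegrable (fun r => α r * ∫ x, energyDensity x (d r x) (q r x) (f r x))
      volume t 1 :=
    (intervalIntegrable_of_bounded hJm (C := ∫ x : ℝ, 24 * c ^ 2 * (1 + x ^ 2)⁻¹) (fun r => by
      rw [← Real.norm_eq_abs]
      exact norm_integral_le_of_norm_le (integrable_const_mul_inv _)
        (Filter.Eventually.of_forall fun x => hG r x)) t 1).continuousOn_mul hα.continuousOn
  rw [h.energy_eq hα hA' t ht, ← intervalIntegral.integral_const_mul]
  refine intervalIntegral.integral_mono_on ht.2 hJi
    ((h.continuous_energy.intervalIntegrable t 1).const_mul _) fun r _ => ?_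
  have h1 : ∫ x, energyDensity x (d r x) (q r x) (f r x) ≤
      (2 + K) ^ 2 / 2 * ∫ x, wt x * d r x ^ 2 := by
    rw [← integral_const_mul]
    exact integral_mono (hGi r) ((hEi r).const_mul _)
      fun x => energyDensity_le h.K_nonneg (h.abs_f_le r x)
  have hE0 : 0 ≤ ∫ x, wt x * d r x ^ 2 :=
    integral_nonneg fun x => mul_nonneg (wt_pos x).le (sq_nonneg _)
  calc _ ≤ α r * ((2 + K) ^ 2 / 2 * ∫ x, wt x * d r x ^ 2) :=
        mul_le_mul_of_nonneg_left h1 (hα0 r)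
    _ ≤ A * ((2 + K) ^ 2 / 2 * ∫ x, wt x * d r x ^ 2) :=
        mul_le_mul_of_nonneg_right (hA r) (by positivity)
    _ = _ := by ring

theorem eq_zero (h : IsDifference α K L d q f) (hα : Continuous α) {A : ℝ}
    (hα0 : ∀ t, 0 ≤ α t) (hA : ∀ t, α t ≤ A) {t : ℝ} (ht : t ∈ Icc (0 : ℝ) 1) (x : ℝ) :
    d t x = 0 := by
  have hA0 : 0 ≤ A := (hα0 0).trans (hA 0)
  have hE := eq_zero_of_le_integral h.continuous_energy
    (fun t => integral_nonneg fun x => mul_nonneg (wt_pos x).le (sq_nonneg _))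
    (by positivity) (h.energy_le hα hα0 hA) t ht
  obtain ⟨c, -, -, -, hd, -⟩ := h.exists_growth
  have hEi : Integrable fun x => wt x * d t x ^ 2 := by
    simpa only [sq, mul_assoc] using integrable_mul_mul abs_wt_le continuous_wt
      (h.cont_slice t).measurable (h.cont_slice t).measurable (hd t) (hd t)
  rw [integral_eq_zero_iff_of_nonneg (fun x => mul_nonneg (wt_pos x).le (sq_nonneg _)) hEi] at hE
  have h0 : wt x * d t x ^ 2 = 0 := congrFun ((Continuous.ae_eq_iff_eq volume
    (continuous_wt.mul ((h.cont_slice t).pow 2)) continuous_const).1 hE) x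
  simpa [(wt_pos x).ne'] using h0

end IsDifference

/-- An essentially bounded function has a measurable and everywhere bounded representative. -/
theorem EssBounded.exists_bounded {p : ℝ → ℝ → ℝ} (hp : EssBounded p) :
    ∃ (p' : ℝ → ℝ → ℝ) (C : ℝ), Measurable (uncurry p') ∧ (∀ t x, |p' t x| ≤ C) ∧
      ∀ᵐ z ∂volume.restrict strip, p z.1 z.2 = p' z.1 z.2 := by
  obtain ⟨p₀, hp₀, hae⟩ := hp.aestronglyMeasurable
  set C := (eLpNormEssSup (uncurry p) (volume.restrict strip)).toReal
  have hC : 0 ≤ C := ENNReal.toReal_nonneg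
  have hle : ∀ᵐ z ∂volume.restrict strip, |uncurry p z| ≤ C := by
    have hfin : eLpNormEssSup (uncurry p) (volume.restrict strip) ≠ ⊤ := by
      simpa [eLpNorm_exponent_top] using hp.eLpNorm_lt_top.ne
    filter_upwards [enorm_ae_le_eLpNormEssSup (uncurry p) (volume.restrict strip)] with z hz
    have := ENNReal.toReal_mono hfin hz
    simpa using this
  refine ⟨fun t x => max (-C) (min (p₀ (t, x)) C), C,
    measurable_const.max (hp₀.measurable.min measurable_const), fun t x => ?_, ?_⟩
  · rw [abs_le]
    exact ⟨le_max_left _ _, max_le (by linarith) (min_le_right _ _)⟩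
  · filter_upwards [hae, hle] with z h1 h2
    rw [h1, abs_le] at h2
    change uncurry p z = max (-C) (min (p₀ z) C)
    rw [h1, min_eq_left h2.2, max_eq_right h2.1]

/-- Weak solutions normalized to be continuous on the plane and constant in time off `[0,1]`, with
a bounded measurable representative `p` of the weak derivative, and with `ξ''/2` replaced by `α`. -/
structure IsRegularWeakSolution (α : ℝ → ℝ) (μ : Measure unitInterval) (v p : ℝ → ℝ → ℝ) (C : ℝ) :
    Prop where
  cont : Continuous (uncurry v)
  clamp : ∀ t, v (clamp t) = v t
  measurable : Measurable (uncurry p)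
  abs_le : ∀ t x, |p t x| ≤ C
  isWeakDx : IsWeakDx v p
  weak : ∀ φ, IsTestFunction (Ioi 0 ×ˢ univ) φ →
    0 = (∫ z in strip, (-(v z.1 z.2 * dt φ z.1 z.2) +
      α z.1 * (v z.1 z.2 * dx 2 φ z.1 z.2 + distFun μ z.1 * p z.1 z.2 ^ 2 * φ z.1 z.2))) +
      ∫ x, φ 1 x * logCosh x

section

variable {α : ℝ → ℝ} {β : ℕ+ → ℝ} {μ : Measure unitInterval}

theorem IsWeakSolution.exists_regular
    (hαβ : ∀ t ∈ Icc (0 : ℝ) 1, α t = deriv (deriv (mixture β)) t / 2) {v : ℝ → ℝ → ℝ}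
    (hv : IsWeakSolution β μ v) :
    ∃ v' p C, IsRegularWeakSolution α μ v' p C ∧ ∀ t ∈ Icc (0 : ℝ) 1, v' t = v t := by
  obtain ⟨hc, p, hp, hdx, hw⟩ := hv
  obtain ⟨p', C, hm, hb, hae⟩ := hp.exists_bounded
  have heq : ∀ t ∈ Icc (0 : ℝ) 1, v (Parisi.clamp t) = v t := fun t ht => by rw [clamp_of_mem ht]
  refine ⟨fun t => v (Parisi.clamp t), p', C, ⟨?_, fun t => by rw [clamp_clamp], hm, hb, ?_, ?_⟩,
    heq⟩
  · exact hc.comp_continuous (f := fun z : ℝ × ℝ => (Parisi.clamp z.1, z.2))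
      ((continuous_clamp.comp continuous_fst).prodMk continuous_snd)
      fun z => ⟨clamp_mem _, mem_univ _⟩
  · intro φ hφ
    refine Eq.trans ?_ ((hdx φ hφ).trans ?_)
    · exact setIntegral_congr_fun measurableSet_strip fun z hz => by simp only [heq z.1 hz.1]
    · rw [integral_congr_ae]
      filter_upwards [hae] with z hz
      rw [hz]
  · intro φ hφ
    rw [hw φ hφ]
    congr 1
    refine integral_congr_ae ?_
    filter_upwards [hae, ae_restrict_mem measurableSet_strip] with z hz hzs
    rw [hz, heq z.1 hzs.1, hαβ z.1 hzs.1]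

variable [IsProbabilityMeasure μ]

theorem IsRegularWeakSolution.integrable {v p : ℝ → ℝ → ℝ} {C : ℝ} (hα : Continuous α)
    (h : IsRegularWeakSolution α μ v p C) {φ : ℝ → ℝ → ℝ} (hφ : IsTest φ) :
    Integrable fun z : ℝ × ℝ => -(v z.1 z.2 * dt φ z.1 z.2) +
      α z.1 * (v z.1 z.2 * dx 2 φ z.1 z.2 + distFun μ z.1 * p z.1 z.2 ^ 2 * φ z.1 z.2) := by
  have hαc : Continuous fun z : ℝ × ℝ => α z.1 := hα.comp continuous_fst
  have i1 := (hφ.dt.integrable_uncurry_mul h.cont).neg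
  have i2 := hφ.dx_two.integrable_mul (w := fun z : ℝ × ℝ => α z.1 * v z.1 z.2) (hαc.mul h.cont)
  have i3 : Integrable fun z : ℝ × ℝ =>
      (distFun μ z.1 * p z.1 z.2 ^ 2) * (α z.1 * φ z.1 z.2) := by
    refine (hφ.integrable_mul (w := fun z : ℝ × ℝ => α z.1) hαc).bdd_mul (c := 1 * C ^ 2)
      (((distFun_mono μ).measurable.comp measurable_fst).mul
        (h.measurable.pow_const 2)).aestronglyMeasurable (Filter.Eventually.of_forall fun z => ?_)
    rw [norm_mul, norm_pow, Real.norm_eq_abs, Real.norm_eq_abs, abs_of_nonneg (distFun_nonneg μ _)]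
    exact mul_le_mul (distFun_le_one μ _) (pow_le_pow_left₀ (abs_nonneg _) (h.abs_le _ _) 2)
      (by positivity) zero_le_one
  refine (i1.add (i2.add i3)).congr (Filter.Eventually.of_forall fun z => ?_)
  simp only [Pi.add_apply, Pi.neg_apply]; ring

/-- The difference of two weak solutions. -/
theorem IsRegularWeakSolution.isDifference {v p u w : ℝ → ℝ → ℝ} {B C : ℝ} (hα : Continuous α)
    (hv : IsRegularWeakSolution α μ v p B) (hu : IsRegularWeakSolution α μ u w C) :
    IsDifference α (B + C) (B + C) (fun t x => v t x - u t x) (fun t x => p t x - w t x)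
      (fun t x => distFun μ t * (p t x ^ 2 - w t x ^ 2)) where
  cont := hv.cont.sub hu.cont
  clamp t := by rw [hv.clamp, hu.clamp]
  measurable_q := hv.measurable.sub hu.measurable
  measurable_f := ((distFun_mono μ).measurable.comp measurable_fst).mul
    ((hv.measurable.pow_const 2).sub (hu.measurable.pow_const 2))
  abs_q_le t x := (abs_sub _ _).trans (add_le_add (hv.abs_le t x) (hu.abs_le t x))
  abs_f_le t x := by
    rw [sq_sub_sq, abs_mul, abs_mul, abs_of_nonneg (distFun_nonneg μ t)]
    refine (mul_le_of_le_one_left (by positivity) (distFun_le_one μ t)).trans ?_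
    exact mul_le_mul_of_nonneg_right
      ((abs_add_le _ _).trans (add_le_add (hv.abs_le t x) (hu.abs_le t x))) (abs_nonneg _)
  K_nonneg := add_nonneg ((abs_nonneg _).trans (hv.abs_le 0 0)) ((abs_nonneg _).trans (hu.abs_le 0 0))
  isWeakDx φ hφ := by
    have h := hφ.isTest
    simp only [sub_mul]
    rw [integral_sub (h.dx_one.integrable_uncurry_mul hv.cont).integrableOn
        (h.dx_one.integrable_uncurry_mul hu.cont).integrableOn,
      integral_sub (integrable_bounded_mul h hv.measurable hv.abs_le).integrableOn
        (integrable_bounded_mul h hu.measurable hu.abs_le).integrableOn,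
      hv.isWeakDx φ hφ, hu.isWeakDx φ hφ]
    ring
  weak φ hφ := by
    have e : ∀ z : ℝ × ℝ, -((v z.1 z.2 - u z.1 z.2) * dt φ z.1 z.2) +
        α z.1 * ((v z.1 z.2 - u z.1 z.2) * dx 2 φ z.1 z.2 +
          distFun μ z.1 * (p z.1 z.2 ^ 2 - w z.1 z.2 ^ 2) * φ z.1 z.2) =
        (-(v z.1 z.2 * dt φ z.1 z.2) +
          α z.1 * (v z.1 z.2 * dx 2 φ z.1 z.2 + distFun μ z.1 * p z.1 z.2 ^ 2 * φ z.1 z.2)) -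
        (-(u z.1 z.2 * dt φ z.1 z.2) +
          α z.1 * (u z.1 z.2 * dx 2 φ z.1 z.2 + distFun μ z.1 * w z.1 z.2 ^ 2 * φ z.1 z.2)) :=
      fun z => by ring
    simp only [e]
    rw [integral_sub (hv.integrable hα hφ.isTest).integrableOn
      (hu.integrable hα hφ.isTest).integrableOn]
    linarith [hv.weak φ hφ, hu.weak φ hφ]

theorem IsWeakSolution.unique (hα : Continuous α) (hα0 : ∀ t, 0 ≤ α t) {A : ℝ}
    (hA : ∀ t, α t ≤ A) (hαβ : ∀ t ∈ Icc (0 : ℝ) 1, α t = deriv (deriv (mixture β)) t / 2)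
    {v u : ℝ → ℝ → ℝ} (hv : IsWeakSolution β μ v) (hu : IsWeakSolution β μ u) {t : ℝ}
    (ht : t ∈ Icc (0 : ℝ) 1) (x : ℝ) : v t x = u t x := by
  obtain ⟨v', p, B, hv', hveq⟩ := hv.exists_regular hαβ
  obtain ⟨u', w, C, hu', hueq⟩ := hu.exists_regular hαβ
  have := (hv'.isDifference hα hu').eq_zero hα hα0 hA ht x
  rw [← hveq t ht, ← hueq t ht]
  exact sub_eq_zero.1 this

end

end Parisi

theorem mainTheorem2 (β : ℕ+ → ℝ) (hβ : Parisi.Admissible β)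
    (μ : MeasureTheory.Measure unitInterval) [MeasureTheory.IsProbabilityMeasure μ] :
    ∃ u : ℝ → ℝ → ℝ,
      Parisi.IsWeakSolution β μ u ∧
      (∀ v : ℝ → ℝ → ℝ, Parisi.IsWeakSolution β μ v →
        ∀ t ∈ Set.Icc (0 : ℝ) 1, ∀ x : ℝ, v t x = u t x) ∧
      (∀ t ∈ Set.Icc (0 : ℝ) 1, ContDiff ℝ ∞ (u t)) ∧
      (∀ j : ℕ, 1 ≤ j →
        ContinuousOn (Function.uncurry (Parisi.dx j u)) Parisi.strip ∧
        ∃ C : ℝ, ∀ t ∈ Set.Icc (0 : ℝ) 1, ∀ x : ℝ, |Parisi.dx j u t x| ≤ C) ∧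
      (∀ j : ℕ, ∃ q : ℝ → ℝ → ℝ, Parisi.EssBounded q ∧ Parisi.IsWeakDt (Parisi.dx j u) q) ∧
      (∀ j : ℕ, 1 ≤ j → Parisi.IsDifferentiatedWeakSolution β μ j u) ∧
      (∀ t : unitInterval, μ {t} = 0 → ∀ x : ℝ,
        DifferentiableWithinAt ℝ (fun s => u s x) (Set.Icc 0 1) (t : ℝ)) := by
  obtain ⟨hcont, hder, hnn⟩ := hβ.mixture_facts
  -- `ξ''/2`, extended to the line as a constant on each side of `[0,1]`
  set α : ℝ → ℝ := fun t => deriv (deriv (Parisi.mixture β)) (Parisi.clamp t) / 2 with hαdef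
  have hαβ : ∀ t ∈ Icc (0 : ℝ) 1, α t = deriv (deriv (Parisi.mixture β)) t / 2 := fun t ht => by
    rw [hαdef]; simp only [Parisi.clamp_of_mem ht]
  have hα : Continuous α :=
    (hcont.comp_continuous Parisi.continuous_clamp Parisi.clamp_mem).div_const 2
  have hα0 : ∀ t, 0 ≤ α t := fun t => div_nonneg (hnn _ (Parisi.clamp_mem t)) zero_le_two
  obtain ⟨C, hC⟩ := isCompact_Icc.exists_bound_of_continuousOn (s := Icc (0 : ℝ) 1) hα.continuousOn
  have hαC : ∀ t, |α t| ≤ C := fun t => by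
    have := hC _ (Parisi.clamp_mem t)
    simpa only [hαdef, Parisi.clamp_clamp, Real.norm_eq_abs] using this
  have hαle : ∀ t, α t ≤ C := fun t => (le_abs_self _).trans (hαC t)
  have h0 := Parisi.distFun_nonneg μ
  have h1 := Parisi.distFun_le_one μ
  have hm := Parisi.distFun_mono μ
  obtain ⟨U, hU⟩ := Parisi.exists_isPotential (A := deriv (Parisi.mixture β)) (fun t ht => by
    rw [hαβ t ht, mul_div_cancel₀ _ two_ne_zero]; exact hder t ht) hα0 hα ⟨C, hαle⟩ hm h0 h1
  have hsol : Parisi.IsWeakSolution β μ (U 0) := by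
    obtain ⟨B, hB⟩ := hU.tower.bdd 0
    refine ⟨hU.cont_zero.continuousOn, U 1, ?_,
      Parisi.isWeakDx_of_hasDerivAt (hU.cont 0) (hU.cont 1) (hU.hasDerivAt 0), ?_⟩
    · exact memLp_top_of_bound (hU.cont 1).aestronglyMeasurable B
        (Filter.Eventually.of_forall fun z => hB z.1 z.2)
    · simpa only [iteratedDeriv_zero] using hU.weakForm hα hαβ 0
  refine ⟨U 0, hsol, fun v hv t ht x => hv.unique hα hα0 hαle hαβ hsol ht x,
    fun t _ => hU.contDiff t, fun j hj => ?_, fun j => ?_, fun j _ => ?_, fun t ht x => ?_⟩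
  · rw [hU.dx_eq]
    obtain ⟨i, rfl⟩ := Nat.exists_eq_add_of_le' hj
    obtain ⟨B, hB⟩ := hU.tower.bdd i
    exact ⟨(hU.cont _).continuousOn, B, fun t _ x => hB t x⟩
  · rw [hU.dx_eq]
    exact hU.hasWeakDt hα ⟨C, hαC⟩ hm.measurable h0 h1 j
  · refine ⟨?_, ?_, ?_⟩
    · rw [hU.dx_eq]; exact (hU.cont j).continuousOn
    · rw [hU.dx_eq]; exact hU.hasWeakDx j
    · rw [hU.dx_eq, hU.dx_eq]; exact hU.weakForm hα hαβ j
  · exact hU.differentiableWithinAt hα hm.measurable ⟨C, hαC⟩ h0 h1 t.2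
      (Parisi.continuousAt_distFun μ t ht) x
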